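/- **Conventions.** A grid diagram of size $n\ge 2$ is an $n\times n$ grid in which each row and each column contains exactly one $X$ and exactly one $O$, and no square contains both. Joining the $X$ to the $O$ in each column by a vertical segment oriented from $X$ to $O$, and the $O$ to the $X$ in each row by a horizontal segment oriented from $O$ to $X$, with vertical segments passing over horizontal ones, gives an oriented rectangular link diagram $D$. The $X$'s and $O$'s are called punctures. Let $n_\pm$ be the numbers of positive and negative crossings of $D$, $w(D)=n_+-n_-$ the writhe, and $\mathrm{rot}(D)$ the number of counterclockwise minus the number of clockwise Seifert circles of $D$. *Generators.* Along each vertical segment draw a narrow oriented figure-eight with one transversal self-intersection, lying at any height between the two ends of the segment but on no horizontal line through punctures. It winds clockwise around the upper puncture and counterclockwise around the lower puncture of the segment, and it meets a horizontal segment twice (once on each side of the vertical segment) at each crossing and once at each of its two punctures. Let $\mathcal G$ be the set of unordered $n$-tuples of intersection points of figure-eights with horizontal segments such that each figure-eight and each horizontal segment contains exactly one point of the tuple. Let $\mathbf x\in\mathcal G$ consist of the intersection points nearest to the $X$'s. *Gradings.* For $g\in\mathcal G$ let $\overline P(g)$ be the number of points of $g$ at which the figure-eight is oriented upward, and let $T(g)$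 be the number of pairs $(a,b)$ of points of $g$ with $a_1<b_1$ and $a_2<b_2$. For $g,h\in\mathcal G$ let $\gamma(g,h)$ be the family of closed curves running from $g$ to $h$ along the horizontal segments and back from $h$ to $g$ along the figure-eights; $Q$ is defined by the conditions that $Q(g)-Q(h)$ is the sum of the winding numbers of these curves around all punctures, and that $Q(\mathbf x)=0$. Put $$J(g)=2(T(g)-Q(g))-2T(\mathbf x)+\mathrm{rot}(D)+w(D),\qquad P(g)=\overline P(g)-\overline P(\mathbf x)-\mathrm{rot}(D)-w(D).$$ *Jones polynomial.* Let $V(D)(q)\in\mathbb Z[q^{\pm1}]$ be the unnormalized Jones polynomial, with value $(-q-q^{-1})^k$ on the $k$-component unlink: in terms of Kauffman states, $$V(D)(q)=(-1)^{w(D)}\sum_{s} q^{\,b(s)+n_+-2n_-}\,(-q-q^{-1})^{|s|},$$ where $s$ runs over all choices of an $A$- or $B$-smoothing at each crossing, $b(s)$ is the number of $B$-smoothings and $|s|$ the number of circles of $s$. Equivalently, $V(D)(A^{-2})=(-A^3)^{-w(D)}\langle D\rangle$, where $\langle D\rangle$ is the Kauffman bracket with value $1$ on the empty diagram. **Corollary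 (Bigelow).** For every oriented rectangular diagram $D$ of size $n\ge2$ and every choice of the figure-eights as above, $$V(D)(q)=\sum_{g\in\mathcal G}(-1)^{P(g)}q^{J(g)}.$$ -/

import Mathlib

open scoped LaurentPolynomial

/-- A grid diagram of size `n`: column `c` carries its `X` in row `rowX c` and its `O` in row
`rowO c`.  Each row and each column contains exactly one `X` and one `O`, and no square carries
both.  Columns are numbered from left to right and rows from bottom to top. -/
structure GridDiagram (n : ℕ) where
  rowX : Equiv.Perm (Fin n)
  rowO : Equiv.Perm (Fin n)
  ne : ∀ c, rowX c ≠ rowO c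

namespace GridDiagram

variable {n : ℕ} (D : GridDiagram n)

/-! ### The planar rectangular diagram -/

/-- Column of the `X` in row `r`. -/
def colX (r : Fin n) : Fin n := D.rowX.symm r

/-- Column of the `O` in row `r`. -/
def colO (r : Fin n) : Fin n := D.rowO.symm r

/-- Row of the lower end of the vertical segment in column `c`. -/
def lo (c : Fin n) : Fin n := min (D.rowX c) (D.rowO c)

/-- Row of the upper end of the vertical segment in column `c`. -/
def hi (c : Fin n) : Fin n := max (D.rowX c) (D.rowO c)

/-- Column of the left end of the horizontal segment in row `r`. -/
def left (r : Fin n) : Fin n := min (D.colX r) (D.colO r)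

/-- Column of the right end of the horizontal segment in row `r`. -/
def right (r : Fin n) : Fin n := max (D.colX r) (D.colO r)

/-- The direction of the vertical segment in column `c`, oriented from `X` to `O`:
`+1` is upward and `-1` is downward. -/
def vdir (c : Fin n) : ℤ := if D.rowX c < D.rowO c then 1 else -1

/-- The direction of the horizontal segment in row `r`, oriented from `O` to `X`:
`+1` is rightward and `-1` is leftward. -/
def hdir (r : Fin n) : ℤ := if D.colO r < D.colX r then 1 else -1

/-- The vertical segment in column `c` and the horizontal segment in row `r` cross. -/
def IsCrossing (c r : Fin n) : Prop :=
  D.lo c < r ∧ r < D.hi c ∧ D.left r < c ∧ c < D.right r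

instance (c r : Fin n) : Decidable (D.IsCrossing c r) := by
  unfold IsCrossing; infer_instance

/-- The crossings `(column, row)` of the diagram. -/
def Crossing : Type := {p : Fin n × Fin n // D.IsCrossing p.1 p.2}

instance : Fintype D.Crossing := by unfold Crossing; infer_instance

instance : DecidableEq D.Crossing := by unfold Crossing; infer_instance

/-- The sign `w(c)` of a crossing.  The vertical strand, of direction `(0, vdir)`, passes over the
horizontal strand, of direction `(hdir, 0)`; the crossing is positive when the pair
(over direction, under direction) is a positive basis of the plane. -/
def sign (p : D.Crossing) : ℤ := 0 * 0 - D.vdir p.1.1 * D.hdir p.1.2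

/-- The number `n₊` of positive crossings. -/
def nPos : ℕ := (Finset.univ.filter fun p : D.Crossing => D.sign p = 1).card

/-- The number `n₋` of negative crossings. -/
def nNeg : ℕ := (Finset.univ.filter fun p : D.Crossing => D.sign p = -1).card

/-- The writhe `w(D)`. -/
def writhe : ℤ := ∑ p : D.Crossing, D.sign p

/-! ### Resolutions and their circles -/

/-- The two smoothings of a crossing.  Turning the overcrossing strand counterclockwise sweeps two
of the four regions at the crossing; the `A`-smoothing merges these two regions, the `B`-smoothing
merges the two others. -/
inductive Smoothing
  | A
  | B
  deriving DecidableEq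

instance : Fintype Smoothing := ⟨{.A, .B}, fun x => by cases x <;> simp⟩

/-- The four directions at a lattice point. -/
inductive Dir
  | N
  | E
  | S
  | W
  deriving DecidableEq

instance : Fintype Dir := ⟨{.N, .E, .S, .W}, fun x => by cases x <;> simp⟩

/-- Which of the two arcs of a smoothed crossing contains the end of direction `d`.  As the
overcrossing strand is vertical, it sweeps the north-west and south-east regions: the arcs of the
`A`-smoothing are `NE` and `SW`, and the arcs of the `B`-smoothing are `NW` and `SE`. -/
def Smoothing.arc : Smoothing → Dir → Bool
  | .A, .N => true
  | .A, .E => true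
  | .A, .S => false
  | .A, .W => false
  | .B, .N => true
  | .B, .W => true
  | .B, .S => false
  | .B, .E => false

/-- Unit edges of the lattice: `vert c y` joins `(c, y)` to `(c, y + 1)`, and `horiz x r` joins
`(x, r)` to `(x + 1, r)`. -/
inductive UnitEdge (n : ℕ)
  | vert (c y : Fin n)
  | horiz (x r : Fin n)
  deriving DecidableEq, Fintype

/-- `e.Leaves c r d`: the unit edge `e` has an end at the lattice point `(c, r)` and leaves it in
the direction `d`. -/
def UnitEdge.Leaves : UnitEdge n → Fin n → Fin n → Dir → Prop
  | .vert c' y, c, r, .N => c' = c ∧ y = r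
  | .vert c' y, c, r, .S => c' = c ∧ (y : ℕ) + 1 = r
  | .horiz x r', c, r, .E => r' = r ∧ x = c
  | .horiz x r', c, r, .W => r' = r ∧ (x : ℕ) + 1 = c
  | _, _, _, _ => False

/-- The unit edges that make up the rectangular diagram. -/
def Covers : UnitEdge n → Prop
  | .vert c y => D.lo c ≤ y ∧ y < D.hi c
  | .horiz x r => D.left r ≤ x ∧ x < D.right r

/-- The unit edges of the diagram. -/
def Edge : Type := {e : UnitEdge n // D.Covers e}

instance : Finite D.Edge := by unfold Edge; infer_instance

/-- A resolution of the diagram: a smoothing of every crossing. -/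
abbrev Resolution : Type := D.Crossing → Smoothing

variable {D}

/-- Two unit edges of the diagram follow each other in the resolved diagram: they meet at a lattice
point and, if this point is a crossing, they lie on the same arc of its smoothing. -/
def Resolution.Joined (s : D.Resolution) (e f : D.Edge) : Prop :=
  ∃ (c r : Fin n) (d d' : Dir), e.1.Leaves c r d ∧ f.1.Leaves c r d' ∧
    ∀ h : D.IsCrossing c r, (s ⟨(c, r), h⟩).arc d = (s ⟨(c, r), h⟩).arc d'

/-- The circles of a resolution: the connected components of the resolved diagram. -/
def Resolution.Circle (s : D.Resolution) : Type := Quotient (Relation.EqvGen.setoid s.Joined)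

instance (s : D.Resolution) : Finite s.Circle := by unfold Resolution.Circle; infer_instance

noncomputable instance (s : D.Resolution) : Fintype s.Circle := Fintype.ofFinite _

/-- The number of circles of a resolution. -/
noncomputable def Resolution.numCircles (s : D.Resolution) : ℕ := Fintype.card s.Circle

/-- The number of `A`-smoothings of a resolution. -/
def Resolution.numA (s : D.Resolution) : ℕ := (Finset.univ.filter fun p => s p = .A).card

/-- The number of `B`-smoothings of a resolution. -/
def Resolution.numB (s : D.Resolution) : ℕ := (Finset.univ.filter fun p => s p = .B).card

/-! ### The Jones polynomial -/

variable (D)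

/-- Kauffman's bracket polynomial of the diagram at an invertible element `A`, normalized to be `1`
on the empty diagram. -/
noncomputable def kauffmanBracket {R : Type*} [CommRing R] (A : Rˣ) : R :=
  ∑ s : D.Resolution,
    ((A ^ ((s.numA : ℤ) - s.numB) : Rˣ) : R) *
      (-((A ^ (2 : ℤ) : Rˣ) : R) - ((A ^ (-2 : ℤ) : Rˣ) : R)) ^ s.numCircles

/-- The (unnormalized) Jones polynomial `V(D)(q)`, a Laurent polynomial in `q = t ^ (1/2)`, through
Kauffman states.  The unlink of `k` components has the value `(-q - q⁻¹) ^ k`.  It is Kauffman's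
normalized bracket `(-A ^ 3) ^ (-w(D)) ⟨D⟩` with `q = A ^ (-2)`; the theorem `eval_jonesPolynomial`
below checks this. -/
noncomputable def jonesPolynomial : ℤ[T;T⁻¹] :=
  LaurentPolynomial.C ((D.writhe.negOnePow : ℤˣ) : ℤ) *
    ∑ s : D.Resolution,
      LaurentPolynomial.T ((s.numB : ℤ) + D.nPos - 2 * D.nNeg) *
        (-LaurentPolynomial.T 1 - LaurentPolynomial.T (-1)) ^ s.numCircles

theorem sign_eq (p : D.Crossing) : D.sign p = 1 ∨ D.sign p = -1 := by
  unfold sign vdir hdir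
  split_ifs <;> simp

theorem writhe_eq : D.writhe = D.nPos - D.nNeg := by
  have h : ∀ p : D.Crossing,
      D.sign p = (if D.sign p = 1 then 1 else 0) - (if D.sign p = -1 then 1 else 0) := by
    intro p
    rcases D.sign_eq p with h | h <;> simp [h]
  unfold writhe nPos nNeg
  rw [Finset.sum_congr rfl fun p _ => h p, Finset.sum_sub_distrib]
  simp

theorem numA_add_numB (s : D.Resolution) : s.numA + s.numB = D.nPos + D.nNeg := by
  have h1 : s.numA + s.numB = Fintype.card D.Crossing := by
    unfold Resolution.numA Resolution.numB
    rw [← Finset.card_univ,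
      ← Finset.card_filter_add_card_filter_not (s := Finset.univ) (fun p => s p = .A)]
    refine congrArg₂ _ rfl (congrArg Finset.card (Finset.ext fun p => ?_))
    cases h : s p <;> simp [h]
  have h2 : D.nPos + D.nNeg = Fintype.card D.Crossing := by
    unfold nPos nNeg
    rw [← Finset.card_univ,
      ← Finset.card_filter_add_card_filter_not (s := Finset.univ) (fun p => D.sign p = 1)]
    refine congrArg₂ _ rfl (congrArg Finset.card (Finset.ext fun p => ?_))
    rcases D.sign_eq p with h | h <;> simp [h]
  rw [h1, h2]

/-- The Jones polynomial is Kauffman's normalized bracket under the substitution `q = A ^ (-2)`. -/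
theorem eval_jonesPolynomial {R : Type*} [CommRing R] (A : Rˣ) :
    LaurentPolynomial.eval₂ (Int.castRingHom R) (A ^ (-2 : ℤ)) D.jonesPolynomial =
      (((-A ^ 3) ^ (-D.writhe) : Rˣ) : R) * D.kauffmanBracket A := by
  have hw := D.writhe_eq
  have e1 : ((-A ^ 3) ^ (-D.writhe) : Rˣ) =
      (-1) ^ D.writhe * A ^ (-3 * D.writhe) := by
    rw [neg_eq_neg_one_mul, mul_zpow, zpow_neg, ← inv_zpow, ← zpow_natCast, ← zpow_mul]
    congr 2
    simp
  have e2 : (((D.writhe.negOnePow : ℤˣ) : ℤ) : R) = (((-1) ^ D.writhe : Rˣ) : R) := by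
    rcases Int.even_or_odd D.writhe with h | h
    · simp [Int.negOnePow_even _ h, h.neg_one_zpow]
    · simp [Int.negOnePow_odd _ h, h.neg_one_zpow]
  unfold jonesPolynomial kauffmanBracket
  rw [map_mul, map_sum, LaurentPolynomial.eval₂_C, e1, Units.val_mul, mul_assoc, eq_intCast, e2]
  congr 1
  rw [Finset.mul_sum]
  refine Finset.sum_congr rfl fun s _ => ?_
  have hs := D.numA_add_numB s
  rw [map_mul, map_pow, map_sub, map_neg, LaurentPolynomial.eval₂_T, LaurentPolynomial.eval₂_T,
    LaurentPolynomial.eval₂_T, ← mul_assoc, ← Units.val_mul, ← zpow_mul, ← zpow_mul, ← zpow_mul,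
    ← zpow_add]
  congr 2
  · congr 2
    push_cast [hw]
    zify at hs
    linarith
  · norm_num
    ring

/-! ### Seifert circles and the rotation number -/

/-- The oriented resolution.  At a positive crossing (vertical strand up and horizontal strand to the
left, or the reverse of both) the arcs respecting the orientations are `NE` and `SW`; at a negative
crossing they are `NW` and `SE`. -/
def orientedResolution : D.Resolution := fun p => if D.sign p = 1 then .A else .B

/-- The Seifert circles of the diagram. -/
abbrev SeifertCircle : Type := D.orientedResolution.Circle

open Classical in
/-- The area enclosed by a Seifert circle, counted positively for a counterclockwise circle and
negatively for a clockwise one: the integral of `x dy` along the oriented circle. -/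
noncomputable def signedArea (C : D.SeifertCircle) : ℤ :=
  ∑ c : Fin n, ∑ y : Fin n,
    if ∃ h : D.Covers (.vert c y), (Quotient.mk _ ⟨.vert c y, h⟩ : D.SeifertCircle) = C then
      (c : ℤ) * D.vdir c
    else 0

/-- The rotation number: the number of counterclockwise Seifert circles minus the number of
clockwise ones. -/
noncomputable def rot : ℤ := ∑ C : D.SeifertCircle, if 0 < D.signedArea C then 1 else -1

/-! ### Figure-eights

The plane is drawn on the integer lattice at scale four: the square in column `c` and row `r` has
its centre at `(4 c, 4 r)`. -/

/-- The centre of the square in column `c` and row `r`. -/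
def center (c r : Fin n) : ℤ × ℤ := (4 * (c : ℤ), 4 * (r : ℤ))

/-- The punctures: the set of all `X`'s and `O`'s. -/
def punctures : Finset (ℤ × ℤ) :=
  Finset.univ.image (fun c => center c (D.rowX c)) ∪ Finset.univ.image (fun c => center c (D.rowO c))

/-- A choice of figure-eights, one along each vertical segment: the self-intersection of the
figure-eight in column `c` lies between the rows `cut c` and `cut c + 1`. -/
structure FigureEights where
  cut : Fin n → ℕ
  lo_le_cut : ∀ c, (D.lo c : ℕ) ≤ cut c
  cut_lt_hi : ∀ c, cut c < (D.hi c : ℕ)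

/-- The two sides of a vertical segment. -/
inductive Side
  | L
  | R
  deriving DecidableEq

instance : Fintype Side := ⟨{.L, .R}, fun x => by cases x <;> simp⟩

/-- Horizontal displacement of the sides of a figure-eight. -/
def Side.offset : Side → ℤ
  | .L => -1
  | .R => 1

/-- The point of row `r` on the given side of the vertical segment in column `c`. -/
def sidePoint (c r : Fin n) (ε : Side) : ℤ × ℤ := (4 * (c : ℤ) + ε.offset, 4 * (r : ℤ))

/-- `𝒵`: the figure-eight in column `c` meets the horizontal segment in row `r` at a point on the
side `ε`.  (There are two such points near a crossing and one near each puncture.) -/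
def IsIntersection (c r : Fin n) (ε : Side) : Prop :=
  D.lo c ≤ r ∧ r ≤ D.hi c ∧
    4 * (D.left r : ℤ) < 4 * (c : ℤ) + ε.offset ∧ 4 * (c : ℤ) + ε.offset < 4 * (D.right r : ℤ)

instance (c r : Fin n) (ε : Side) : Decidable (D.IsIntersection c r ε) := by
  unfold IsIntersection; infer_instance

/-- A choice of one position on each figure-eight, each row being used exactly once: the position on
the figure-eight in column `c` is in row `row c`, on the side `side c`. -/
structure Tuple (n : ℕ) where
  row : Equiv.Perm (Fin n)
  side : Fin n → Side
  deriving DecidableEq, Fintype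

/-- The set `𝒢` of Bigelow generators: the tuples of intersection points of figure-eights and
horizontal segments containing exactly one point of each figure-eight and of each horizontal
segment. -/
def generators : Finset (Tuple n) :=
  Finset.univ.filter fun g => ∀ c, D.IsIntersection c (g.row c) (g.side c)

/-- The generator `𝐱`: the points of `𝒵` nearest to the `X`'s. -/
def genX : Tuple n where
  row := D.rowX
  side c := if c < D.colO (D.rowX c) then .R else .L

/-- The position of a tuple on the figure-eight of column `c`. -/
def Tuple.pt (g : Tuple n) (c : Fin n) : ℤ × ℤ := sidePoint c (g.row c) (g.side c)

/-- The position of a tuple on the horizontal segment of row `r`. -/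
def Tuple.ptOfRow (g : Tuple n) (r : Fin n) : ℤ × ℤ := g.pt (g.row.symm r)

/-- The finite set of points of a tuple. -/
def Tuple.points (g : Tuple n) : Finset (ℤ × ℤ) := Finset.univ.image g.pt

/-! ### The gradings -/

/-- The number of pairs `(a, b)` in `A × B` with `a` strictly to the left of and strictly below
`b`. -/
def countI (A B : Finset (ℤ × ℤ)) : ℕ :=
  ((A ×ˢ B).filter fun p => p.1.1 < p.2.1 ∧ p.1.2 < p.2.2).card

/-- The grading `T`. -/
def Tuple.T (g : Tuple n) : ℤ := countI g.points g.points

/-- The contribution of the straight oriented edge from `a` to `b` to the winding number around `p`: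
its signed crossing with the horizontal half-line going from `p` to the right. -/
def edgeWinding (p a b : ℤ × ℤ) : ℤ :=
  let det := (b.1 - a.1) * (p.2 - a.2) - (b.2 - a.2) * (p.1 - a.1)
  if a.2 ≤ p.2 ∧ p.2 < b.2 ∧ 0 < det then 1
  else if b.2 ≤ p.2 ∧ p.2 < a.2 ∧ det < 0 then -1
  else 0

/-- The sum of the contributions of the edges of a polygonal path. -/
def pathWinding (p : ℤ × ℤ) : List (ℤ × ℤ) → ℤ
  | a :: b :: l => edgeWinding p a b + pathWinding p (b :: l)
  | _ => 0

variable {D}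

/-- The vertices of the figure-eight in column `c`, a closed polygon, in the order of its
orientation: clockwise around the upper puncture and counterclockwise around the lower one, with the
self-intersection at height `4 * cut c + 2`. -/
def FigureEights.vertices (F : D.FigureEights) (c : Fin n) : List (ℤ × ℤ) :=
  let x : ℤ := 4 * (c : ℤ)
  let b : ℤ := 4 * (D.lo c : ℤ) - 1
  let t : ℤ := 4 * (D.hi c : ℤ) + 1
  let s : ℤ := 4 * (F.cut c : ℤ) + 2
  [(x - 1, b), (x + 1, b), (x + 1, s - 1), (x - 1, s + 1),
    (x - 1, t), (x + 1, t), (x + 1, s + 1), (x - 1, s - 1)]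

/-- The index of the edge of the figure-eight in column `c`, namely the edge arriving at this vertex
in the cyclic order, that contains the position in row `r` on the side `ε`. -/
def FigureEights.edgeIndex (F : D.FigureEights) (c r : Fin n) : Side → ℕ
  | .R => if F.cut c < r then 6 else 2
  | .L => if F.cut c < r then 4 else 8

/-- The part of the figure-eight in column `c` from its first vertex, along its orientation, to the
position in row `r` on the side `ε`. -/
def FigureEights.arcTo (F : D.FigureEights) (c r : Fin n) (ε : Side) : List (ℤ × ℤ) :=
  (F.vertices c).take (F.edgeIndex c r ε) ++ [sidePoint c r ε]

/-- `p(z)`: it is `1` if the figure-eight is oriented upward at `z` and `0` otherwise.  It is oriented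
upward on the left above the self-intersection, and on the right below it. -/
def FigureEights.p (F : D.FigureEights) (c r : Fin n) : Side → ℤ
  | .L => if F.cut c < r then 1 else 0
  | .R => if F.cut c < r then 0 else 1

/-- The grading `P̄`. -/
def FigureEights.Pbar (F : D.FigureEights) (g : Tuple n) : ℤ :=
  ∑ c, F.p c (g.row c) (g.side c)

/-- A path from the point of `h` to the point of `g` along the figure-eight in column `c`, through the
first vertex of the figure-eight.  (Two such paths differ, up to homotopy, by turns around the
figure-eight, which winds `-1` times around one puncture and `+1` times around another one.) -/
def FigureEights.pathAlong (F : D.FigureEights) (h g : Tuple n) (c : Fin n) : List (ℤ × ℤ) :=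
  (F.arcTo c (h.row c) (h.side c)).reverse ++ F.arcTo c (g.row c) (g.side c)

/-- The relative grading `Q(g) - Q(h)`: the total winding number around the punctures of the closed
curves `γ(g, h)` that go from `g` to `h` along the horizontal segments and back from `h` to `g` along
the figure-eights. -/
def FigureEights.Qrel (F : D.FigureEights) (g h : Tuple n) : ℤ :=
  ∑ p ∈ D.punctures,
    (∑ r, pathWinding p [g.ptOfRow r, h.ptOfRow r] + ∑ c, pathWinding p (F.pathAlong h g c))

/-- The grading `Q`, normalized by `Q(𝐱) = 0`. -/
def FigureEights.Q (F : D.FigureEights) (g : Tuple n) : ℤ := F.Qrel g D.genX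

/-- The Jones grading `J`. -/
noncomputable def FigureEights.J (F : D.FigureEights) (g : Tuple n) : ℤ :=
  2 * (g.T - F.Q g) - 2 * D.genX.T + D.rot + D.writhe

/-- The homological grading `P`. -/
noncomputable def FigureEights.P (F : D.FigureEights) (g : Tuple n) : ℤ :=
  F.Pbar g - F.Pbar D.genX - D.rot - D.writhe

end GridDiagram

/-! The Jones polynomial is turned into a vertex model on the rectangular diagram, and its nonzero
configurations are matched with the horizontal positions of Bigelow's generators.

Substitute q = -T^4; the ring map `subst` is injective, so nothing is lost. A circle then has the
value T^4 + T^(-4). By Hopf's Umlaufsatz for lattice curves (`LatticeCycle.turning_eq_sign_area`),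
this is the sum of T^(total turning in quarter turns) over the two orientations of the circle. So
the Kauffman sum runs over resolutions with oriented circles, that is, over pairs of a resolution
and a consistent flow of signs on the unit edges (`Resolution.sum_consistent`). The total turning is
a sum of contributions of corners and crossings. For a fixed flow the smoothings can therefore be
summed crossing by crossing (`sum_resolution`).

The resulting weight of a crossing is computed in `crossingWeight_eq`. A flow that enters a crossing
vertically from both sides and leaves it horizontally on both sides has weight zero, since its two
smoothings cancel. Hence in a flow of nonzero weight every column switches exactly once, from
downward to upward, and every row exactly once, from rightward to leftward. The switches of columns
and rows sit at the same points, so these flows are the permutations whose points lie on the diagram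
(`exists_flowOf`).

The weight of such a flow is a power of -T^4, counting the crossings passed in one of the two
straight ways, times factors at the points of the permutation. An inclusion-exclusion count
(`exists_negativeStraight_eq`) replaces this number by a constant, plus twice the number of
noninversions, plus terms attached to single points. So the weight is a constant times `permWeight`.

On the other side, T(g) is the number of noninversions, and Q(g) is a sum over columns: up to a
constant of the column, it counts the punctures to the lower left of the point and adds a correction
from the figure-eight itself (`FigureEights.arcWinding_eq`). Adding up the available sides of a
position gives the local factor of `permWeight` (`FigureEights.sum_sideWeight`); at a crossing both
sides occur and give 1 - T^(-8).

Both sides are thus constants times the same sum of `permWeight`. The constants agree because they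
agree at the permutation of the X's: there the flow is the orientation of the diagram, with turning
4 rot(D), the only generator is 𝐱, and the weight is a unit. -/

namespace GridDiagram

/-! ### Lattice directions -/

namespace Dir

def opp : Dir → Dir
  | .N => .S
  | .S => .N
  | .E => .W
  | .W => .E

/-- Clockwise quarter turn. -/
def rotR : Dir → Dir
  | .N => .E
  | .E => .S
  | .S => .W
  | .W => .N

def vec : Dir → ℤ × ℤ
  | .N => (0, 1)
  | .S => (0, -1)
  | .E => (1, 0)
  | .W => (-1, 0)

/-- The turn, in counterclockwise quarter turns, of a path heading first `d` and then `d'`. -/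
def turn : Dir → Dir → ℤ
  | .E, .N => 1
  | .N, .W => 1
  | .W, .S => 1
  | .S, .E => 1
  | .N, .E => -1
  | .E, .S => -1
  | .S, .W => -1
  | .W, .N => -1
  | _, _ => 0

@[simp] theorem opp_opp (d : Dir) : d.opp.opp = d := by cases d <;> rfl

theorem vec_opp (d : Dir) : d.opp.vec = -d.vec := by cases d <;> rfl

theorem turn_opp_opp (d e : Dir) : turn e.opp d.opp = -turn d e := by
  cases d <;> cases e <;> rfl

end Dir

/-! ### Quarter turns of nonzero lattice vectors -/

/-- The (half-open) quadrant containing a nonzero vector. -/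
def quad (v : ℤ × ℤ) : ℤ :=
  if 0 < v.1 ∧ 0 ≤ v.2 then 0 else if v.1 ≤ 0 ∧ 0 < v.2 then 1
  else if v.1 < 0 ∧ v.2 ≤ 0 then 2 else 3

/-- The number of counterclockwise quarter turns, between `-1` and `2`, from `v` to `w`. -/
def quarterTurn (v w : ℤ × ℤ) : ℤ := (quad w - quad v + 1) % 4 - 1

/-- Inside two adjacent quadrants `quarterTurn` is a difference of values of one angle function,
hence independent of the path. -/
theorem quarterTurn_square_of_quad {v w x y : ℤ × ℤ} {a b : ℤ}
    (hab : (b = a + 1) ∨ (a = 0 ∧ b = 3))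
    (hv : quad v = a ∨ quad v = b) (hw : quad w = a ∨ quad w = b)
    (hx : quad x = a ∨ quad x = b) (hy : quad y = a ∨ quad y = b) :
    quarterTurn v w + quarterTurn w y = quarterTurn v x + quarterTurn x y := by
  unfold quarterTurn
  rcases hab with rfl | ⟨rfl, rfl⟩ <;> rcases hv with h | h <;> rcases hw with h' | h' <;>
    rcases hx with h'' | h'' <;> rcases hy with h3 | h3 <;> rw [h, h', h'', h3] <;> omega

theorem quad_of_fst_pos {v : ℤ × ℤ} (h : 0 < v.1) : quad v = 0 ∨ quad v = 3 := by
  unfold quad; split_ifs <;> omega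

theorem quad_of_fst_neg {v : ℤ × ℤ} (h : v.1 < 0) : quad v = 1 ∨ quad v = 2 := by
  unfold quad; split_ifs <;> omega

theorem quad_of_snd_pos {v : ℤ × ℤ} (h : 0 < v.2) : quad v = 0 ∨ quad v = 1 := by
  unfold quad; split_ifs <;> omega

theorem quad_of_snd_neg {v : ℤ × ℤ} (h : v.2 < 0) : quad v = 2 ∨ quad v = 3 := by
  unfold quad; split_ifs <;> omega

/-- The finitely many configurations left when the two lattice points are equal or neighbours,
diagonally included; `w` is twice their difference. -/
theorem quarterTurn_square_small : ∀ m k : Fin 3, ∀ a a' b b' : Dir,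
    let w : ℤ × ℤ := (2 * ((m : ℕ) : ℤ) - 2, 2 * ((k : ℕ) : ℤ) - 2)
    a' ≠ a.opp → b' ≠ b.opp → (w = 0 → ¬(a' = a ∧ b' = b)) →
    w - b.vec + a.vec ≠ 0 → w - b.vec - a'.vec ≠ 0 → w + b'.vec + a.vec ≠ 0 →
    w + b'.vec - a'.vec ≠ 0 →
    quarterTurn (w - b.vec + a.vec) (w + b'.vec + a.vec) +
        quarterTurn (w + b'.vec + a.vec) (w + b'.vec - a'.vec) =
      quarterTurn (w - b.vec + a.vec) (w - b.vec - a'.vec) +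
        quarterTurn (w - b.vec - a'.vec) (w + b'.vec - a'.vec) := by
  decide +kernel

theorem Dir.vec_bound (d : Dir) : -1 ≤ d.vec.1 ∧ d.vec.1 ≤ 1 ∧ -1 ≤ d.vec.2 ∧ d.vec.2 ≤ 1 := by
  cases d <;> decide

/-- The secant vectors of two disjoint lattice arcs, which pass through lattice points of difference
`w`, do not turn around the origin. -/
theorem quarterTurn_square (w : ℤ × ℤ) (a a' b b' : Dir) (ha : a' ≠ a.opp) (hb : b' ≠ b.opp)
    (hw : w = 0 → ¬(a' = a ∧ b' = b))
    (h1 : (w + w) - b.vec + a.vec ≠ 0) (h2 : (w + w) - b.vec - a'.vec ≠ 0)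
    (h3 : (w + w) + b'.vec + a.vec ≠ 0) (h4 : (w + w) + b'.vec - a'.vec ≠ 0) :
    quarterTurn ((w + w) - b.vec + a.vec) ((w + w) + b'.vec + a.vec) +
        quarterTurn ((w + w) + b'.vec + a.vec) ((w + w) + b'.vec - a'.vec) =
      quarterTurn ((w + w) - b.vec + a.vec) ((w + w) - b.vec - a'.vec) +
        quarterTurn ((w + w) - b.vec - a'.vec) ((w + w) + b'.vec - a'.vec) := by
  obtain ⟨a1, a2, a3, a4⟩ := a.vec_bound
  obtain ⟨a1', a2', a3', a4'⟩ := a'.vec_bound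
  obtain ⟨b1, b2, b3, b4⟩ := b.vec_bound
  obtain ⟨b1', b2', b3', b4'⟩ := b'.vec_bound
  -- If a coordinate of `w` is at least 2 in absolute value, the four secants stay in an open
  -- half-plane, because directions change `w + w` by at most 2 in each coordinate.
  by_cases c1 : 2 ≤ w.1
  · apply quarterTurn_square_of_quad (a := 0) (b := 3) (by simp) <;> apply quad_of_fst_pos <;>
      simp only [Prod.fst_add, Prod.fst_sub] <;> omega
  by_cases c2 : w.1 ≤ -2
  · apply quarterTurn_square_of_quad (a := 1) (b := 2) (by simp) <;> apply quad_of_fst_neg <;>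
      simp only [Prod.fst_add, Prod.fst_sub] <;> omega
  by_cases c3 : 2 ≤ w.2
  · apply quarterTurn_square_of_quad (a := 0) (b := 1) (by simp) <;> apply quad_of_snd_pos <;>
      simp only [Prod.snd_add, Prod.snd_sub] <;> omega
  by_cases c4 : w.2 ≤ -2
  · apply quarterTurn_square_of_quad (a := 2) (b := 3) (by simp) <;> apply quad_of_snd_neg <;>
      simp only [Prod.snd_add, Prod.snd_sub] <;> omega
  have key := quarterTurn_square_small ⟨(w.1 + 1).toNat, by omega⟩ ⟨(w.2 + 1).toNat, by omega⟩
    a a' b b'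
  have e : ((2 * (((⟨(w.1 + 1).toNat, by omega⟩ : Fin 3) : ℕ) : ℤ) - 2,
      2 * (((⟨(w.2 + 1).toNat, by omega⟩ : Fin 3) : ℕ) : ℤ) - 2) : ℤ × ℤ) = w + w := by
    ext <;> simp <;> omega
  simp only [e] at key
  refine key ha hb (fun h => hw ?_) h1 h2 h3 h4
  have := congrArg Prod.fst h
  have := congrArg Prod.snd h
  simp only [Prod.fst_add, Prod.snd_add, Prod.fst_zero, Prod.snd_zero] at *
  ext <;> simp <;> omega

/-- Quarter turns along the tangents of a lattice path. -/
theorem quarterTurn_tangent : ∀ a b c : Dir, b ≠ a.opp → c ≠ b.opp →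
    quarterTurn (a.vec + b.vec) (a.vec + b.vec + (b.vec + c.vec)) +
        quarterTurn (a.vec + b.vec + (b.vec + c.vec)) (b.vec + c.vec) =
      Dir.turn a b + (min (Dir.turn b c) 0 - min (Dir.turn a b) 0) := by
  decide +kernel

/-! ### Sums over a triangle -/

theorem sum_triangle_aux (u h : ℕ → ℕ → ℤ) (a m j : ℕ) (ham : a ≤ m)
    (hsq : ∀ i, a ≤ i → i < m → u i j + h i (j + 1) = h i j + u (i + 1) j) :
    u a j + ∑ i ∈ Finset.Ico a m, h i (j + 1) = ∑ i ∈ Finset.Ico a m, h i j + u m j := by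
  induction m, ham using Nat.le_induction with
  | base => simp
  | succ m hm ih =>
    rw [Finset.sum_Ico_succ_top hm, Finset.sum_Ico_succ_top hm, ← add_assoc,
      ih fun i h1 h2 => hsq i h1 (by omega)]
    linarith [hsq m hm (by omega)]

/-- Discrete Stokes: `u` and `h` form a closed cochain on the squares above the diagonal, so the two
legs of the triangle and the staircase along its diagonal have equal sums. -/
theorem sum_triangle (u h : ℕ → ℕ → ℤ) (m : ℕ)
    (hsq : ∀ i j, i + 1 < j → j ≤ m → u i j + h i (j + 1) = h i j + u (i + 1) j) :
    ∑ k ∈ Finset.range m, u 0 (k + 1) + ∑ i ∈ Finset.range m, h i (m + 1) =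
      ∑ k ∈ Finset.range m, (u k (k + 1) + h k (k + 2)) := by
  induction m with
  | zero => simp
  | succ m ih =>
    have h1 := ih fun i j a b => hsq i j a (by omega)
    have h2 := sum_triangle_aux u h 0 m (m + 1) (by omega)
      fun i _ hi => hsq i (m + 1) (by omega) le_rfl
    rw [← Finset.range_eq_Ico] at h2
    rw [Finset.sum_range_succ, Finset.sum_range_succ, Finset.sum_range_succ]
    have e : m + 1 + 1 = m + 2 := rfl
    rw [e] at *
    linarith

/-- A triangle with one corner cut off. -/
theorem sum_cut_triangle (u h : ℕ → ℕ → ℤ) (m : ℕ) (hm : 1 ≤ m)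
    (hsq : ∀ i j, i + 1 < j → j ≤ m + 1 → (i ≠ 0 ∨ j ≠ m + 1) →
      u i j + h i (j + 1) = h i j + u (i + 1) j) :
    ∑ k ∈ Finset.range (m + 1), (u k (k + 1) + h k (k + 2)) =
      ∑ k ∈ Finset.range m, u 0 (k + 1) + h 0 (m + 1) + u 1 (m + 1) +
        ∑ i ∈ Finset.Ico 1 (m + 1), h i (m + 2) := by
  have h1 := sum_triangle u h m fun i j a b => hsq i j a (by omega) (by omega)
  have h2 := sum_triangle_aux u h 1 m (m + 1) hm
    fun i hi hi' => hsq i (m + 1) (by omega) le_rfl (by omega)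
  rw [Finset.sum_range_succ, ← h1, Finset.sum_Ico_succ_top hm, Finset.range_eq_Ico,
    Finset.sum_eq_sum_Ico_succ_bot (show 0 < m by omega) (fun i => h i (m + 1))]
  have e : m + 1 + 1 = m + 2 := rfl
  rw [e] at *
  linarith

/-- Between vectors in two consecutive quadrants the quarter turn is just the difference of the
quadrants, so the sum telescopes. -/
theorem sum_quarterTurn_of_quad {x : ℕ → ℤ × ℤ} {a b : ℕ} (hab : a ≤ b) {p : ℤ}
    (h : ∀ k, a ≤ k → k ≤ b → quad (x k) = p ∨ quad (x k) = p + 1) :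
    ∑ k ∈ Finset.Ico a b, quarterTurn (x k) (x (k + 1)) = quad (x b) - quad (x a) := by
  induction b, hab using Nat.le_induction with
  | base => simp
  | succ b hb ih =>
    rw [Finset.sum_Ico_succ_top hb, ih fun k h1 h2 => h k h1 (by omega)]
    have h1 := h b hb (by omega)
    have h2 := h (b + 1) (by omega) le_rfl
    unfold quarterTurn
    omega

/-- A simple closed lattice curve: a cyclic sequence of distinct unit edges without transversal
crossings.  The edge `i` leads from `pos i` to `pos (next i)` in the direction `dir i`. -/
structure LatticeCycle (ι : Type*) where
  next : Equiv.Perm ι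
  pos : ι → ℤ × ℤ
  dir : ι → Dir
  sameCycle : ∀ i j, next.SameCycle i j
  pos_next : ∀ i, pos (next i) = pos i + (dir i).vec
  dir_next_ne : ∀ i, dir (next i) ≠ (dir i).opp
  mid_injective : Function.Injective fun i => pos i + pos (next i)
  not_cross : ∀ i j, i ≠ j → pos (next i) = pos (next j) →
    ¬(dir (next i) = dir i ∧ dir (next j) = dir j)

/-! ### Simple closed lattice curves, their reversal and their lowest edge. -/

namespace LatticeCycle

variable {ι : Type*} (C : LatticeCycle ι)

/-- Twice the midpoint of an edge. -/
def mid (i : ι) : ℤ × ℤ := C.pos i + C.pos (C.next i)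

theorem mid_eq_tail (i : ι) : C.mid i = C.pos i + C.pos i + (C.dir i).vec := by
  rw [mid, pos_next]; abel

theorem mid_eq_head (i : ι) :
    C.mid i = C.pos (C.next i) + C.pos (C.next i) - (C.dir i).vec := by
  rw [mid, pos_next]; abel

theorem mid_next (i : ι) :
    C.mid (C.next i) = C.pos (C.next i) + C.pos (C.next i) + (C.dir (C.next i)).vec :=
  C.mid_eq_tail _

theorem mid_inj {i j : ι} (h : C.mid i = C.mid j) : i = j := C.mid_injective h

theorem mid_next_sub (i : ι) :
    C.mid (C.next i) - C.mid i = (C.dir i).vec + (C.dir (C.next i)).vec := by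
  rw [mid_next, mid_eq_head]; abel

/-- The same curve with the opposite orientation. -/
def reverse : LatticeCycle ι where
  next := C.next.symm
  pos i := C.pos (C.next i)
  dir i := (C.dir i).opp
  sameCycle i j := Equiv.Perm.sameCycle_inv.2 (C.sameCycle i j)
  pos_next i := by
    rw [Equiv.apply_symm_apply, Dir.vec_opp, C.pos_next i]; abel
  dir_next_ne i h := by
    have := C.dir_next_ne (C.next.symm i)
    rw [Equiv.apply_symm_apply] at this
    rw [Dir.opp_opp] at h
    exact this (h ▸ rfl)
  mid_injective i j h := by
    simp only [Equiv.apply_symm_apply] at h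
    exact C.mid_injective (by simpa [add_comm] using h)
  not_cross i j hij h := by
    simp only [Equiv.apply_symm_apply] at h
    have := C.not_cross (C.next.symm i) (C.next.symm j) (by simpa using hij)
      (by simpa only [Equiv.apply_symm_apply] using h)
    simp only [Equiv.apply_symm_apply] at this
    rintro ⟨h1, h2⟩
    have inj : ∀ {d e : Dir}, d.opp = e.opp → d = e := fun {d e} h => by
      simpa using congrArg Dir.opp h
    exact this ⟨(inj h1).symm, (inj h2).symm⟩

section Total

variable [Fintype ι]

/-- The total turning, in quarter turns. -/
def turning : ℤ := ∑ i, Dir.turn (C.dir i) (C.dir (C.next i))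

/-- The integral of `x dy`. -/
def area : ℤ := ∑ i, (C.pos i).1 * (C.dir i).vec.2

theorem turning_reverse : C.reverse.turning = -C.turning := by
  unfold turning
  rw [← Finset.sum_neg_distrib, ← Equiv.sum_comp C.next]
  refine Finset.sum_congr rfl fun i _ => ?_
  change Dir.turn (C.dir (C.next i)).opp (C.dir (C.next.symm (C.next i))).opp = _
  rw [Equiv.symm_apply_apply, Dir.turn_opp_opp]

theorem area_reverse : C.reverse.area = -C.area := by
  unfold area
  rw [← Finset.sum_neg_distrib]
  refine Finset.sum_congr rfl fun i _ => ?_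
  change (C.pos (C.next i)).1 * (C.dir i).opp.vec.2 = _
  rw [C.pos_next, Dir.vec_opp]
  cases C.dir i <;> simp [Dir.vec]

end Total

/-- The midpoint of the edge `i` is the leftmost one among the lowest ones. -/
def IsLowest (i : ι) : Prop :=
  ∀ j, (C.mid i).2 < (C.mid j).2 ∨ ((C.mid i).2 = (C.mid j).2 ∧ (C.mid i).1 ≤ (C.mid j).1)

theorem exists_isLowest [Finite ι] [Nonempty ι] : ∃ i, C.IsLowest i := by
  obtain ⟨i, hi⟩ := Finite.exists_min fun i => toLex ((C.mid i).2, (C.mid i).1)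
  refine ⟨i, fun j => ?_⟩
  simpa [Prod.Lex.le_iff] using hi j

/-- At the lower end of a vertical edge the curve continues with an edge whose midpoint is strictly
lower. -/
theorem IsLowest.dir_eq {C : LatticeCycle ι} {i : ι} (h : C.IsLowest i) :
    C.dir i = .E ∨ C.dir i = .W := by
  have h1 := h (C.next i)
  have h2 := h (C.next.symm i)
  have n1 := C.dir_next_ne i
  have n2 := C.dir_next_ne (C.next.symm i)
  have m1 := C.mid_next_sub i
  have m2 := C.mid_next_sub (C.next.symm i)
  rw [Equiv.apply_symm_apply] at n2 m2
  have m1' := congrArg Prod.snd m1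
  have m2' := congrArg Prod.snd m2
  simp only [Prod.snd_sub, Prod.snd_add] at m1' m2'
  generalize C.dir (C.next i) = a at *
  generalize C.dir (C.next.symm i) = b at *
  generalize C.dir i = d at *
  cases d <;> cases a <;> cases b <;> simp_all [Dir.vec, Dir.opp] <;> omega

theorem IsLowest.dir_next {C : LatticeCycle ι} {i : ι} (h : C.IsLowest i) (hE : C.dir i = .E) :
    C.dir (C.next i) = .E ∨ C.dir (C.next i) = .N := by
  have h1 := h (C.next i)
  have n1 := C.dir_next_ne i
  have m1 := C.mid_next_sub i
  have m1' := congrArg Prod.snd m1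
  rw [hE] at *
  simp only [Prod.snd_sub, Prod.snd_add] at m1'
  generalize C.dir (C.next i) = a at *
  cases a <;> (simp_all [Dir.vec, Dir.opp]; try omega)

/-- A previous edge heading `E` would have its midpoint further left at the same height, and one
heading `N` would lie lower. -/
theorem IsLowest.dir_prev {C : LatticeCycle ι} {i : ι} (h : C.IsLowest i) (hE : C.dir i = .E) :
    C.dir (C.next.symm i) = .S := by
  have h1 := h (C.next.symm i)
  have n1 := C.dir_next_ne (C.next.symm i)
  have m1 := C.mid_next_sub (C.next.symm i)
  have m1' := congrArg Prod.snd m1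
  have m1'' := congrArg Prod.fst m1
  rw [Equiv.apply_symm_apply] at *
  rw [hE] at *
  simp only [Prod.snd_sub, Prod.snd_add, Prod.fst_sub, Prod.fst_add] at m1' m1''
  generalize C.dir (C.next.symm i) = a at *
  cases a <;> simp_all [Dir.vec, Dir.opp] <;> omega

/-! ### The total turning of a simple closed lattice curve -/

/-- The secants join midpoints of edges rather than vertices: the curve may visit a lattice point
twice, but the midpoints are distinct, so the secants do not vanish. -/
theorem quarterTurn_secants {i j : ι} (h1 : i ≠ j) (h2 : C.next i ≠ j) (h3 : i ≠ C.next j) :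
    quarterTurn (C.mid j - C.mid i) (C.mid (C.next j) - C.mid i) +
        quarterTurn (C.mid (C.next j) - C.mid i) (C.mid (C.next j) - C.mid (C.next i)) =
      quarterTurn (C.mid j - C.mid i) (C.mid j - C.mid (C.next i)) +
        quarterTurn (C.mid j - C.mid (C.next i)) (C.mid (C.next j) - C.mid (C.next i)) := by
  set p := C.pos (C.next i)
  set q := C.pos (C.next j)
  have e1 : C.mid j - C.mid i = (q - p) + (q - p) - (C.dir j).vec + (C.dir i).vec := by
    rw [mid_eq_head, mid_eq_head]; abel
  have e2 : C.mid (C.next j) - C.mid i =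
      (q - p) + (q - p) + (C.dir (C.next j)).vec + (C.dir i).vec := by
    rw [mid_next, mid_eq_head]; abel
  have e3 : C.mid (C.next j) - C.mid (C.next i) =
      (q - p) + (q - p) + (C.dir (C.next j)).vec - (C.dir (C.next i)).vec := by
    rw [mid_next, mid_next]; abel
  have e4 : C.mid j - C.mid (C.next i) =
      (q - p) + (q - p) - (C.dir j).vec - (C.dir (C.next i)).vec := by
    rw [mid_eq_head, mid_next]; abel
  have nz : ∀ {a b : ι}, a ≠ b → C.mid b - C.mid a ≠ 0 := fun hab h =>
    hab (C.mid_inj (sub_eq_zero.1 h)).symm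
  rw [e1, e2, e3, e4]
  refine quarterTurn_square _ _ _ _ _ (C.dir_next_ne i) (C.dir_next_ne j) (fun h => ?_) ?_ ?_ ?_ ?_
  · exact C.not_cross i j h1 (sub_eq_zero.1 h).symm
  · rw [← e1]; exact nz h1
  · rw [← e4]; exact nz h2
  · rw [← e2]; exact nz h3
  · rw [← e3]; exact nz (by simpa using h1)

/-- Hopf's argument: the secants parametrize a triangle of pairs of edges. The diagonal gives the
turning of the tangent. Along the two legs the secants start or end at the lowest edge, so they
sweep half-planes and their turning is read off from the end values. -/
theorem turning_of_isLowest [Fintype ι] {i₀ : ι} (h : C.IsLowest i₀) (hE : C.dir i₀ = .E) :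
    C.turning = 4 := by
  classical
  set N := Fintype.card ι
  have hcyc : C.next.IsCycleOn (Finset.univ : Finset ι) :=
    ⟨by simp, fun i _ j _ => C.sameCycle i j⟩
  let e : ℕ → ι := fun k => (C.next ^ k) i₀
  have he : ∀ k, e (k + 1) = C.next (e k) := fun k => by
    simp only [e, pow_succ', Equiv.Perm.mul_apply]
  have heq : ∀ a b, e a = e b ↔ a ≡ b [MOD N] := fun a b =>
    hcyc.pow_apply_eq_pow_apply (Finset.mem_univ i₀)
  have heN : e N = e 0 := (heq _ _).2 (by simp [Nat.ModEq])
  have hne : ∀ a b, a < b → b < a + N → e a ≠ e b := fun a b h1 h2 h3 => by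
    have h4 := (Nat.modEq_iff_dvd' h1.le).1 ((heq a b).1 h3)
    exact absurd (Nat.le_of_dvd (by omega) h4) (by omega)
  have he0 : e 0 = i₀ := rfl
  have d0 : C.dir (e 0) = .E := hE
  have hN0 : 0 < N := Fintype.card_pos_iff.2 ⟨i₀⟩
  have hlast : e (N - 1) = C.next.symm i₀ := by
    rw [Equiv.eq_symm_apply, ← he, show N - 1 + 1 = N by omega, heN, he0]
  have dl : C.dir (e (N - 1)) = .S := hlast ▸ h.dir_prev hE
  have d1 : C.dir (e 1) = .E ∨ C.dir (e 1) = .N := h.dir_next hE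
  have hN1 : N ≠ 1 := by
    intro h1
    rw [h1] at dl
    simp only [Nat.sub_self] at dl
    rw [dl] at d0; cases d0
  have hN2 : N ≠ 2 := by
    intro h1
    rw [h1] at dl
    change C.dir (e 1) = .S at dl
    rw [dl] at d1
    simp at d1
  have hsum : C.turning = ∑ k ∈ Finset.range N, Dir.turn (C.dir (e k)) (C.dir (e (k + 1))) := by
    unfold turning
    refine (Finset.sum_bij (fun k _ => e k) (fun _ _ => Finset.mem_univ _) ?_ ?_ ?_).symm
    · intro a ha b hb hab
      rw [Finset.mem_range] at ha hb
      rcases lt_trichotomy a b with hlt | rfl | hlt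
      · exact absurd hab (hne a b hlt (by omega))
      · rfl
      · exact absurd hab.symm (hne b a hlt (by omega))
    · intro i _
      obtain ⟨k, hk, hk'⟩ := hcyc.exists_pow_eq (Finset.mem_univ i₀) (Finset.mem_univ i)
      exact ⟨k, Finset.mem_range.2 hk, hk'⟩
    · intro k _
      rw [he]
  obtain ⟨m, hm⟩ : ∃ m, N = m + 2 := ⟨N - 2, by omega⟩
  have hm1 : 1 ≤ m := by omega
  let v : ℕ → ℕ → ℤ × ℤ := fun i j => C.mid (e j) - C.mid (e i)
  -- The omitted square `i = 0`, `j = m + 1` has the corner `v 0 (m + 2)`, the zero secant from `e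
  -- 0` to `e N = e 0`. On all other squares the secants are nonzero.
  have hcut := sum_cut_triangle (fun i j => quarterTurn (v i j) (v i (j + 1)))
    (fun i j => quarterTurn (v i j) (v (i + 1) j)) m hm1 (by
      intro i j h1 h2 h3
      simp only [v, he]
      refine C.quarterTurn_secants (hne _ _ (by omega) (by omega)) ?_ ?_
      · rw [← he]; exact hne _ _ h1 (by omega)
      · rw [← he]; exact hne _ _ (by omega) (by omega))
  have vN : v (m + 1) (m + 2) = (1, -1) := by
    have h2 := C.mid_next_sub (e (N - 1))
    rw [← he, show N - 1 + 1 = N by omega, heN, dl, d0] at h2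
    rw [show m + 1 = N - 1 by omega, show m + 2 = N by omega]
    simp only [v, heN, h2]
    decide
  have v0l : v 0 (m + 1) = (-1, 1) := by
    have : v 0 (m + 1) = -v (m + 1) (m + 2) := by
      simp only [v, ← hm, heN]; abel
    rw [this, vN]; decide
  have v01 : v 0 1 = (2, 0) ∨ v 0 1 = (1, 1) := by
    have h2 : v 0 1 = _ := C.mid_next_sub (e 0)
    rw [h2, d0, ← he]
    rcases d1 with d1 | d1 <;> rw [d1] <;> decide
  have v1N : v 1 (m + 2) = -v 0 1 := by
    simp only [v, ← hm, heN]; abel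
  have v1l : v 1 (m + 1) = v 0 (m + 1) - v 0 1 := by
    simp only [v]; abel
  -- The ties among the lowest midpoints were broken towards the left, which is exactly what puts
  -- the secants from `e 0` into the half-open upper half-plane and those to `e N` into the lower
  -- one.
  have hup : ∀ k, 1 ≤ k → k ≤ m + 1 → quad (v 0 k) = 0 ∨ quad (v 0 k) = 0 + 1 := by
    intro k h1 h2
    have h3 := h (e k)
    have h4 : v 0 k ≠ 0 := fun h5 =>
      hne 0 k (by omega) (by omega) (C.mid_inj (sub_eq_zero.1 h5)).symm
    have h5 : 0 < (v 0 k).2 ∨ (0 = (v 0 k).2 ∧ 0 ≤ (v 0 k).1) := by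
      simp only [v, Prod.snd_sub, Prod.fst_sub, he0]; omega
    have h6 : (v 0 k).2 = 0 → (v 0 k).1 ≠ 0 := fun a b => h4 (Prod.ext b a)
    unfold quad
    split_ifs <;> omega
  have hdown : ∀ k, 1 ≤ k → k ≤ m + 1 →
      quad (v k (m + 2)) = 2 ∨ quad (v k (m + 2)) = 2 + 1 := by
    intro k h1 h2
    have h3 := h (e k)
    have h4 : v k (m + 2) ≠ 0 := fun h5 => by
      simp only [v, ← hm, heN] at h5
      exact hne 0 k (by omega) (by omega) (C.mid_inj (sub_eq_zero.1 h5))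
    have h5 : (v k (m + 2)).2 < 0 ∨ (0 = (v k (m + 2)).2 ∧ (v k (m + 2)).1 ≤ 0) := by
      simp only [v, Prod.snd_sub, Prod.fst_sub, ← hm, heN, he0]; omega
    have h6 : (v k (m + 2)).2 = 0 → (v k (m + 2)).1 ≠ 0 := fun a b => h4 (Prod.ext b a)
    unfold quad
    split_ifs <;> omega
  have s1 : ∑ k ∈ Finset.range m, quarterTurn (v 0 (k + 1)) (v 0 (k + 1 + 1)) =
      quad (v 0 (m + 1)) - quad (v 0 1) := by
    rw [← sum_quarterTurn_of_quad (show 1 ≤ m + 1 by omega) hup, Finset.sum_Ico_eq_sum_range]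
    simp only [Nat.add_sub_cancel, add_comm]
  have s2 := sum_quarterTurn_of_quad (x := fun k => v k (m + 2)) (show 1 ≤ m + 1 by omega) hdown
  have hdiag : ∀ k, quarterTurn (v k (k + 1)) (v k (k + 2)) +
      quarterTurn (v k (k + 2)) (v (k + 1) (k + 2)) =
      Dir.turn (C.dir (e k)) (C.dir (e (k + 1))) +
        (min (Dir.turn (C.dir (e (k + 1))) (C.dir (e (k + 2)))) 0 -
          min (Dir.turn (C.dir (e k)) (C.dir (e (k + 1)))) 0) := by
    intro k
    have t1 : v k (k + 1) = (C.dir (e k)).vec + (C.dir (e (k + 1))).vec := by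
      simp only [v, he]; exact C.mid_next_sub _
    have t2 : v (k + 1) (k + 2) = (C.dir (e (k + 1))).vec + (C.dir (e (k + 2))).vec := by
      simp only [v, he]; exact C.mid_next_sub _
    have t3 : v k (k + 2) = v k (k + 1) + v (k + 1) (k + 2) := by
      simp only [v]; abel
    rw [t3, t1, t2]
    refine quarterTurn_tangent _ _ _ ?_ ?_
    · rw [he]; exact C.dir_next_ne _
    · rw [he (k + 1)]; exact C.dir_next_ne _
  have hdiag2 : ∑ k ∈ Finset.range (m + 1), (quarterTurn (v k (k + 1)) (v k (k + 2)) +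
      quarterTurn (v k (k + 2)) (v (k + 1) (k + 2))) =
      ∑ k ∈ Finset.range (m + 1), Dir.turn (C.dir (e k)) (C.dir (e (k + 1))) +
        (min (Dir.turn (C.dir (e (m + 1))) (C.dir (e (m + 2)))) 0 -
          min (Dir.turn (C.dir (e 0)) (C.dir (e 1))) 0) := by
    rw [Finset.sum_congr rfl fun k _ => hdiag k, Finset.sum_add_distrib,
      Finset.sum_range_sub (fun k => min (Dir.turn (C.dir (e k)) (C.dir (e (k + 1)))) 0)]
  have tl : Dir.turn (C.dir (e (m + 1))) (C.dir (e (m + 2))) = 1 := by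
    rw [show m + 1 = N - 1 by omega, ← hm, heN, dl, d0]; rfl
  rw [hsum, hm, Finset.sum_range_succ, show m + 1 + 1 = m + 2 from rfl, tl]
  -- The outer path runs from `v 0 1` to `v 0 (m + 1)`, around the missing corner through `v 1 (m +
  -- 1)` to `v 1 (m + 2)`, and on to `v (m + 1) (m + 2)`. All end values are now explicit.
  change ∑ k ∈ Finset.range (m + 1), (quarterTurn (v k (k + 1)) (v k (k + 2)) +
      quarterTurn (v k (k + 2)) (v (k + 1) (k + 2))) =
    ∑ k ∈ Finset.range m, quarterTurn (v 0 (k + 1)) (v 0 (k + 1 + 1)) +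
      quarterTurn (v 0 (m + 1)) (v 1 (m + 1)) + quarterTurn (v 1 (m + 1)) (v 1 (m + 2)) +
        ∑ i ∈ Finset.Ico 1 (m + 1), quarterTurn (v i (m + 2)) (v (i + 1) (m + 2)) at hcut
  rw [hdiag2, s1, s2, tl, v1N, v1l, v0l, vN] at hcut
  have : Dir.turn (C.dir (e 0)) (C.dir (e 1)) = 0 ∨ Dir.turn (C.dir (e 0)) (C.dir (e 1)) = 1 := by
    rw [d0]; rcases d1 with d1 | d1 <;> rw [d1] <;> decide
  rcases v01 with v01 | v01 <;> rw [v01] at hcut <;> norm_num [quad, quarterTurn] at hcut <;>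
    omega

end LatticeCycle

/-! ### Winding numbers and the sign of the enclosed area. -/

namespace LatticeCycle

variable {ι : Type*} (C : LatticeCycle ι)

theorem eq_of_tail {i j : ι} (h : C.pos i = C.pos j) (h' : C.dir i = C.dir j) : i = j :=
  C.mid_inj (by rw [mid_eq_tail, mid_eq_tail, h, h'])

theorem eq_of_head {i j : ι} (h : C.pos (C.next i) = C.pos (C.next j)) (h' : C.dir i = C.dir j) :
    i = j :=
  C.mid_inj (by rw [mid_eq_head, mid_eq_head, h, h'])

theorem eq_of_tail_head {i j : ι} (h : C.pos i = C.pos (C.next j))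
    (h' : C.dir i = (C.dir j).opp) : i = j :=
  C.mid_inj (by rw [mid_eq_tail, mid_eq_head, h, h', Dir.vec_opp]; abel)

theorem _root_.GridDiagram.Dir.opp_ne (d : Dir) : d ≠ d.opp := by cases d <;> simp [Dir.opp]

/-- Two arcs of the curve through the same lattice point use disjoint pairs of ends, since each unit
edge is traversed once. -/
theorem dir_ne_of_ne {i j : ι} (hij : j ≠ i) (h : C.pos (C.next j) = C.pos (C.next i)) :
    C.dir (C.next j) ≠ C.dir (C.next i) ∧ C.dir (C.next j) ≠ (C.dir i).opp ∧
      (C.dir j).opp ≠ C.dir (C.next i) ∧ C.dir j ≠ C.dir i := by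
  refine ⟨fun e => hij (C.next.injective (C.eq_of_tail h e)), fun e => ?_, fun e => ?_,
    fun e => hij (C.eq_of_head h e)⟩
  · have := C.eq_of_tail_head h e
    exact Dir.opp_ne (C.dir i) (by rw [← e, this])
  · have := C.eq_of_tail_head h.symm e.symm
    exact Dir.opp_ne (C.dir j) (by rw [e, this])

variable [Fintype ι]

/-! ### The faces of a simple closed lattice curve -/

/-- The contribution of an edge to the winding number around the unit square with lower left corner
`(x, y)`: its crossing with the half-line going to the left. -/
def windingTerm (i : ι) (x y : ℤ) : ℤ :=
  match C.dir i with
  | .N => if (C.pos i).1 ≤ x ∧ (C.pos i).2 = y then -1 else 0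
  | .S => if (C.pos i).1 ≤ x ∧ (C.pos i).2 = y + 1 then 1 else 0
  | _ => 0

/-- The winding number around the unit square with lower left corner `(x, y)`. -/
def winding (x y : ℤ) : ℤ := ∑ i, C.windingTerm i x y

/-- The winding number around the unit square between the directions `d` and `d` turned
counterclockwise at a lattice point `p`. -/
def windingAt (p : ℤ × ℤ) : Dir → ℤ
  | .E => C.winding p.1 p.2
  | .N => C.winding (p.1 - 1) p.2
  | .W => C.winding (p.1 - 1) (p.2 - 1)
  | .S => C.winding p.1 (p.2 - 1)

/-- The flow out of the lattice point `p` in the direction `d`. -/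
def outflow (p : ℤ × ℤ) (d : Dir) : ℤ :=
  ∑ j, ((if C.pos j = p ∧ C.dir j = d then 1 else 0) -
    (if C.pos (C.next j) = p ∧ (C.dir j).opp = d then 1 else 0))

/-- Crossing an edge changes the winding number by the flow along it. -/
theorem windingAt_sub (p : ℤ × ℤ) (d : Dir) :
    C.windingAt p d - C.windingAt p d.rotR = C.outflow p d := by
  -- For `E` and `W` the two squares lie in different rows, so the half-lines to the left are not
  -- nested. The terms agree only after adding this sum, which telescopes along the closed curve.
  have tel : ∑ j, ((if (C.pos j).1 ≤ p.1 ∧ (C.pos j).2 = p.2 then (1 : ℤ) else 0) -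
      (if (C.pos (C.next j)).1 ≤ p.1 ∧ (C.pos (C.next j)).2 = p.2 then 1 else 0)) = 0 := by
    rw [Finset.sum_sub_distrib, Equiv.sum_comp C.next
      (fun j => if (C.pos j).1 ≤ p.1 ∧ (C.pos j).2 = p.2 then (1 : ℤ) else 0), sub_self]
  have tel' : ∑ j, ((if (C.pos j).1 ≤ p.1 - 1 ∧ (C.pos j).2 = p.2 then (1 : ℤ) else 0) -
      (if (C.pos (C.next j)).1 ≤ p.1 - 1 ∧ (C.pos (C.next j)).2 = p.2 then 1 else 0)) = 0 := by
    rw [Finset.sum_sub_distrib, Equiv.sum_comp C.next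
      (fun j => if (C.pos j).1 ≤ p.1 - 1 ∧ (C.pos j).2 = p.2 then (1 : ℤ) else 0), sub_self]
  unfold outflow
  cases d
  · simp only [Dir.rotR, windingAt, winding]
    rw [← Finset.sum_sub_distrib]
    refine Finset.sum_congr rfl fun j _ => ?_
    rw [C.pos_next]
    unfold windingTerm
    cases C.dir j <;> simp only [Prod.ext_iff, Dir.opp, Dir.vec, Prod.fst_add, Prod.snd_add] <;>
      grind
  · simp only [Dir.rotR, windingAt, winding]
    rw [← Finset.sum_sub_distrib, ← add_zero (∑ j, _), ← tel, ← Finset.sum_add_distrib]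
    refine Finset.sum_congr rfl fun j _ => ?_
    rw [C.pos_next]
    unfold windingTerm
    cases C.dir j <;> simp only [Prod.ext_iff, Dir.opp, Dir.vec, Prod.fst_add, Prod.snd_add] <;>
      grind
  · simp only [Dir.rotR, windingAt, winding]
    rw [← Finset.sum_sub_distrib]
    refine Finset.sum_congr rfl fun j _ => ?_
    rw [C.pos_next]
    unfold windingTerm
    cases C.dir j <;> simp only [Prod.ext_iff, Dir.opp, Dir.vec, Prod.fst_add, Prod.snd_add] <;>
      grind
  · simp only [Dir.rotR, windingAt, winding]
    rw [← Finset.sum_sub_distrib, ← sub_zero (∑ j, _), ← tel', ← Finset.sum_sub_distrib]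
    refine Finset.sum_congr rfl fun j _ => ?_
    rw [C.pos_next]
    unfold windingTerm
    cases C.dir j <;> simp only [Prod.ext_iff, Dir.opp, Dir.vec, Prod.fst_add, Prod.snd_add] <;>
      grind

/-- The outflow as a sum over the arcs of the curve. -/
theorem outflow_eq (p : ℤ × ℤ) (d : Dir) :
    C.outflow p d = ∑ j, if C.pos (C.next j) = p then
      ((if C.dir (C.next j) = d then (1 : ℤ) else 0) - if (C.dir j).opp = d then 1 else 0)
      else 0 := by
  unfold outflow
  rw [Finset.sum_sub_distrib, ← Equiv.sum_comp C.next
    (fun j => if C.pos j = p ∧ C.dir j = d then (1 : ℤ) else 0), ← Finset.sum_sub_distrib]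
  refine Finset.sum_congr rfl fun j _ => ?_
  split_ifs <;> simp_all

theorem outflow_tail (i : ι) : C.outflow (C.pos i) (C.dir i) = 1 := by
  unfold outflow
  rw [Finset.sum_eq_single i]
  · rw [if_pos ⟨rfl, rfl⟩, if_neg]; · rfl
    intro h; cases hd : C.dir i <;> simp [hd, Dir.opp] at h
  · intro j _ hj
    rw [if_neg, if_neg, sub_zero]
    · exact fun h => hj (C.eq_of_tail_head h.1.symm h.2.symm).symm
    · exact fun h => hj (C.eq_of_tail h.1 h.2)
  · simp

theorem outflow_eq_zero (p : ℤ × ℤ) (d : Dir)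
    (h : ∀ i, ¬(C.pos i = p ∧ C.dir i = d) ∧ ¬(C.pos (C.next i) = p ∧ (C.dir i).opp = d)) :
    C.outflow p d = 0 := by
  unfold outflow
  refine Finset.sum_eq_zero fun j _ => ?_
  rw [if_neg (h j).1, if_neg (h j).2, sub_zero]

/-- The winding number on the left of an edge. -/
def leftWinding (i : ι) : ℤ := C.windingAt (C.pos i) (C.dir i)

theorem leftWinding_eq_head (i : ι) :
    C.leftWinding i = C.windingAt (C.pos (C.next i)) (C.dir i).opp.rotR := by
  unfold leftWinding
  rw [C.pos_next]
  cases C.dir i <;> simp [windingAt, Dir.opp, Dir.rotR, Dir.vec, ← sub_eq_add_neg]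

theorem _root_.GridDiagram.Dir.outflow_aux : ∀ a a' b b' d d' : Dir, d ≠ d' → d ≠ a.opp → d ≠ a' →
    d' ≠ a.opp → d' ≠ a' → a' ≠ a.opp → b' ≠ b.opp → b' ≠ a' → b' ≠ a.opp → b.opp ≠ a' → b ≠ a →
    ((if b' = d then (1 : ℤ) else 0) - if b.opp = d then 1 else 0) +
      ((if b' = d' then (1 : ℤ) else 0) - if b.opp = d' then 1 else 0) = 0 := by
  decide +kernel

theorem _root_.GridDiagram.Dir.straight_aux : ∀ a b b' : Dir,
    b' ≠ b.opp → b' ≠ a → b' ≠ a.opp → b.opp ≠ a → b ≠ a → b' = b := by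
  decide +kernel

/-- The directions `d` and `d'` are the two ends left free by the arc after `i`. Any other arc
through the point must use both, one inward and one outward. -/
theorem outflow_add_outflow_eq_zero (i : ι) {d d' : Dir} (hd : d ≠ d')
    (h1 : d ≠ (C.dir i).opp) (h2 : d ≠ C.dir (C.next i)) (h3 : d' ≠ (C.dir i).opp)
    (h4 : d' ≠ C.dir (C.next i)) :
    C.outflow (C.pos (C.next i)) d + C.outflow (C.pos (C.next i)) d' = 0 := by
  rw [outflow_eq, outflow_eq, ← Finset.sum_add_distrib]
  refine Finset.sum_eq_zero fun j _ => ?_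
  by_cases h : C.pos (C.next j) = C.pos (C.next i)
  swap; · simp [h]
  rw [if_pos h, if_pos h]
  by_cases hij : j = i
  · subst hij
    rw [if_neg h1.symm, if_neg h2.symm, if_neg h3.symm, if_neg h4.symm]; simp
  obtain ⟨n1, n2, n3, n4⟩ := C.dir_ne_of_ne hij h
  exact Dir.outflow_aux _ _ _ _ _ _ hd h1 h2 h3 h4 (C.dir_next_ne i) (C.dir_next_ne j) n1 n2 n3 n4

/-- When the curve goes straight at a point, a second arc there would have to go straight across it,
which `not_cross` forbids. -/
theorem outflow_straight (i : ι) (hs : C.dir (C.next i) = C.dir i) {d : Dir}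
    (h1 : d ≠ (C.dir i).opp) (h2 : d ≠ C.dir i) : C.outflow (C.pos (C.next i)) d = 0 := by
  rw [outflow_eq]
  refine Finset.sum_eq_zero fun j _ => ?_
  by_cases h : C.pos (C.next j) = C.pos (C.next i)
  swap; · simp [h]
  rw [if_pos h]
  by_cases hij : j = i
  · subst hij
    rw [if_neg h1.symm, if_neg (hs ▸ h2.symm)]; simp
  obtain ⟨n1, n2, n3, n4⟩ := C.dir_ne_of_ne hij h
  rw [hs] at n1 n3
  exact absurd ⟨Dir.straight_aux _ _ _ (C.dir_next_ne j) n1 n2 n3 n4, hs⟩ (C.not_cross j i hij h)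

/-- Turning around the common vertex on the left side crosses no end of the present arc: nothing is
crossed at a left turn, one free end when going straight, both free ends at a right turn. The net
flow crossed is zero. -/
theorem leftWinding_next (i : ι) : C.leftWinding (C.next i) = C.leftWinding i := by
  rw [C.leftWinding_eq_head i, leftWinding]
  have w := C.windingAt_sub (C.pos (C.next i))
  have n := C.dir_next_ne i
  have s := C.outflow_straight i
  have t := @outflow_add_outflow_eq_zero _ C _ i
  generalize C.pos (C.next i) = p at *
  generalize C.dir (C.next i) = a' at *
  generalize C.dir i = a at *
  have wN := w .N
  have wE := w .E
  have wS := w .S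
  have wW := w .W
  simp only [Dir.rotR] at wN wE wS wW
  cases a <;> cases a' <;> simp only [Dir.opp, Dir.rotR, ne_eq, reduceCtorEq, not_true_eq_false,
    not_false_eq_true] at n s t ⊢
  · linarith [s trivial (d := .W) (by simp) (by simp)]
  · linarith [t (d := .W) (d' := .N) (by simp) (by simp) (by simp) (by simp) (by simp)]
  · linarith [s trivial (d := .N) (by simp) (by simp)]
  · linarith [t (d := .N) (d' := .E) (by simp) (by simp) (by simp) (by simp) (by simp)]
  · linarith [s trivial (d := .E) (by simp) (by simp)]
  · linarith [t (d := .E) (d' := .S) (by simp) (by simp) (by simp) (by simp) (by simp)]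
  · linarith [t (d := .S) (d' := .W) (by simp) (by simp) (by simp) (by simp) (by simp)]
  · linarith [s trivial (d := .S) (by simp) (by simp)]

theorem leftWinding_eq (i j : ι) : C.leftWinding i = C.leftWinding j := by
  obtain ⟨k, rfl⟩ := (C.sameCycle i j).exists_nat_pow_eq
  induction k with
  | zero => simp
  | succ k ih => rw [pow_succ', Equiv.Perm.mul_apply, leftWinding_next, ih]

theorem IsLowest.leftWinding_eq_one {C : LatticeCycle ι} {i₀ : ι} (h : C.IsLowest i₀)
    (hE : C.dir i₀ = .E) (i : ι) : C.leftWinding i = 1 := by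
  rw [C.leftWinding_eq i i₀]
  have h1 := C.windingAt_sub (C.pos i₀) (C.dir i₀)
  rw [C.outflow_tail] at h1
  -- No vertical edge meets the row of squares just below the lowest edge.
  have h2 : C.windingAt (C.pos i₀) (C.dir i₀).rotR = 0 := by
    rw [hE]
    refine Finset.sum_eq_zero fun j _ => ?_
    have h3 := h j
    have e1 := congrArg Prod.snd (C.mid_eq_tail i₀)
    have e2 := congrArg Prod.snd (C.mid_eq_tail j)
    rw [hE] at e1
    simp only [Prod.snd_add, Dir.vec] at e1 e2
    unfold windingTerm
    cases hd : C.dir j <;> rw [hd] at e2 <;> simp only at e2 ⊢ <;> rw [if_neg]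
    all_goals rintro ⟨-, h4⟩; omega
  unfold leftWinding
  linarith

theorem winding_sub (x y : ℤ) : C.winding x y - C.winding (x - 1) y = -C.outflow (x, y) .N := by
  rw [← C.windingAt_sub (x, y) .N]
  simp [windingAt, Dir.rotR]

/-- A step to the right either crosses no edge or arrives at the right of an upward edge, where the
winding number is 0, or at the left of a downward one, where it is 1. -/
theorem winding_eq_or (h1 : ∀ i, C.leftWinding i = 1) (x y : ℤ) :
    C.winding x y = C.winding (x - 1) y ∨ C.winding x y = 0 ∨ C.winding x y = 1 := by
  by_cases h : ∃ i, (C.pos i = (x, y) ∧ C.dir i = .N) ∨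
      (C.pos (C.next i) = (x, y) ∧ C.dir i = .S)
  · right
    obtain ⟨i, ⟨hp, hd⟩ | ⟨hp, hd⟩⟩ := h
    · left
      have e1 := h1 i
      have e2 := C.outflow_tail i
      rw [leftWinding, hp, hd] at e1
      rw [hp, hd, ← C.windingAt_sub] at e2
      simp only [windingAt, Dir.rotR] at e1 e2
      linarith
    · right
      have e1 := h1 i
      rw [leftWinding_eq_head, hp, hd] at e1
      exact e1
  · left
    have := C.winding_sub x y
    rw [C.outflow_eq_zero] at this
    · linarith
    · intro i
      push Not at h
      have := h i
      refine ⟨fun h' => this.1 h'.1 h'.2, fun h' => this.2 h'.1 ?_⟩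
      have := h'.2
      revert this
      cases C.dir i <;> simp [Dir.opp]

theorem winding_mem (h0 : ∀ i, 0 ≤ (C.pos i).1) (h1 : ∀ i, C.leftWinding i = 1) (x : ℕ) (y : ℤ) :
    C.winding x y = 0 ∨ C.winding x y = 1 := by
  have hneg : C.winding (-1) y = 0 := by
    refine Finset.sum_eq_zero fun j _ => ?_
    have := h0 j
    unfold windingTerm
    split
    · rw [if_neg]; omega
    · rw [if_neg]; omega
    · rfl
  induction x with
  | zero =>
    have := C.winding_eq_or h1 0 y
    rw [zero_sub, hneg] at this
    simpa using this
  | succ x ih =>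
    have := C.winding_eq_or h1 ((x + 1 : ℕ) : ℤ) y
    rw [show (((x + 1 : ℕ) : ℤ) - 1) = x by push_cast; ring] at this
    rcases this with h | h
    · rw [h]; exact ih
    · exact h

theorem sum_range_ite_le (a : ℤ) (K : ℕ) (h0 : 0 ≤ a) (hK : a ≤ K) :
    ∑ x ∈ Finset.range K, (if a ≤ (x : ℤ) then (1 : ℤ) else 0) = K - a := by
  induction K with
  | zero => simp at hK ⊢; omega
  | succ K ih =>
    rw [Finset.sum_range_succ]
    by_cases h : a ≤ K
    · rw [ih h, if_pos h]; push_cast; ring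
    · rw [if_neg h, Finset.sum_eq_zero]
      · push_cast at hK ⊢; omega
      · intro x hx
        rw [Finset.mem_range] at hx
        rw [if_neg]; omega

theorem sum_range_ite_eq (b : ℤ) (K : ℕ) (h0 : 0 ≤ b) (hK : b < K) :
    ∑ y ∈ Finset.range K, (if b = (y : ℤ) then (1 : ℤ) else 0) = 1 := by
  rw [Finset.sum_eq_single b.toNat]
  · rw [if_pos]; omega
  · intro y _ hy; rw [if_neg]; omega
  · intro h; rw [Finset.mem_range] at h; omega

omit [Fintype ι] in
theorem sum_windingTerm (K : ℕ) (h0 : ∀ i, 0 ≤ (C.pos i).1 ∧ 0 ≤ (C.pos i).2)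
    (hK : ∀ i, (C.pos i).1 ≤ K ∧ (C.pos i).2 ≤ K) (i : ι) :
    ∑ x ∈ Finset.range K, ∑ y ∈ Finset.range K, C.windingTerm i x y =
      ((C.pos i).1 - K) * (C.dir i).vec.2 := by
  have h1 := h0 i
  have h2 := hK i
  have h3 := h0 (C.next i)
  have h4 := hK (C.next i)
  rw [C.pos_next] at h3 h4
  unfold windingTerm
  have key : ∀ b : ℤ, 0 ≤ b → b < K → ∀ s : ℤ, ∑ x ∈ Finset.range K, ∑ y ∈ Finset.range K,
      (if (C.pos i).1 ≤ (x : ℤ) ∧ b = (y : ℤ) then s else 0) = (K - (C.pos i).1) * s := by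
    intro b hb hb' s
    have : ∀ x y : ℕ, (if (C.pos i).1 ≤ (x : ℤ) ∧ b = (y : ℤ) then s else 0) =
        (if (C.pos i).1 ≤ (x : ℤ) then 1 else 0) * (if b = (y : ℤ) then 1 else 0) * s := by
      intro x y; split_ifs <;> simp_all
    simp only [this]
    simp_rw [← Finset.sum_mul, ← Finset.mul_sum, sum_range_ite_eq b K hb hb', mul_one,
      sum_range_ite_le _ K h1.1 h2.1]
  cases hd : C.dir i <;> rw [hd] at h3 h4 <;>
    simp only [Dir.vec, Prod.fst_add, Prod.snd_add] at h3 h4 ⊢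
  · rw [key _ h1.2 (by omega)]; ring
  · simp
  · have := key ((C.pos i).2 - 1) (by omega) (by omega) 1
    simp only [sub_eq_iff_eq_add] at this
    rw [this]; ring
  · simp

/-- Green's theorem. The half-lines are truncated at abscissa `K`, which costs `K` times the
integral of `dy`, and this is zero on a closed curve. -/
theorem sum_winding (K : ℕ) (h0 : ∀ i, 0 ≤ (C.pos i).1 ∧ 0 ≤ (C.pos i).2)
    (hK : ∀ i, (C.pos i).1 ≤ K ∧ (C.pos i).2 ≤ K) :
    ∑ x ∈ Finset.range K, ∑ y ∈ Finset.range K, C.winding x y = C.area := by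
  have h1 : ∑ i, (C.dir i).vec.2 = 0 := by
    have : ∀ i, (C.dir i).vec.2 = (C.pos (C.next i)).2 - (C.pos i).2 := fun i => by
      rw [C.pos_next]; simp
    simp_rw [this]
    rw [Finset.sum_sub_distrib, Equiv.sum_comp C.next (fun i => (C.pos i).2), sub_self]
  have h2 : ∑ x ∈ Finset.range K, ∑ y ∈ Finset.range K, C.winding x y =
      ∑ i, ∑ x ∈ Finset.range K, ∑ y ∈ Finset.range K, C.windingTerm i x y := by
    unfold winding
    rw [Finset.sum_comm]
    rw [Finset.sum_congr rfl fun x _ => Finset.sum_comm (s := Finset.range K), Finset.sum_comm]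
    exact Finset.sum_congr rfl fun i _ => Finset.sum_comm
  rw [h2, Finset.sum_congr rfl fun i _ => C.sum_windingTerm K h0 hK i]
  simp_rw [sub_mul]
  rw [Finset.sum_sub_distrib, ← Finset.mul_sum, h1, area]
  ring

/-- The area is the sum of winding numbers equal to 0 or 1, and the square above the lowest edge
contributes 1. -/
theorem area_pos_of_isLowest {i₀ : ι} (h : C.IsLowest i₀) (hE : C.dir i₀ = .E)
    (h0 : ∀ i, 0 ≤ (C.pos i).1 ∧ 0 ≤ (C.pos i).2) : 0 < C.area := by
  obtain ⟨K, hK⟩ : ∃ K : ℕ, ∀ i, (C.pos i).1 ≤ K ∧ (C.pos i).2 ≤ K := by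
    refine ⟨∑ i, ((C.pos i).1.toNat + (C.pos i).2.toNat), fun i => ?_⟩
    have := Finset.single_le_sum (f := fun i => ((C.pos i).1.toNat + (C.pos i).2.toNat))
      (fun _ _ => Nat.zero_le _) (Finset.mem_univ i)
    constructor <;> omega
  have h1 := h.leftWinding_eq_one hE
  have hm := C.winding_mem (fun i => (h0 i).1) h1
  have hK' : ∀ i, (C.pos i).1 ≤ (K + 1 : ℕ) ∧ (C.pos i).2 ≤ (K + 1 : ℕ) := fun i => by
    have := hK i; push_cast; omega
  rw [← C.sum_winding (K + 1) h0 hK']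
  have nn : ∀ x y : ℕ, 0 ≤ C.winding x y := fun x y => by rcases hm x y with h | h <;> omega
  have h2 := h1 i₀
  have b0 := h0 i₀
  have bK := hK i₀
  refine Finset.sum_pos' (fun x _ => Finset.sum_nonneg fun y _ => nn x y)
    ⟨(C.pos i₀).1.toNat, Finset.mem_range.2 (by omega),
      Finset.sum_pos' (fun y _ => nn _ y) ⟨(C.pos i₀).2.toNat, Finset.mem_range.2 (by omega), ?_⟩⟩
  rw [Int.toNat_of_nonneg b0.1, Int.toNat_of_nonneg b0.2]
  rw [leftWinding, hE] at h2
  simp only [windingAt] at h2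
  omega

/-- A simple closed lattice curve makes exactly one full turn, counterclockwise if and only if the
area on its left is positive. -/
theorem turning_eq_sign_area [Nonempty ι] (h0 : ∀ i, 0 ≤ (C.pos i).1 ∧ 0 ≤ (C.pos i).2) :
    C.area ≠ 0 ∧ C.turning = 4 * C.area.sign := by
  obtain ⟨i₀, h⟩ := C.exists_isLowest
  rcases h.dir_eq with hE | hW
  · have h1 := C.area_pos_of_isLowest h hE h0
    rw [C.turning_of_isLowest h hE, Int.sign_eq_one_of_pos h1]
    exact ⟨h1.ne', rfl⟩
  · have hm : ∀ i, C.reverse.mid i = C.mid i := fun i => by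
      change C.pos (C.next i) + C.pos (C.next (C.next.symm i)) = _
      rw [Equiv.apply_symm_apply, add_comm, mid]
    have h' : C.reverse.IsLowest i₀ := fun j => by rw [hm, hm]; exact h j
    have hE : C.reverse.dir i₀ = .E := by
      change (C.dir i₀).opp = _
      rw [hW]; rfl
    have h1 := C.reverse.area_pos_of_isLowest h' hE fun i => h0 _
    have h2 := C.reverse.turning_of_isLowest h' hE
    rw [area_reverse] at h1
    rw [turning_reverse] at h2
    have h3 : C.area < 0 := by omega
    rw [Int.sign_eq_neg_one_of_neg h3]
    exact ⟨h3.ne, by omega⟩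

end LatticeCycle

variable {n : ℕ} (D : GridDiagram n)

/-! ### Half-edges of the diagram -/

theorem lo_lt_hi (c : Fin n) : D.lo c < D.hi c := by
  unfold lo hi; exact min_lt_max.2 (D.ne c)

theorem colX_ne_colO (r : Fin n) : D.colX r ≠ D.colO r := by
  unfold colX colO
  intro h
  apply D.ne (D.rowX.symm r)
  rw [Equiv.apply_symm_apply, h, Equiv.apply_symm_apply]

theorem left_lt_right (r : Fin n) : D.left r < D.right r := by
  unfold left right; exact min_lt_max.2 (D.colX_ne_colO r)

/-- Both sides say that the square contains a puncture; vertical and horizontal segments end at the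
same points. -/
theorem eq_lo_or_hi_iff (c r : Fin n) :
    (r = D.lo c ∨ r = D.hi c) ↔ (c = D.left r ∨ c = D.right r) := by
  have h1 : (r = D.lo c ∨ r = D.hi c) ↔ (D.rowX c = r ∨ D.rowO c = r) := by
    unfold lo hi; rcases le_total (D.rowX c) (D.rowO c) with h | h <;> simp [h, eq_comm, or_comm]
  have h2 : (c = D.left r ∨ c = D.right r) ↔ (D.colX r = c ∨ D.colO r = c) := by
    unfold left right
    rcases le_total (D.colX r) (D.colO r) with h | h <;> simp [h, eq_comm, or_comm]
  rw [h1, h2]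
  unfold colX colO
  rw [Equiv.symm_apply_eq, Equiv.symm_apply_eq, eq_comm (a := r), eq_comm (a := r)]

/-- The lattice point `(c, r)` lies on an edge of the diagram in the direction `d`. -/
def HasEnd (c r : Fin n) : Dir → Prop
  | .N => D.lo c ≤ r ∧ r < D.hi c
  | .S => D.lo c < r ∧ r ≤ D.hi c
  | .E => D.left r ≤ c ∧ c < D.right r
  | .W => D.left r < c ∧ c ≤ D.right r

instance (c r : Fin n) (d : Dir) : Decidable (D.HasEnd c r d) := by
  cases d <;> unfold HasEnd <;> infer_instance

variable {D}

theorem IsCrossing.hasEnd {c r : Fin n} (h : D.IsCrossing c r) (d : Dir) : D.HasEnd c r d := by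
  obtain ⟨h1, h2, h3, h4⟩ := h
  cases d
  · exact ⟨h1.le, h2⟩
  · exact ⟨h3.le, h4⟩
  · exact ⟨h1, h2.le⟩
  · exact ⟨h3, h4.le⟩

/-- A lattice point of the diagram which is not a crossing has exactly two ends. -/
theorem exists_two_ends {c r : Fin n} (hc : ¬D.IsCrossing c r) {d : Dir} (h : D.HasEnd c r d) :
    ∃ e, d ≠ e ∧ ∀ x, D.HasEnd c r x ↔ x = d ∨ x = e := by
  have h1 := D.lo_lt_hi c
  have h2 := D.left_lt_right r
  have h3 := D.eq_lo_or_hi_iff c r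
  unfold IsCrossing at hc
  have all : ∀ {p : Dir → Prop}, (∀ x, p x) ↔ p .N ∧ p .E ∧ p .S ∧ p .W :=
    fun {p} => ⟨fun h => ⟨h _, h _, h _, h _⟩, fun ⟨a, b, c, d⟩ x => by cases x <;> assumption⟩
  have ex : ∀ {p : Dir → Prop}, (∃ x, p x) ↔ p .N ∨ p .E ∨ p .S ∨ p .W :=
    fun {p} => ⟨fun ⟨x, h⟩ => by cases x <;> simp [h], fun h => by
      rcases h with h | h | h | h <;> exact ⟨_, h⟩⟩
  rw [ex]
  simp only [all]
  cases d <;> simp only [HasEnd, ne_eq, reduceCtorEq, not_true_eq_false, not_false_eq_true,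
    false_and, true_and, or_false, false_or, iff_true, iff_false, or_true,
    Fin.lt_def, Fin.le_def, Fin.ext_iff] at * <;> omega

/-- The other end of the arc of a smoothed crossing. -/
def Smoothing.partner : Smoothing → Dir → Dir
  | .A, .N => .E
  | .A, .E => .N
  | .A, .S => .W
  | .A, .W => .S
  | .B, .N => .W
  | .B, .W => .N
  | .B, .S => .E
  | .B, .E => .S

theorem Smoothing.eq_partner_iff (x : Smoothing) (d e : Dir) :
    e = x.partner d ↔ e ≠ d ∧ x.arc d = x.arc e := by
  cases x <;> cases d <;> cases e <;> simp [partner, arc]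

/-- The end which follows the end `d` at the lattice point `(c, r)` in the resolved diagram. -/
def Resolution.partnerDir (s : D.Resolution) (c r : Fin n) (d : Dir) : Dir :=
  if h : D.IsCrossing c r then (s ⟨(c, r), h⟩).partner d
  else if D.HasEnd c r d.opp then d.opp
  else if D.HasEnd c r d.rotR then d.rotR else d.rotR.opp

/-- Every end has exactly one successor: at a crossing because arcs have two ends, elsewhere because
the lattice point has only two ends. -/
theorem Resolution.eq_partnerDir_iff (s : D.Resolution) {c r : Fin n} {d : Dir}
    (h : D.HasEnd c r d) (e : Dir) :
    e = s.partnerDir c r d ↔ e ≠ d ∧ D.HasEnd c r e ∧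
      ∀ h : D.IsCrossing c r, (s ⟨(c, r), h⟩).arc d = (s ⟨(c, r), h⟩).arc e := by
  by_cases hc : D.IsCrossing c r
  · simp only [partnerDir, dif_pos hc, Smoothing.eq_partner_iff, hc.hasEnd e, true_and]
    exact ⟨fun h => ⟨h.1, fun _ => h.2⟩, fun h => ⟨h.1, h.2 hc⟩⟩
  · obtain ⟨x, hx, hx'⟩ := exists_two_ends hc h
    have : s.partnerDir c r d = x := by
      simp only [partnerDir, dif_neg hc, hx']
      cases d <;> cases x <;> simp [Dir.opp, Dir.rotR] at hx ⊢
    rw [this]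
    simp only [hc, IsEmpty.forall_iff, and_true, hx']
    constructor
    · rintro rfl; exact ⟨hx.symm, Or.inr rfl⟩
    · rintro ⟨h1, h2⟩; exact h2.resolve_left h1

/-- The orientation of a half-edge relative to the coordinate axes. -/
def Dir.sgn : Dir → ℤˣ
  | .N => 1
  | .E => 1
  | .S => -1
  | .W => -1

variable (D)

/-- The half-edges of the diagram. -/
def Half : Type := {x : (Fin n × Fin n) × Dir // D.HasEnd x.1.1 x.1.2 x.2}

instance : Fintype D.Half := by unfold Half; infer_instance

instance : DecidableEq D.Half := by unfold Half; infer_instance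

instance : DecidableEq D.Edge := by unfold Edge; infer_instance

instance (e : UnitEdge n) : Decidable (D.Covers e) := by
  cases e <;> unfold Covers <;> infer_instance

instance : Fintype D.Edge := by unfold Edge; infer_instance

variable {D}

/-- The unit edge of a half-edge. -/
def edgeAt : (c r : Fin n) → (d : Dir) → D.HasEnd c r d → D.Edge
  | c, r, .N, h => ⟨.vert c r, h⟩
  | c, r, .E, h => ⟨.horiz c r, h⟩
  | c, r, .S, h => ⟨.vert c ⟨r - 1, by omega⟩, by
      simp only [HasEnd, Covers, Fin.lt_def, Fin.le_def] at *; omega⟩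
  | c, r, .W, h => ⟨.horiz ⟨c - 1, by omega⟩ r, by
      simp only [HasEnd, Covers, Fin.lt_def, Fin.le_def] at *; omega⟩

namespace Half

/-- The lattice point of a half-edge. -/
def pt (h : D.Half) : Fin n × Fin n := h.1.1

def dir (h : D.Half) : Dir := h.1.2

def edge (h : D.Half) : D.Edge := edgeAt _ _ _ h.2

/-- The lattice point of a half-edge, as an integral point. -/
def pos (h : D.Half) : ℤ × ℤ := ((h.pt.1 : ℕ), (h.pt.2 : ℕ))

theorem ext {h h' : D.Half} (h1 : h.pt = h'.pt) (h2 : h.dir = h'.dir) : h = h' :=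
  Subtype.ext (Prod.ext h1 h2)

theorem pos_injective {h h' : D.Half} (H : h.pos = h'.pos) : h.pt = h'.pt := by
  simp only [pos, Prod.mk.injEq, Nat.cast_inj] at H
  exact Prod.ext (Fin.ext H.1) (Fin.ext H.2)

theorem ext_iff' {h h' : D.Half} : h = h' ↔
    ((h.pt.1 : ℕ) = h'.pt.1 ∧ (h.pt.2 : ℕ) = h'.pt.2) ∧ h.dir = h'.dir := by
  constructor
  · rintro rfl; simp
  · rintro ⟨⟨h1, h2⟩, h3⟩; exact ext (Prod.ext (Fin.ext h1) (Fin.ext h2)) h3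

/-- The other end of the edge of a half-edge. -/
def other : D.Half → D.Half
  | ⟨((c, r), .N), h⟩ =>
    have h' : D.lo c ≤ r ∧ r < D.hi c := h
    ⟨((c, ⟨r + 1, by omega⟩), .S),
      show D.lo c < _ ∧ _ ≤ D.hi c by simp only [Fin.lt_def, Fin.le_def] at h' ⊢; omega⟩
  | ⟨((c, r), .E), h⟩ =>
    have h' : D.left r ≤ c ∧ c < D.right r := h
    ⟨((⟨c + 1, by omega⟩, r), .W),
      show D.left r < _ ∧ _ ≤ D.right r by simp only [Fin.lt_def, Fin.le_def] at h' ⊢; omega⟩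
  | ⟨((c, r), .S), h⟩ =>
    have h' : D.lo c < r ∧ r ≤ D.hi c := h
    ⟨((c, ⟨r - 1, by omega⟩), .N),
      show D.lo c ≤ _ ∧ _ < D.hi c by simp only [Fin.lt_def, Fin.le_def] at h' ⊢; omega⟩
  | ⟨((c, r), .W), h⟩ =>
    have h' : D.left r < c ∧ c ≤ D.right r := h
    ⟨((⟨c - 1, by omega⟩, r), .E),
      show D.left r ≤ _ ∧ _ < D.right r by simp only [Fin.lt_def, Fin.le_def] at h' ⊢; omega⟩

theorem other_spec (h : D.Half) : h.other.edge = h.edge ∧ h.other.dir = h.dir.opp ∧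
    h.other.pos = h.pos + h.dir.vec := by
  obtain ⟨⟨⟨c, r⟩, d⟩, h⟩ := h
  cases d <;> refine ⟨Subtype.ext ?_, rfl, Prod.ext ?_ ?_⟩ <;>
    simp only [HasEnd, Fin.lt_def, Fin.le_def] at h <;>
    simp [other, edge, edgeAt, pos, pt, dir, Dir.vec] <;> omega

theorem edge_eq_iff (h h' : D.Half) : h.edge = h'.edge ↔ h' = h ∨ h' = h.other := by
  constructor
  · intro H
    rw [ext_iff', ext_iff']
    replace H := congrArg Subtype.val H
    revert H
    obtain ⟨⟨⟨c, r⟩, d⟩, h⟩ := h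
    obtain ⟨⟨⟨c', r'⟩, d'⟩, h'⟩ := h'
    cases d <;> cases d' <;>
      simp only [other, edge, edgeAt, HasEnd, Fin.lt_def, Fin.le_def, pt, dir,
        UnitEdge.vert.injEq, UnitEdge.horiz.injEq, Fin.ext_iff, reduceCtorEq,
        and_true, and_false, or_false, false_or, IsEmpty.forall_iff] at h h' ⊢ <;> omega
  · rintro (rfl | rfl)
    · rfl
    · exact h.other_spec.1.symm

end Half

theorem Dir.sgn_opp (d : Dir) : d.opp.sgn = -d.sgn := by cases d <;> rfl

/-- Half-edges are oriented edges. -/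
theorem exists_half (e : D.Edge) (u : ℤˣ) : ∃! h : D.Half, h.edge = e ∧ h.dir.sgn = u := by
  obtain ⟨h₀, h₀e⟩ : ∃ h : D.Half, h.edge = e := by
    obtain ⟨e | e, he⟩ := e
    · exact ⟨⟨((_, _), .N), he⟩, rfl⟩
    · exact ⟨⟨((_, _), .E), he⟩, rfl⟩
  obtain ⟨h₁, h₁e, h₁s⟩ : ∃ h : D.Half, h.edge = e ∧ h.dir.sgn = u := by
    by_cases hu : h₀.dir.sgn = u
    · exact ⟨h₀, h₀e, hu⟩
    · refine ⟨h₀.other, h₀.other_spec.1.trans h₀e, ?_⟩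
      rw [h₀.other_spec.2.1, Dir.sgn_opp]
      exact (Int.units_ne_iff_eq_neg.1 (Ne.symm hu)).symm
  refine ⟨h₁, ⟨h₁e, h₁s⟩, fun h' ⟨h1, h2⟩ => ?_⟩
  rcases (Half.edge_eq_iff h₁ h').1 (h₁e.trans h1.symm) with h | h
  · exact h
  · rw [h, h₁.other_spec.2.1, Dir.sgn_opp, h₁s] at h2
    exact absurd h2 (by rcases Int.units_eq_one_or u with rfl | rfl <;> decide)

/-- The half-edges as edges with an orientation, pointing away from the lattice point. -/
noncomputable def halfEquiv : D.Half ≃ D.Edge × ℤˣ :=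
  Equiv.ofBijective (fun h => (h.edge, h.dir.sgn)) ⟨fun h h' H => by
    obtain ⟨x, -, hx⟩ := exists_half h.edge h.dir.sgn
    rw [hx h ⟨rfl, rfl⟩, hx h' ⟨(congrArg Prod.fst H).symm, (congrArg Prod.snd H).symm⟩],
    fun ⟨e, u⟩ => by
      obtain ⟨h, ⟨h1, h2⟩, -⟩ := exists_half e u
      exact ⟨h, Prod.ext h1 h2⟩⟩

theorem halfEquiv_apply (h : D.Half) : halfEquiv h = (h.edge, h.dir.sgn) := rfl

@[simp] theorem edge_halfEquiv_symm (x : D.Edge × ℤˣ) : (halfEquiv.symm x).edge = x.1 :=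
  congrArg Prod.fst (halfEquiv.apply_symm_apply x)

@[simp] theorem sgn_halfEquiv_symm (x : D.Edge × ℤˣ) : (halfEquiv.symm x).dir.sgn = x.2 :=
  congrArg Prod.snd (halfEquiv.apply_symm_apply x)

theorem Half.other_eq (h : D.Half) : h.other = halfEquiv.symm (h.edge, -h.dir.sgn) := by
  rw [Equiv.eq_symm_apply, halfEquiv_apply, h.other_spec.1, h.other_spec.2.1, Dir.sgn_opp]

/-- The position of the edge of a half-edge. -/
theorem Half.edge_injective {h h' : D.Half}
    (H : h.pos + (h.pos + h.dir.vec) = h'.pos + (h'.pos + h'.dir.vec)) : h.edge = h'.edge := by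
  have H1 := congrArg Prod.fst H
  have H2 := congrArg Prod.snd H
  clear H
  refine Subtype.ext ?_
  obtain ⟨⟨⟨c, r⟩, d⟩, h⟩ := h
  obtain ⟨⟨⟨c', r'⟩, d'⟩, h'⟩ := h'
  cases d <;> cases d' <;>
    simp only [edge, edgeAt, HasEnd, Fin.lt_def, Fin.le_def, pos, pt, dir, Dir.vec,
      UnitEdge.vert.injEq, UnitEdge.horiz.injEq, Fin.ext_iff, reduceCtorEq, Prod.fst_add,
      Prod.snd_add] at h h' H1 H2 ⊢ <;> omega

theorem leaves_iff (e : D.Edge) (c r : Fin n) (d : Dir) :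
    e.1.Leaves c r d ↔ ∃ h : D.HasEnd c r d, e = edgeAt c r d h := by
  constructor
  · obtain ⟨⟨x, y⟩ | ⟨x, y⟩, he⟩ := e <;> cases d <;> intro h <;>
      simp only [UnitEdge.Leaves] at h <;> obtain ⟨rfl, h2⟩ := h <;>
      [obtain rfl := h2; skip; obtain rfl := h2; skip] <;>
      simp only [Covers, Fin.lt_def, Fin.le_def] at he
    · exact ⟨he, rfl⟩
    · refine ⟨⟨by simp only [Fin.lt_def]; omega, by simp only [Fin.le_def]; omega⟩, Subtype.ext ?_⟩
      simp only [edgeAt, UnitEdge.vert.injEq, true_and, Fin.ext_iff]; omega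
    · exact ⟨he, rfl⟩
    · refine ⟨⟨by simp only [Fin.lt_def]; omega, by simp only [Fin.le_def]; omega⟩, Subtype.ext ?_⟩
      simp only [edgeAt, UnitEdge.horiz.injEq, and_true, Fin.ext_iff]; omega
  · rintro ⟨h, rfl⟩
    cases d <;> simp only [edgeAt, UnitEdge.Leaves, true_and, and_true] <;>
      simp only [HasEnd, Fin.lt_def] at h <;> omega

end GridDiagram

namespace GridDiagram

variable {n : ℕ} {D : GridDiagram n}

/-! ### Flows on the diagram and the circles of a resolution -/

namespace Half

/-- The flow through a half-edge, away from its lattice point. -/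
def out (o : D.Edge → ℤˣ) (h : D.Half) : ℤˣ := h.dir.sgn * o h.edge

/-- The half-edge following `h` in the resolved diagram. -/
def partner (s : D.Resolution) (h : D.Half) : D.Half :=
  ⟨(h.pt, s.partnerDir h.pt.1 h.pt.2 h.dir), ((s.eq_partnerDir_iff h.2 _).1 rfl).2.1⟩

theorem pt_partner (s : D.Resolution) (h : D.Half) : (h.partner s).pt = h.pt := rfl

theorem eq_partner_iff (s : D.Resolution) (h h' : D.Half) :
    h' = h.partner s ↔ h' ≠ h ∧ h'.pt = h.pt ∧ ∀ H : D.IsCrossing h.pt.1 h.pt.2,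
      (s ⟨(h.pt.1, h.pt.2), H⟩).arc h.dir = (s ⟨(h.pt.1, h.pt.2), H⟩).arc h'.dir := by
  constructor
  · rintro rfl
    obtain ⟨h1, h2, h3⟩ := (s.eq_partnerDir_iff h.2 _).1 rfl
    exact ⟨fun e => h1 (congrArg Half.dir e), rfl, h3⟩
  · rintro ⟨h1, h2, h3⟩
    refine ext h2 ((s.eq_partnerDir_iff h.2 _).2 ⟨fun e => h1 (ext h2 e), ?_, h3⟩)
    have := h'.2
    rw [show h'.1.1 = h.1.1 from h2] at this
    exact this

theorem partner_ne (s : D.Resolution) (h : D.Half) : h.partner s ≠ h :=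
  ((eq_partner_iff s h _).1 rfl).1

theorem dir_partner_ne (s : D.Resolution) (h : D.Half) : (h.partner s).dir ≠ h.dir :=
  fun e => h.partner_ne s (ext rfl e)

theorem partner_partner (s : D.Resolution) (h : D.Half) : (h.partner s).partner s = h := by
  obtain ⟨h1, h2, h3⟩ := (eq_partner_iff s h _).1 rfl
  exact ((eq_partner_iff s _ _).2 ⟨h1.symm, h2.symm, fun H => (h3 H).symm⟩).symm

/-- At a lattice point that is not a crossing there are only two half-edges. -/
theorem eq_or_eq_partner (s : D.Resolution) {h h' : D.Half} (hp : h'.pt = h.pt)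
    (hc : ¬D.IsCrossing h.pt.1 h.pt.2) : h' = h ∨ h' = h.partner s := by
  by_cases e : h' = h
  · exact Or.inl e
  · exact Or.inr ((eq_partner_iff s h h').2 ⟨e, hp, fun H => absurd H hc⟩)

theorem dir_partner_of_isCrossing (s : D.Resolution) {h : D.Half}
    (hc : D.IsCrossing h.pt.1 h.pt.2) : (h.partner s).dir = (s ⟨_, hc⟩).partner h.dir :=
  dif_pos hc

end Half

namespace Resolution

variable (s : D.Resolution)

theorem joined_iff (e f : D.Edge) :
    s.Joined e f ↔ ∃ h : D.Half, e = h.edge ∧ (f = h.edge ∨ f = (h.partner s).edge) := by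
  constructor
  · rintro ⟨c, r, d, d', h1, h2, h3⟩
    obtain ⟨k1, rfl⟩ := (leaves_iff _ _ _ _).1 h1
    obtain ⟨k2, rfl⟩ := (leaves_iff _ _ _ _).1 h2
    refine ⟨⟨((c, r), d), k1⟩, rfl, ?_⟩
    by_cases hd : d' = d
    · subst hd; exact Or.inl rfl
    · refine Or.inr (congrArg Half.edge
        ((Half.eq_partner_iff s ⟨((c, r), d), k1⟩ ⟨((c, r), d'), k2⟩).2 ⟨?_, rfl, h3⟩))
      exact fun e => hd (congrArg Half.dir e)
  · rintro ⟨h, rfl, rfl | rfl⟩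
    · exact ⟨h.pt.1, h.pt.2, h.dir, h.dir, (leaves_iff _ _ _ _).2 ⟨h.2, rfl⟩,
        (leaves_iff _ _ _ _).2 ⟨h.2, rfl⟩, fun _ => rfl⟩
    · exact ⟨h.pt.1, h.pt.2, h.dir, (h.partner s).dir, (leaves_iff _ _ _ _).2 ⟨h.2, rfl⟩,
        (leaves_iff _ _ _ _).2 ⟨(h.partner s).2, rfl⟩, ((Half.eq_partner_iff s h _).1 rfl).2.2⟩

/-- The circle of a unit edge. -/
def circle (e : D.Edge) : s.Circle := Quotient.mk _ e

theorem circle_partner (h : D.Half) : s.circle (h.partner s).edge = s.circle h.edge :=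
  Quotient.sound (Relation.EqvGen.symm _ _
    (Relation.EqvGen.rel _ _ ((s.joined_iff _ _).2 ⟨h, rfl, Or.inr rfl⟩)))

noncomputable instance : DecidableEq s.Circle := Classical.decEq _

/-- A flow which respects the arcs of a resolution. -/
def Consistent (o : D.Edge → ℤˣ) : Prop := ∀ h : D.Half, (h.partner s).out o = -h.out o

end Resolution

/-- The half-edge at the end of an edge, with respect to a flow. -/
noncomputable def head (o : D.Edge → ℤˣ) (e : D.Edge) : D.Half := halfEquiv.symm (e, -o e)

/-- The half-edge at the beginning of an edge, with respect to a flow. -/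
noncomputable def tail (o : D.Edge → ℤˣ) (e : D.Edge) : D.Half := halfEquiv.symm (e, o e)

section
variable (o : D.Edge → ℤˣ)

theorem edge_head (e : D.Edge) : (head o e).edge = e := edge_halfEquiv_symm _

theorem edge_tail (e : D.Edge) : (tail o e).edge = e := edge_halfEquiv_symm _

theorem out_head (e : D.Edge) : (head o e).out o = -1 := by
  unfold Half.out
  rw [edge_head, head, sgn_halfEquiv_symm, neg_mul, Int.units_mul_self]

theorem out_tail (e : D.Edge) : (tail o e).out o = 1 := by
  unfold Half.out
  rw [edge_tail, tail, sgn_halfEquiv_symm, Int.units_mul_self]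

theorem eq_head {h : D.Half} (H : h.out o = -1) : h = head o h.edge := by
  rw [head, Equiv.eq_symm_apply, halfEquiv_apply]
  refine Prod.ext rfl ?_
  unfold Half.out at H
  change h.dir.sgn = -o h.edge
  rw [← neg_one_mul, ← H, mul_assoc, Int.units_mul_self, mul_one]

theorem eq_tail {h : D.Half} (H : h.out o = 1) : h = tail o h.edge := by
  rw [tail, Equiv.eq_symm_apply, halfEquiv_apply]
  exact Prod.ext rfl (Int.units_inv_eq_self (o h.edge) ▸ eq_inv_of_mul_eq_one_left H)

theorem other_tail (e : D.Edge) : (tail o e).other = head o e := by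
  rw [Half.other_eq, edge_tail, head, tail, sgn_halfEquiv_symm]

end

/-! ### The circles of a resolution as simple closed lattice curves. -/

namespace Resolution

variable {s : D.Resolution} {o : D.Edge → ℤˣ}

theorem Consistent.partner_head (hc : s.Consistent o) (e : D.Edge) :
    (head o e).partner s = tail o ((head o e).partner s).edge :=
  eq_tail o (by rw [hc, out_head, neg_neg])

theorem Consistent.partner_tail (hc : s.Consistent o) (e : D.Edge) :
    (tail o e).partner s = head o ((tail o e).partner s).edge :=
  eq_head o (by rw [hc, out_tail])

/-- The successor of an edge along a flow. -/
noncomputable def Consistent.next (hc : s.Consistent o) : Equiv.Perm D.Edge where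
  toFun e := ((head o e).partner s).edge
  invFun e := ((tail o e).partner s).edge
  left_inv e := by dsimp only; rw [← hc.partner_head, Half.partner_partner, edge_head]
  right_inv e := by dsimp only; rw [← hc.partner_tail, Half.partner_partner, edge_tail]

theorem Consistent.tail_next (hc : s.Consistent o) (e : D.Edge) :
    tail o (hc.next e) = (head o e).partner s := (hc.partner_head e).symm

theorem Consistent.circle_next (hc : s.Consistent o) (e : D.Edge) :
    s.circle (hc.next e) = s.circle e := by
  change s.circle ((head o e).partner s).edge = _
  rw [circle_partner, edge_head]

/-- Joined edges are equal or adjacent along the flow, forwards or backwards according to the sign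
of the flow at the half-edge. -/
theorem Consistent.sameCycle (hc : s.Consistent o) {e f : D.Edge} (h : s.circle e = s.circle f) :
    hc.next.SameCycle e f := by
  have h' : Relation.EqvGen s.Joined e f := Quotient.exact h
  clear h
  induction h' with
  | rel e f _ =>
    obtain ⟨h, rfl, rfl | rfl⟩ := (s.joined_iff e f).1 ‹_›
    · exact Equiv.Perm.SameCycle.rfl
    · rcases Int.units_eq_one_or (h.out o) with H | H
      · refine ⟨-1, ?_⟩
        rw [zpow_neg_one]
        change ((tail o h.edge).partner s).edge = _
        rw [← eq_tail o H]
      · refine ⟨1, ?_⟩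
        rw [zpow_one]
        change ((head o h.edge).partner s).edge = _
        rw [← eq_head o H]
  | refl e => exact Equiv.Perm.SameCycle.rfl
  | symm e f _ ih => exact ih.symm
  | trans e f g _ _ ih ih' => exact ih.trans ih'

/-- A circle of a resolution as a simple closed lattice curve. -/
noncomputable def Consistent.latticeCycle (hc : s.Consistent o) (C : s.Circle) :
    LatticeCycle {e : D.Edge // s.circle e = C} where
  next := hc.next.subtypePerm fun e => by rw [hc.circle_next]
  pos e := (tail o e.1).pos
  dir e := (tail o e.1).dir
  sameCycle e f := by
    obtain ⟨k, hk⟩ := hc.sameCycle (e.2.trans f.2.symm)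
    refine ⟨k, Subtype.ext ?_⟩
    rw [Equiv.Perm.subtypePerm_zpow]
    exact hk
  pos_next e := by
    rw [Equiv.Perm.subtypePerm_apply]
    dsimp only
    rw [hc.tail_next, ← (tail o e.1).other_spec.2.2, other_tail]
    rfl
  dir_next_ne e := by
    rw [Equiv.Perm.subtypePerm_apply]
    dsimp only
    rw [hc.tail_next, ← (tail o e.1).other_spec.2.1, other_tail]
    exact Half.dir_partner_ne _ _
  mid_injective e f h := by
    have key : ∀ e : D.Edge, (tail o (hc.next e)).pos = (tail o e).pos + (tail o e).dir.vec := by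
      intro e
      rw [hc.tail_next, ← (tail o e).other_spec.2.2, other_tail]
      rfl
    simp only [Equiv.Perm.subtypePerm_apply, key] at h
    have := Half.edge_injective h
    rw [edge_tail, edge_tail] at this
    exact Subtype.ext this
  not_cross e f hef h := by
    simp only [Equiv.Perm.subtypePerm_apply, hc.tail_next] at h ⊢
    have hp : (head o f.1).pt = (head o e.1).pt := (Half.pos_injective h).symm
    rintro ⟨h1, h2⟩
    -- At a crossing the arcs of a smoothing always bend. At any other lattice point there is only
    -- one arc, so the two incoming edges would coincide.
    by_cases H : D.IsCrossing (head o e.1).pt.1 (head o e.1).pt.2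
    · have h3 : (head o e.1).dir = (tail o e.1).dir.opp := by
        rw [← other_tail, (tail o e.1).other_spec.2.1]
      rw [Half.dir_partner_of_isCrossing s H, h3] at h1
      revert h1
      generalize s ⟨_, H⟩ = x
      cases x <;> cases (tail o e.1).dir <;> simp [Smoothing.partner, Dir.opp]
    · rcases Half.eq_or_eq_partner s hp H with h' | h'
      · apply hef
        have := congrArg Half.edge h'
        rw [edge_head, edge_head] at this
        exact Subtype.ext this.symm
      · have := congrArg (Half.out o) h'
        rw [hc, out_head, out_head] at this
        exact absurd this (by decide)

end Resolution

/-- The abscissa of a vertical unit edge. -/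
def edgeAbscissa : D.Edge → ℤ
  | ⟨.vert c _, _⟩ => (c : ℕ)
  | ⟨.horiz _ _, _⟩ => 0

theorem Half.pos_mul_vec (h : D.Half) :
    h.pos.1 * h.dir.vec.2 = edgeAbscissa h.edge * (h.dir.sgn : ℤ) := by
  obtain ⟨⟨⟨c, r⟩, d⟩, h⟩ := h
  cases d <;> simp [edge, edgeAt, pos, pt, dir, Dir.vec, edgeAbscissa, Dir.sgn]

namespace Resolution

variable (s : D.Resolution) {o : D.Edge → ℤˣ}

/-- The area enclosed by a circle of a resolution, with respect to a flow. -/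
noncomputable def circleArea (o : D.Edge → ℤˣ) (C : s.Circle) : ℤ :=
  ∑ e : {e : D.Edge // s.circle e = C}, edgeAbscissa e.1 * (o e.1 : ℤ)

/-- The total turning of a flow along the arcs of a resolution, in quarter turns. -/
noncomputable def turning (o : D.Edge → ℤˣ) : ℤ :=
  ∑ e : D.Edge, Dir.turn (tail o e).dir ((head o e).partner s).dir

variable {s}

/-- The Umlaufsatz for one circle; its hypothesis holds because the diagram lies in the first
quadrant. -/
theorem Consistent.turning_circle (hc : s.Consistent o) (C : s.Circle) :
    s.circleArea o C ≠ 0 ∧ (hc.latticeCycle C).turning = 4 * (s.circleArea o C).sign := by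
  obtain ⟨e, he⟩ := Quotient.exists_rep C
  have : Nonempty {f : D.Edge // s.circle f = C} := ⟨⟨e, he⟩⟩
  have h := (hc.latticeCycle C).turning_eq_sign_area
    fun i => ⟨Int.natCast_nonneg _, Int.natCast_nonneg _⟩
  have : (hc.latticeCycle C).area = s.circleArea o C := by
    unfold LatticeCycle.area circleArea
    refine Finset.sum_congr rfl fun f _ => ?_
    change (tail o f.1).pos.1 * (tail o f.1).dir.vec.2 = _
    rw [Half.pos_mul_vec, edge_tail, tail, sgn_halfEquiv_symm]
  rw [this] at h
  exact h

theorem Consistent.turning_eq (hc : s.Consistent o) :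
    s.turning o = ∑ C, 4 * (s.circleArea o C).sign := by
  unfold turning
  rw [← Fintype.sum_fiberwise s.circle]
  refine Finset.sum_congr rfl fun C _ => ?_
  rw [← (hc.turning_circle C).2]
  unfold LatticeCycle.turning
  refine Finset.sum_congr rfl fun e _ => ?_
  change _ = Dir.turn (tail o e.1).dir (tail o (hc.next e.1)).dir
  rw [hc.tail_next]

end Resolution

end GridDiagram

namespace GridDiagram

variable {n : ℕ} (D : GridDiagram n)

/-! ### The checkerboard flow -/

/-- The checkerboard coloring of the complement of the diagram, at the unit square with lower left
corner `(x, y)`. -/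
def checkerboard (x y : ℤ) : ℤˣ :=
  ∏ c : Fin n, if ((c : ℕ) : ℤ) ≤ x ∧ ((D.lo c : ℕ) : ℤ) ≤ y ∧ y < ((D.hi c : ℕ) : ℤ) then -1 else 1

theorem checkerboard_left (c : Fin n) (y : ℤ) :
    D.checkerboard ((c : ℕ) - 1) y = D.checkerboard (c : ℕ) y *
      if ((D.lo c : ℕ) : ℤ) ≤ y ∧ y < ((D.hi c : ℕ) : ℤ) then -1 else 1 := by
  have : (if ((D.lo c : ℕ) : ℤ) ≤ y ∧ y < ((D.hi c : ℕ) : ℤ) then (-1 : ℤˣ) else 1) =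
      ∏ c', if c' = c then
        (if ((D.lo c' : ℕ) : ℤ) ≤ y ∧ y < ((D.hi c' : ℕ) : ℤ) then (-1 : ℤˣ) else 1) else 1 := by
    simp
  rw [this, checkerboard, checkerboard, ← Finset.prod_mul_distrib]
  refine Finset.prod_congr rfl fun c' _ => ?_
  rcases lt_trichotomy c' c with h | rfl | h
  · have h' : (c' : ℕ) < c := h
    rw [if_neg h.ne, mul_one]
    refine if_congr ?_ rfl rfl
    omega
  · rw [if_pos rfl, if_neg (by omega)]
    split_ifs with h1 h2 h2
    · rfl
    · omega
    · omega
    · rfl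
  · have h' : (c : ℕ) < c' := h
    rw [if_neg h.ne', mul_one]
    refine if_congr ?_ rfl rfl
    omega

/-- A factor changes between the rows `r - 1` and `r` only when the vertical segment of its column
ends in row `r`, which happens in the two end columns of that row. So the coloring also changes
across horizontal segments. -/
theorem checkerboard_below (x : ℤ) (r : Fin n) :
    D.checkerboard x ((r : ℕ) - 1) = D.checkerboard x (r : ℕ) *
      if ((D.left r : ℕ) : ℤ) ≤ x ∧ x < ((D.right r : ℕ) : ℤ) then -1 else 1 := by
  have h1 : ∀ c₀ : Fin n, (if ((c₀ : ℕ) : ℤ) ≤ x then (-1 : ℤˣ) else 1) =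
      ∏ c, if c = c₀ then (if ((c : ℕ) : ℤ) ≤ x then (-1 : ℤˣ) else 1) else 1 := by simp
  have h2 : (if ((D.left r : ℕ) : ℤ) ≤ x ∧ x < ((D.right r : ℕ) : ℤ) then (-1 : ℤˣ) else 1) =
      (if ((D.left r : ℕ) : ℤ) ≤ x then (-1 : ℤˣ) else 1) *
        (if ((D.right r : ℕ) : ℤ) ≤ x then (-1 : ℤˣ) else 1) := by
    have : (D.left r : ℕ) < D.right r := D.left_lt_right r
    split_ifs <;> first | omega | rfl
  rw [h2, h1, h1, checkerboard, checkerboard, ← Finset.prod_mul_distrib, ← Finset.prod_mul_distrib]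
  refine Finset.prod_congr rfl fun c _ => ?_
  have e1 := D.eq_lo_or_hi_iff c r
  have e2 : (D.left r : ℕ) < D.right r := D.left_lt_right r
  have e3 : (D.lo c : ℕ) < D.hi c := D.lo_lt_hi c
  simp only [Fin.ext_iff] at e1 ⊢
  split_ifs <;> first | rfl | omega

/-- The flow whose edges have the odd color on their left. -/
def baseFlow : D.Edge → ℤˣ
  | ⟨.vert c y, _⟩ => D.checkerboard (c : ℕ) (y : ℕ)
  | ⟨.horiz x r, _⟩ => -D.checkerboard (x : ℕ) (r : ℕ)

variable {D}

theorem Half.out_baseFlow (h : D.Half) :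
    h.out D.baseFlow = D.checkerboard (h.pt.1 : ℕ) (h.pt.2 : ℕ) *
      match h.dir with
      | .N => 1
      | .E => -1
      | .S => if D.HasEnd h.pt.1 h.pt.2 .E then 1 else -1
      | .W => if D.HasEnd h.pt.1 h.pt.2 .N then -1 else 1 := by
  obtain ⟨⟨⟨c, r⟩, d⟩, h⟩ := h
  cases d
  · simp [out, edge, edgeAt, dir, pt, Dir.sgn, baseFlow]
  · simp [out, edge, edgeAt, dir, pt, Dir.sgn, baseFlow]
  · have h' : (D.lo c : ℕ) < r := h.1
    simp only [out, edge, edgeAt, dir, pt, Dir.sgn, baseFlow, HasEnd, Fin.le_def, Fin.lt_def]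
    rw [Nat.cast_sub (by omega), Nat.cast_one, checkerboard_below]
    simp only [Nat.cast_le, Nat.cast_lt]
    split_ifs <;> simp
  · have h' : (D.left r : ℕ) < c := h.1
    simp only [out, edge, edgeAt, dir, pt, Dir.sgn, baseFlow, HasEnd, Fin.le_def, Fin.lt_def]
    rw [Nat.cast_sub (by omega), Nat.cast_one, checkerboard_left]
    simp only [Nat.cast_le, Nat.cast_lt]
    split_ifs <;> simp

/-- The checkerboard flow is consistent with every resolution. -/
theorem Resolution.consistent_baseFlow (s : D.Resolution) : s.Consistent D.baseFlow := by
  intro h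
  rw [Half.out_baseFlow, Half.out_baseFlow, Half.pt_partner, ← mul_neg]
  congr 1
  by_cases hc : D.IsCrossing h.pt.1 h.pt.2
  · rw [Half.dir_partner_of_isCrossing s hc]
    simp only [hc.hasEnd, if_true]
    -- Around a crossing the colors alternate, so the flow alternates between inward and outward,
    -- while either smoothing joins neighbouring ends.
    have key : ∀ (x : Smoothing) (d : Dir), (match x.partner d with
        | .N => 1 | .E => -1 | .S => 1 | .W => -1 : ℤˣ) =
        -match d with | .N => 1 | .E => -1 | .S => 1 | .W => -1 := by decide
    exact key _ _
  · obtain ⟨e, he, hx⟩ := exists_two_ends hc h.2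
    have h4 : (h.partner s).dir = e :=
      ((hx _).1 (h.partner s).2).resolve_left (h.dir_partner_ne s)
    have hE : D.HasEnd h.pt.1 h.pt.2 .E ↔ .E = h.dir ∨ .E = e := hx _
    have hN : D.HasEnd h.pt.1 h.pt.2 .N ↔ .N = h.dir ∨ .N = e := hx _
    have he' : h.dir ≠ e := he
    rw [h4]
    simp only [hE, hN]
    generalize h.dir = d at *
    cases d <;> cases e <;> simp at he' ⊢

instance (s : D.Resolution) (o : D.Edge → ℤˣ) : Decidable (s.Consistent o) := by
  unfold Resolution.Consistent; infer_instance

namespace Resolution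

variable (s : D.Resolution)

/-- Reversing a flow along some circles. -/
def twist (o : D.Edge → ℤˣ) (χ : s.Circle → ℤˣ) (e : D.Edge) : ℤˣ := χ (s.circle e) * o e

variable {s} {o : D.Edge → ℤˣ}

theorem Consistent.twist (hc : s.Consistent o) (χ : s.Circle → ℤˣ) :
    s.Consistent (s.twist o χ) := by
  intro h
  have := hc h
  unfold Half.out Resolution.twist at *
  rw [circle_partner, mul_left_comm, this]
  simp only [mul_neg, mul_left_comm]

/-- The quotient of two consistent flows is constant along each circle; with `twist_injective`, the
consistent flows are all orientations of the circles, each occurring once. -/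
theorem Consistent.exists_twist (hc : s.Consistent o) {o' : D.Edge → ℤˣ} (hc' : s.Consistent o') :
    ∃ χ, s.twist o χ = o' := by
  have key : ∀ e f, Relation.EqvGen s.Joined e f → o' e * o e = o' f * o f := by
    intro e f h
    induction h with
    | rel e f _ =>
      obtain ⟨h, rfl, rfl | rfl⟩ := (s.joined_iff e f).1 ‹_›
      · rfl
      · have h1 := hc h
        have h2 := hc' h
        have h3 : (h.partner s).out o' * (h.partner s).out o = h.out o' * h.out o := by
          rw [h1, h2, neg_mul_neg]
        unfold Half.out at h3
        rw [mul_mul_mul_comm, mul_mul_mul_comm h.dir.sgn, Int.units_mul_self, Int.units_mul_self,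
          one_mul, one_mul] at h3
        exact h3.symm
    | refl e => rfl
    | symm e f _ ih => exact ih.symm
    | trans e f g _ _ ih ih' => exact ih.trans ih'
  refine ⟨Quotient.lift (fun e => o' e * o e) key, funext fun e => ?_⟩
  change o' e * o e * o e = o' e
  rw [mul_assoc, Int.units_mul_self, mul_one]

theorem twist_injective (o : D.Edge → ℤˣ) : Function.Injective (s.twist o) := by
  intro χ χ' h
  funext C
  obtain ⟨e, rfl⟩ := Quotient.exists_rep C
  exact mul_right_cancel (congrFun h e)

theorem circleArea_twist (o : D.Edge → ℤˣ) (χ : s.Circle → ℤˣ) (C : s.Circle) :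
    s.circleArea (s.twist o χ) C = (χ C : ℤ) * s.circleArea o C := by
  unfold circleArea
  rw [Finset.mul_sum]
  refine Finset.sum_congr rfl fun e _ => ?_
  rw [twist, e.2]
  push_cast
  ring

end Resolution

theorem T_sum {ι : Type*} (t : Finset ι) (f : ι → ℤ) :
    (LaurentPolynomial.T (∑ i ∈ t, f i) : ℤ[T;T⁻¹]) = ∏ i ∈ t, LaurentPolynomial.T (f i) := by
  classical
  induction t using Finset.induction_on with
  | empty => simp
  | insert a t ha ih => rw [Finset.sum_insert ha, Finset.prod_insert ha, LaurentPolynomial.T_add, ih]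

/-- The value of a collection of circles as a sum over their orientations. -/
theorem Resolution.sum_consistent (s : D.Resolution) :
    ∑ o with s.Consistent o, (LaurentPolynomial.T (s.turning o) : ℤ[T;T⁻¹]) =
      (LaurentPolynomial.T 4 + LaurentPolynomial.T (-4)) ^ s.numCircles := by
  have hb := s.consistent_baseFlow
  have h1 : ∑ o with s.Consistent o, (LaurentPolynomial.T (s.turning o) : ℤ[T;T⁻¹]) =
      ∑ χ : s.Circle → ℤˣ, LaurentPolynomial.T (s.turning (s.twist D.baseFlow χ)) := by
    symm
    refine Finset.sum_bij (fun χ _ => s.twist D.baseFlow χ) (fun χ _ => ?_)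
      (fun χ _ χ' _ h => twist_injective _ h) (fun o ho => ?_) (fun _ _ => rfl)
    · simpa using hb.twist χ
    · obtain ⟨χ, hχ⟩ := hb.exists_twist (Finset.mem_filter.1 ho).2
      exact ⟨χ, Finset.mem_univ _, hχ⟩
  have h2 : ∀ χ : s.Circle → ℤˣ, (LaurentPolynomial.T (s.turning (s.twist D.baseFlow χ)) : ℤ[T;T⁻¹]) =
      ∏ C, LaurentPolynomial.T (4 * ((χ C : ℤ) * (s.circleArea D.baseFlow C).sign)) := by
    intro χ
    rw [(hb.twist χ).turning_eq, T_sum]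
    refine Finset.prod_congr rfl fun C _ => ?_
    rw [circleArea_twist, Int.sign_mul]
    rcases Int.units_eq_one_or (χ C) with h | h <;> rw [h] <;> rfl
  -- Whichever way the checkerboard flow runs around the circle, the two signs give one
  -- counterclockwise and one clockwise orientation.
  have h3 : ∀ C : s.Circle, ∑ u : ℤˣ,
      (LaurentPolynomial.T (4 * ((u : ℤ) * (s.circleArea D.baseFlow C).sign)) : ℤ[T;T⁻¹]) =
      LaurentPolynomial.T 4 + LaurentPolynomial.T (-4) := by
    intro C
    rw [show (Finset.univ : Finset ℤˣ) = {1, -1} from rfl, Finset.sum_pair (by decide)]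
    rcases lt_or_gt_of_ne (hb.turning_circle C).1 with h | h
    · rw [Int.sign_eq_neg_one_of_neg h, add_comm]; rfl
    · rw [Int.sign_eq_one_of_pos h]; rfl
  rw [h1, Finset.sum_congr rfl fun χ _ => h2 χ, ← Fintype.piFinset_univ,
    ← Finset.prod_univ_sum (fun _ => Finset.univ) fun C (u : ℤˣ) =>
      (LaurentPolynomial.T (4 * ((u : ℤ) * (s.circleArea D.baseFlow C).sign)) : ℤ[T;T⁻¹]),
    Finset.prod_congr rfl fun C _ => h3 C, Finset.prod_const, numCircles, Finset.card_univ]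

end GridDiagram

namespace GridDiagram

variable {n : ℕ} {D : GridDiagram n}

/-! ### The state sum as a sum over flows -/

/-- The substitution `q = -T ^ 4`. -/
noncomputable def subst : ℤ[T;T⁻¹] →+* ℤ[T;T⁻¹] :=
  LaurentPolynomial.eval₂ (Int.castRingHom _)
    ⟨-LaurentPolynomial.T 4, -LaurentPolynomial.T (-4),
      by rw [neg_mul_neg, ← LaurentPolynomial.T_add]; rfl,
      by rw [neg_mul_neg, ← LaurentPolynomial.T_add]; rfl⟩

theorem subst_T_one : subst (LaurentPolynomial.T 1) = -LaurentPolynomial.T 4 := by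
  rw [subst, LaurentPolynomial.eval₂_T, zpow_one]

theorem subst_T_neg_one : subst (LaurentPolynomial.T (-1)) = -LaurentPolynomial.T (-4) := by
  rw [subst, LaurentPolynomial.eval₂_T, zpow_neg_one]; rfl

theorem subst_C (a : ℤ) : subst (LaurentPolynomial.C a) = LaurentPolynomial.C a := by
  rw [subst, LaurentPolynomial.eval₂_C]; simp

theorem subst_T (k : ℤ) : subst (LaurentPolynomial.T k) =
    LaurentPolynomial.C ((k.negOnePow : ℤˣ) : ℤ) * LaurentPolynomial.T (4 * k) := by
  induction k with
  | zero => simp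
  | succ k ih =>
    rw [LaurentPolynomial.T_add, map_mul, ih, subst_T_one, Int.negOnePow_succ, mul_add,
      LaurentPolynomial.T_add, mul_one, Units.val_neg, map_neg]
    ring
  | pred k ih =>
    rw [sub_eq_add_neg, LaurentPolynomial.T_add, map_mul, ih, subst_T_neg_one, Int.negOnePow_add,
      mul_add, LaurentPolynomial.T_add, show (-1 : ℤ).negOnePow = -1 from rfl, mul_neg_one,
      Units.val_neg, map_neg]
    ring_nf

/-- The coefficients reappear, up to sign, at the multiples of 4, which makes the substitution
injective. -/
theorem subst_coeff (f : ℤ[T;T⁻¹]) (k : ℤ) :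
    (subst f).coeff (4 * k) = ((k.negOnePow : ℤˣ) : ℤ) * f.coeff k := by
  induction f using LaurentPolynomial.induction_on' with
  | add p q hp hq => simp [hp, hq, mul_add]
  | C_mul_T m a =>
    rw [map_mul subst, subst_C, subst_T, ← mul_assoc, ← map_mul LaurentPolynomial.C, ← LaurentPolynomial.single_eq_C_mul_T,
      ← LaurentPolynomial.single_eq_C_mul_T, AddMonoidAlgebra.coeff_single,
      AddMonoidAlgebra.coeff_single, Finsupp.single_apply, Finsupp.single_apply]
    by_cases h : m = k
    · subst h; simp [mul_comm]
    · rw [if_neg h, if_neg (by omega), mul_zero]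

theorem subst_injective : Function.Injective subst := by
  intro f g h
  refine LaurentPolynomial.ext fun k => ?_
  have := congrArg (fun p => p.coeff (4 * k)) h
  simp only [subst_coeff] at this
  exact mul_left_cancel₀ (Units.ne_zero _) this

/-- The turning of a flow along the two arcs of a smoothed crossing. -/
def crossingTurn (x : Smoothing) (w : Dir → ℤˣ) : ℤ :=
  ∑ d, if w d = -1 then Dir.turn d.opp (x.partner d) else 0

/-- The weight of a crossing whose ends have the outward flows `w`. -/
noncomputable def crossingWeight (w : Dir → ℤˣ) : ℤ[T;T⁻¹] :=
  ∑ x : Smoothing, if ∀ d, w (x.partner d) = -w d then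
    (if x = .B then -LaurentPolynomial.T 4 else 1) * LaurentPolynomial.T (crossingTurn x w) else 0

/-- A straight flow allows only one smoothing, whose two arcs turn oppositely. A flow with outward
vertical ends and inward horizontal ends allows both, giving T^(-2) and -T^4 · T^2. In the reverse
case the terms are T^2 and -T^4 · T^(-2), which cancel. -/
theorem crossingWeight_eq (w : Dir → ℤˣ) : crossingWeight w =
    if w .S = -w .N ∧ w .W = -w .E then (if w .N = w .E then -LaurentPolynomial.T 4 else 1)
    else if w .N = 1 ∧ w .S = 1 ∧ w .E = -1 ∧ w .W = -1 then
      LaurentPolynomial.T (-2) - LaurentPolynomial.T 6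
    else 0 := by
  obtain ⟨a, b, c, d, rfl⟩ : ∃ a b c d : ℤˣ,
      w = fun x => match x with | .N => a | .E => b | .S => c | .W => d :=
    ⟨w .N, w .E, w .S, w .W, funext fun x => by cases x <;> rfl⟩
  unfold crossingWeight
  rw [show (Finset.univ : Finset Smoothing) = {.A, .B} from rfl, Finset.sum_pair (by simp)]
  have all : ∀ {p : Dir → Prop}, (∀ x, p x) ↔ p .N ∧ p .E ∧ p .S ∧ p .W :=
    fun {p} => ⟨fun h => ⟨h _, h _, h _, h _⟩, fun ⟨a, b, c, d⟩ x => by cases x <;> assumption⟩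
  have sum : ∀ f : Dir → ℤ, ∑ x, f x = f .N + f .E + f .S + f .W := fun f => by
    rw [show (Finset.univ : Finset Dir) = {.N, .E, .S, .W} from rfl]
    simp [add_assoc]
  unfold crossingTurn
  simp only [all, sum]
  have h1 : (1 : ℤˣ) ≠ -1 := by decide
  rcases Int.units_eq_one_or a with rfl | rfl <;> rcases Int.units_eq_one_or b with rfl | rfl <;>
    rcases Int.units_eq_one_or c with rfl | rfl <;> rcases Int.units_eq_one_or d with rfl | rfl <;>
    simp only [Smoothing.partner, Dir.turn, Dir.opp, neg_neg, h1, h1.symm, and_true,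
      and_false, if_true, if_false, reduceCtorEq, add_zero, zero_add, and_self, one_mul,
      neg_mul, ← LaurentPolynomial.T_add, ← sub_eq_add_neg] <;> try norm_num

/-- The outward flow through the ends of a crossing. -/
def Crossing.out (p : D.Crossing) (o : D.Edge → ℤˣ) (d : Dir) : ℤˣ :=
  Half.out o (⟨(p.1, d), p.2.hasEnd d⟩ : D.Half)

/-- A flow which is preserved at every lattice point except the crossings. -/
def Preserved (o : D.Edge → ℤˣ) : Prop :=
  ∀ h h' : D.Half, ¬D.IsCrossing h.pt.1 h.pt.2 → h'.pt = h.pt → h' ≠ h → h'.out o = -h.out o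

instance (o : D.Edge → ℤˣ) : Decidable (Preserved o) := by unfold Preserved; infer_instance

/-- This separates the conditions independent of the resolution from those at the crossings, so that
the smoothings can be summed crossing by crossing. -/
theorem Resolution.consistent_iff (s : D.Resolution) (o : D.Edge → ℤˣ) :
    s.Consistent o ↔
      Preserved o ∧ ∀ p : D.Crossing, ∀ d, p.out o ((s p).partner d) = -p.out o d := by
  constructor
  · refine fun hc => ⟨fun h h' H hp hne => ?_, fun p d => ?_⟩
    · rw [(Half.eq_or_eq_partner s hp H).resolve_left hne, hc]
    · have := hc ⟨(p.1, d), p.2.hasEnd d⟩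
      unfold Crossing.out
      rw [← this]
      congr 1
      exact Half.ext rfl (Half.dir_partner_of_isCrossing s (h := ⟨(p.1, d), p.2.hasEnd d⟩) p.2).symm
  · rintro ⟨h1, h2⟩ h
    by_cases H : D.IsCrossing h.pt.1 h.pt.2
    · have := h2 ⟨h.pt, H⟩ h.dir
      unfold Crossing.out at this
      refine Eq.trans ?_ this
      congr 1
      exact Half.ext rfl (Half.dir_partner_of_isCrossing s H)
    · exact h1 h _ H rfl (h.partner_ne s)

variable (D) in
/-- The half-edge at the lower end of a vertical segment. -/
def halfLo (c : Fin n) : D.Half := ⟨((c, D.lo c), .N), ⟨le_rfl, D.lo_lt_hi c⟩⟩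

variable (D) in
/-- The half-edge at the upper end of a vertical segment. -/
def halfHi (c : Fin n) : D.Half := ⟨((c, D.hi c), .S), ⟨D.lo_lt_hi c, le_rfl⟩⟩

variable (D) in
/-- The shape of the lower end of a vertical segment. -/
def shapeLo (c : Fin n) : ℤ := if c = D.left (D.lo c) then 1 else -1

variable (D) in
/-- The shape of the upper end of a vertical segment. -/
def shapeHi (c : Fin n) : ℤ := if c = D.right (D.hi c) then 1 else -1

/-- The turning of a flow at the corners of the diagram. -/
def cornerTurn (o : D.Edge → ℤˣ) : ℤ :=
  ∑ c, (-((D.halfLo c).out o : ℤ) * D.shapeLo c - ((D.halfHi c).out o : ℤ) * D.shapeHi c)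

end GridDiagram

/-! ### The turning of a flow as a sum of local contributions, and the factorization of the state
sum. -/

namespace GridDiagram

variable {n : ℕ} {D : GridDiagram n}

namespace Half

/-- The turning along the arc that a flow enters through a half-edge. -/
def turnIn (s : D.Resolution) (o : D.Edge → ℤˣ) (h : D.Half) : ℤ :=
  if h.out o = -1 then Dir.turn h.dir.opp (h.partner s).dir else 0

end Half

/-- The half-edge at a lattice point in a given direction. -/
def mkHalf (p : Fin n × Fin n) (d : Dir) (H : D.HasEnd p.1 p.2 d) : D.Half := ⟨(p, d), H⟩

/-- Sums over the half-edges. -/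
theorem sum_half (f : D.Half → ℤ) : ∑ h, f h =
    ∑ p : Fin n × Fin n, ∑ d, if H : D.HasEnd p.1 p.2 d then f (mkHalf p d H) else 0 := by
  rw [← Finset.sum_product', Finset.univ_product_univ,
    ← Finset.sum_filter_add_sum_filter_not Finset.univ
      (fun x : (Fin n × Fin n) × Dir => D.HasEnd x.1.1 x.1.2 x.2), add_comm,
    Finset.sum_eq_zero (s := Finset.univ.filter fun x : (Fin n × Fin n) × Dir =>
      ¬D.HasEnd x.1.1 x.1.2 x.2), zero_add]
  · refine Finset.sum_bij (fun h _ => h.1) (fun h _ => by simpa using h.2)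
      (fun h _ h' _ e => Subtype.ext e) (fun x hx => ?_) (fun h _ => ?_)
    · exact ⟨⟨x, (Finset.mem_filter.1 hx).2⟩, Finset.mem_univ _, rfl⟩
    · rw [dif_pos h.2]; rfl
  · intro x hx
    rw [dif_neg (Finset.mem_filter.1 hx).2]

/-- Every edge has exactly one half-edge through which the flow enters a lattice point, so the sum
over edges becomes a sum over points. -/
theorem Resolution.turning_eq_sum_half (s : D.Resolution) (o : D.Edge → ℤˣ) :
    s.turning o = ∑ h : D.Half, h.turnIn s o := by
  have h1 : s.turning o = ∑ e, (head o e).turnIn s o := by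
    refine Finset.sum_congr rfl fun e _ => ?_
    rw [Half.turnIn, if_pos (out_head o e), ← other_tail, (tail o e).other_spec.2.1, Dir.opp_opp]
  rw [h1]
  rw [← Finset.sum_image (s := Finset.univ) (g := head o) (f := fun h => h.turnIn s o)
    fun e _ f _ h => by rw [← edge_head o e, h, edge_head]]
  refine Finset.sum_subset (Finset.subset_univ _) fun h _ hh => if_neg fun H => hh ?_
  exact Finset.mem_image.2 ⟨h.edge, Finset.mem_univ _, (eq_head o H).symm⟩

/-- The contribution of a lattice point to the turning of a flow. -/
def Resolution.turnAt (s : D.Resolution) (o : D.Edge → ℤˣ) (p : Fin n × Fin n) : ℤ :=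
  ∑ d, if H : D.HasEnd p.1 p.2 d then (mkHalf p d H).turnIn s o else 0

theorem Resolution.turnAt_crossing (s : D.Resolution) (o : D.Edge → ℤˣ) (p : D.Crossing) :
    s.turnAt o p.1 = crossingTurn (s p) (p.out o) := by
  unfold turnAt crossingTurn
  refine Finset.sum_congr rfl fun d _ => ?_
  rw [dif_pos (p.2.hasEnd d)]
  unfold Half.turnIn
  rw [Half.dir_partner_of_isCrossing s (h := mkHalf p.1 d (p.2.hasEnd d)) p.2]
  rfl

/-- The turning at a lattice point with exactly two ends. -/
theorem Resolution.turnAt_of_two_ends {s : D.Resolution} {o : D.Edge → ℤˣ} (hc : s.Consistent o)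
    {h : D.Half} {e : Dir} (hc' : ¬D.IsCrossing h.pt.1 h.pt.2) (he : e ≠ h.dir)
    (hx : D.HasEnd h.pt.1 h.pt.2 e) :
    s.turnAt o h.pt = -(h.out o : ℤ) * Dir.turn h.dir.opp e := by
  obtain ⟨e', he', hx'⟩ := exists_two_ends hc' h.2
  have hee : e = e' := ((hx' e).1 hx).resolve_left he
  subst hee
  have hp : mkHalf h.pt e hx = h.partner s :=
    (Half.eq_or_eq_partner s (h := h) (h' := mkHalf h.pt e hx) rfl hc').resolve_left
      fun H => he (congrArg Half.dir H)
  have hd : (h.partner s).dir = e := (congrArg Half.dir hp).symm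
  unfold turnAt
  rw [← Finset.sum_subset (Finset.subset_univ {h.dir, e}), Finset.sum_pair he.symm,
    dif_pos (show D.HasEnd h.pt.1 h.pt.2 h.dir from h.2), dif_pos hx, hp]
  · have e1 : mkHalf h.pt h.dir h.2 = h := rfl
    rw [e1]
    unfold Half.turnIn
    rw [hc, Half.partner_partner, hd]
    rcases Int.units_eq_one_or (h.out o) with H | H
    · rw [H, if_neg (by decide), if_pos rfl]
      generalize h.dir = d
      cases d <;> cases e <;> rfl
    · rw [H, if_pos rfl, if_neg (by decide)]
      simp
  · intro d _ hd'
    rw [dif_neg]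
    intro H
    have := (hx' d).1 H
    simp only [Finset.mem_insert, Finset.mem_singleton] at hd'
    exact hd' this

theorem hasEnd_lo (c : Fin n) :
    D.HasEnd c (D.lo c) (if c = D.left (D.lo c) then .E else .W) := by
  have h := (D.eq_lo_or_hi_iff c (D.lo c)).1 (Or.inl rfl)
  have h2 := D.left_lt_right (D.lo c)
  split_ifs with H
  · exact ⟨H.symm.le, H.trans_lt h2⟩
  · have H' := h.resolve_left H
    exact ⟨h2.trans_eq H'.symm, H'.le⟩

theorem hasEnd_hi (c : Fin n) :
    D.HasEnd c (D.hi c) (if c = D.right (D.hi c) then .W else .E) := by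
  have h := (D.eq_lo_or_hi_iff c (D.hi c)).1 (Or.inr rfl)
  have h2 := D.left_lt_right (D.hi c)
  split_ifs with H
  · exact ⟨h2.trans_eq H.symm, H.le⟩
  · have H' := h.resolve_right H
    exact ⟨H'.symm.le, H'.trans_lt h2⟩

/-- Besides the crossings only the corners count, and each corner is the lower or upper end of a
unique vertical segment; straight passages and points off the diagram give zero. -/
theorem Resolution.turnAt_eq {s : D.Resolution} {o : D.Edge → ℤˣ} (hc : s.Consistent o)
    (c r : Fin n) : s.turnAt o (c, r) =
      (if D.IsCrossing c r then s.turnAt o (c, r) else 0) +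
      (if D.lo c = r then -((D.halfLo c).out o : ℤ) * D.shapeLo c else 0) +
      (if D.hi c = r then -((D.halfHi c).out o : ℤ) * D.shapeHi c else 0) := by
  have hlh := D.lo_lt_hi c
  by_cases h1 : D.lo c = r
  · subst h1
    have h0 : ¬D.IsCrossing c (D.lo c) := fun h => lt_irrefl _ h.1
    rw [if_neg h0, if_pos rfl, if_neg hlh.ne', zero_add, add_zero]
    have := turnAt_of_two_ends hc (h := D.halfLo c) (e := if c = D.left (D.lo c) then .E else .W) h0
      (by split_ifs <;> simp [halfLo, Half.dir]) (hasEnd_lo c)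
    refine this.trans ?_
    unfold shapeLo
    split_ifs <;> rfl
  by_cases h2 : D.hi c = r
  · subst h2
    have h0 : ¬D.IsCrossing c (D.hi c) := fun h => lt_irrefl _ h.2.1
    rw [if_neg h0, if_pos rfl, if_neg hlh.ne, zero_add, zero_add]
    have := turnAt_of_two_ends hc (h := D.halfHi c)
      (e := if c = D.right (D.hi c) then .W else .E) h0
      (by split_ifs <;> simp [halfHi, Half.dir]) (hasEnd_hi c)
    refine this.trans ?_
    unfold shapeHi
    split_ifs <;> rfl
  rw [if_neg h1, if_neg h2, add_zero, add_zero]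
  split_ifs with h0
  · rfl
  have h3 := D.eq_lo_or_hi_iff c r
  by_cases hN : D.HasEnd c r .N
  · have hS : D.HasEnd c r .S := ⟨lt_of_le_of_ne hN.1 h1, hN.2.le⟩
    rw [show ((c, r) : Fin n × Fin n) = (mkHalf (c, r) .N hN).pt from rfl,
      turnAt_of_two_ends hc (h := mkHalf (c, r) .N hN) h0 (e := .S) (by simp [mkHalf, Half.dir]) hS]
    exact mul_zero _
  by_cases hE : D.HasEnd c r .E
  · have hW : D.HasEnd c r .W := ⟨lt_of_le_of_ne hE.1
      fun h => by exact (h3.2 (Or.inl h.symm)).elim (fun h => h1 h.symm) fun h => h2 h.symm, hE.2.le⟩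
    rw [show ((c, r) : Fin n × Fin n) = (mkHalf (c, r) .E hE).pt from rfl,
      turnAt_of_two_ends hc (h := mkHalf (c, r) .E hE) h0 (e := .W) (by simp [mkHalf, Half.dir]) hW]
    exact mul_zero _
  have hS : ¬D.HasEnd c r .S := fun h => hN ⟨h.1.le, lt_of_le_of_ne h.2 (Ne.symm h2)⟩
  have hW : ¬D.HasEnd c r .W := fun h => hE ⟨h.1.le, lt_of_le_of_ne h.2
    fun h => by exact (h3.2 (Or.inr h)).elim (fun h => h1 h.symm) fun h => h2 h.symm⟩
  unfold turnAt
  refine Finset.sum_eq_zero fun d _ => dif_neg ?_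
  cases d <;> assumption

theorem Resolution.Consistent.turning_eq_local {s : D.Resolution} {o : D.Edge → ℤˣ}
    (hc : s.Consistent o) :
    s.turning o = cornerTurn o + ∑ p : D.Crossing, crossingTurn (s p) (p.out o) := by
  rw [turning_eq_sum_half, sum_half]
  change ∑ p : Fin n × Fin n, s.turnAt o p = _
  have h1 : ∑ p : D.Crossing, crossingTurn (s p) (p.out o) =
      ∑ p : Fin n × Fin n, if D.IsCrossing p.1 p.2 then s.turnAt o p else 0 := by
    rw [← Finset.sum_filter]
    refine Finset.sum_bij (fun p _ => p.1) (fun p _ => by simpa using p.2)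
      (fun p _ q _ h => Subtype.ext h) (fun p hp => ?_) (fun p _ => (s.turnAt_crossing o p).symm)
    exact ⟨⟨p, (Finset.mem_filter.1 hp).2⟩, Finset.mem_univ _, rfl⟩
  rw [h1, Finset.sum_congr rfl fun (p : Fin n × Fin n) _ => turnAt_eq hc p.1 p.2,
    Finset.sum_add_distrib, Finset.sum_add_distrib, add_assoc, add_comm]
  congr 1
  unfold cornerTurn
  rw [Fintype.sum_prod_type, Fintype.sum_prod_type, ← Finset.sum_add_distrib]
  refine Finset.sum_congr rfl fun c _ => ?_
  simp [sub_eq_add_neg]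

/-- The contribution of a flow to the state sum. -/
noncomputable def flowWeight (o : D.Edge → ℤˣ) : ℤ[T;T⁻¹] :=
  LaurentPolynomial.T (cornerTurn o) * ∏ p : D.Crossing, crossingWeight (p.out o)

theorem prod_ite_B (s : D.Resolution) :
    ∏ p, (if s p = .B then -LaurentPolynomial.T 4 else 1 : ℤ[T;T⁻¹]) =
      (-LaurentPolynomial.T 4) ^ s.numB := by
  rw [Finset.prod_ite, Finset.prod_const, Finset.prod_const_one, mul_one]
  rfl

/-- Exchange the sums over resolutions and flows. For a fixed flow, weight and consistency are
products over the crossings, so the sum over resolutions is the product of the crossing weights. -/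
theorem sum_resolution :
    ∑ s : D.Resolution, (-LaurentPolynomial.T 4 : ℤ[T;T⁻¹]) ^ s.numB *
      (LaurentPolynomial.T 4 + LaurentPolynomial.T (-4)) ^ s.numCircles =
    ∑ o : D.Edge → ℤˣ with Preserved o, flowWeight o := by
  have h1 : ∀ s : D.Resolution, (-LaurentPolynomial.T 4 : ℤ[T;T⁻¹]) ^ s.numB *
      (LaurentPolynomial.T 4 + LaurentPolynomial.T (-4)) ^ s.numCircles =
      ∑ o : D.Edge → ℤˣ with Preserved o, LaurentPolynomial.T (cornerTurn o) *
        ∏ p : D.Crossing, (if ∀ d, p.out o ((s p).partner d) = -p.out o d then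
          (if s p = .B then -LaurentPolynomial.T 4 else 1) *
            LaurentPolynomial.T (crossingTurn (s p) (p.out o)) else 0) := by
    intro s
    rw [← s.sum_consistent, Finset.mul_sum, Finset.sum_filter, Finset.sum_filter]
    refine Finset.sum_congr rfl fun o _ => ?_
    by_cases h : s.Consistent o
    · obtain ⟨h2, h3⟩ := (s.consistent_iff o).1 h
      rw [if_pos h, if_pos h2, Finset.prod_congr rfl fun p _ => if_pos (h3 p),
        Finset.prod_mul_distrib, prod_ite_B, ← T_sum, h.turning_eq_local, LaurentPolynomial.T_add]
      ring
    · rw [if_neg h]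
      split_ifs with h2
      · have : ∃ p : D.Crossing, ¬∀ d, p.out o ((s p).partner d) = -p.out o d := by
          by_contra h3
          push Not at h3
          exact h ((s.consistent_iff o).2 ⟨h2, h3⟩)
        obtain ⟨p, hp⟩ := this
        rw [Finset.prod_eq_zero (Finset.mem_univ p) (if_neg hp), mul_zero]
      · rfl
  rw [Finset.sum_congr rfl fun s _ => h1 s, Finset.sum_comm]
  refine Finset.sum_congr rfl fun o _ => ?_
  rw [← Finset.mul_sum, flowWeight]
  unfold crossingWeight
  rw [Finset.prod_univ_sum (fun _ => Finset.univ) fun (p : D.Crossing) (x : Smoothing) =>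
    if ∀ d, p.out o (x.partner d) = -p.out o d then
      (if x = .B then -LaurentPolynomial.T 4 else 1) *
        LaurentPolynomial.T (crossingTurn x (p.out o)) else (0 : ℤ[T;T⁻¹]),
    Fintype.piFinset_univ]

variable (D)

theorem subst_jonesPolynomial : subst D.jonesPolynomial =
    LaurentPolynomial.C ((D.writhe.negOnePow : ℤˣ) : ℤ) *
      (subst (LaurentPolynomial.T (D.nPos - 2 * D.nNeg)) *
        ∑ o : D.Edge → ℤˣ with Preserved o, flowWeight o) := by
  unfold jonesPolynomial
  rw [map_mul, subst_C, map_sum, ← sum_resolution, Finset.mul_sum, Finset.mul_sum, Finset.mul_sum]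
  refine Finset.sum_congr rfl fun s _ => congrArg (fun x : ℤ[T;T⁻¹] => _ * x) ?_
  rw [map_mul, map_pow, map_sub, map_neg, subst_T_one, subst_T_neg_one, neg_neg, sub_neg_eq_add,
    add_sub_assoc, LaurentPolynomial.T_add, map_mul, ← mul_assoc, mul_comm (subst _) (subst _)]
  congr 2
  rw [← mul_one (s.numB : ℤ), ← LaurentPolynomial.T_pow, map_pow, subst_T_one]

end GridDiagram

namespace GridDiagram

variable {n : ℕ} {D : GridDiagram n}

/-! ### Flows of nonzero weight are permutations -/

/-- A flow which changes from downward to upward at height `σ c` on the column `c`, and from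
rightward to leftward at abscissa `τ r` on the row `r`. -/
def SwitchesAt (o : D.Edge → ℤˣ) (σ τ : Fin n → Fin n) : Prop :=
  (∀ c y H, o ⟨.vert c y, H⟩ = if σ c ≤ y then 1 else -1) ∧
    ∀ x r H, o ⟨.horiz x r, H⟩ = if τ r ≤ x then -1 else 1

/-- The outward flow at a lattice point, for a flow switching at `σ` and `τ`. -/
def switchOut (σ τ : Fin n → Fin n) (c r : Fin n) : Dir → ℤˣ
  | .N => if σ c ≤ r then 1 else -1
  | .S => if r ≤ σ c then 1 else -1
  | .E => if τ r ≤ c then -1 else 1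
  | .W => if c ≤ τ r then -1 else 1

theorem SwitchesAt.out_eq {o : D.Edge → ℤˣ} {σ τ : Fin n → Fin n} (ho : SwitchesAt o σ τ)
    (h : D.Half) : h.out o = switchOut σ τ h.pt.1 h.pt.2 h.dir := by
  obtain ⟨⟨⟨c, r⟩, d⟩, h⟩ := h
  cases d
  · simp only [Half.out, Half.edge, edgeAt, Half.dir, Half.pt, Dir.sgn, switchOut, one_mul]
    exact ho.1 _ _ _
  · simp only [Half.out, Half.edge, edgeAt, Half.dir, Half.pt, Dir.sgn, switchOut, one_mul]
    exact ho.2 _ _ _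
  · have h' : (D.lo c : ℕ) < r := h.1
    simp only [Half.out, Half.edge, edgeAt, Half.dir, Half.pt, Dir.sgn, switchOut]
    rw [ho.1]
    simp only [Fin.le_def]
    split_ifs <;> first | omega | simp
  · have h' : (D.left r : ℕ) < c := h.1
    simp only [Half.out, Half.edge, edgeAt, Half.dir, Half.pt, Dir.sgn, switchOut]
    rw [ho.2]
    simp only [Fin.le_def]
    split_ifs <;> first | omega | simp

variable (D) in
/-- A permutation, from columns to rows, whose points lie on the diagram. -/
def Admissible (σ : Equiv.Perm (Fin n)) : Prop :=
  ∀ c, (D.lo c ≤ σ c ∧ σ c ≤ D.hi c) ∧ D.left (σ c) ≤ c ∧ c ≤ D.right (σ c)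

instance (σ : Equiv.Perm (Fin n)) : Decidable (D.Admissible σ) := by
  unfold Admissible; infer_instance

variable (D) in
/-- The flow of an admissible permutation. -/
def flowOf (σ : Equiv.Perm (Fin n)) : D.Edge → ℤˣ
  | ⟨.vert c y, _⟩ => if σ c ≤ y then 1 else -1
  | ⟨.horiz x r, _⟩ => if σ.symm r ≤ x then -1 else 1

theorem switchesAt_flowOf (σ : Equiv.Perm (Fin n)) : SwitchesAt (D.flowOf σ) σ σ.symm :=
  ⟨fun _ _ _ => rfl, fun _ _ _ => rfl⟩

theorem Admissible.symm {σ : Equiv.Perm (Fin n)} (hσ : D.Admissible σ) (r : Fin n) :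
    (D.lo (σ.symm r) ≤ r ∧ r ≤ D.hi (σ.symm r)) ∧ D.left r ≤ σ.symm r ∧ σ.symm r ≤ D.right r := by
  simpa using hσ (σ.symm r)

/-- The ends at a lattice point, in terms of the segments. -/
theorem hasEnd_of_ne {c r : Fin n} {d e : Dir} (hd : D.HasEnd c r d) (he : D.HasEnd c r e)
    (hde : e ≠ d) (hc : ¬D.IsCrossing c r) : (e = d.opp) ∨
      (((d = .N ∨ e = .N) → r = D.lo c) ∧ ((d = .S ∨ e = .S) → r = D.hi c) ∧
        ((d = .E ∨ e = .E) → c = D.left r) ∧ ((d = .W ∨ e = .W) → c = D.right r)) := by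
  have h3 := D.eq_lo_or_hi_iff c r
  have h1 := D.lo_lt_hi c
  have h2 := D.left_lt_right r
  unfold IsCrossing at hc
  cases d <;> cases e <;> simp only [HasEnd, Dir.opp, Fin.ext_iff, Fin.lt_def, Fin.le_def,
    reduceCtorEq, or_false, false_or, or_true, true_or, forall_true_left, IsEmpty.forall_iff,
    true_and, and_true, ne_eq, not_true_eq_false] at * <;> omega

/-- At a corner the vertical end is outward exactly when the column switches there, and the
horizontal end inward exactly when the row does. At a straight point off the crossings no switch can
occur. -/
theorem switchOut_eq_neg {σ τ : Fin n → Fin n} {c r : Fin n} {d e : Dir}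
    (a1 : D.lo c ≤ σ c ∧ σ c ≤ D.hi c) (a2 : D.left r ≤ τ r ∧ τ r ≤ D.right r)
    (a3 : σ c = r ↔ τ r = c)
    (h4 : σ c = r → D.left r ≤ c ∧ c ≤ D.right r)
    (h5 : τ r = c → D.lo c ≤ r ∧ r ≤ D.hi c) (hc : ¬D.IsCrossing c r)
    (hd : D.HasEnd c r d) (he : D.HasEnd c r e) (hde : e ≠ d) :
    switchOut σ τ c r e = -switchOut σ τ c r d := by
  have key := hasEnd_of_ne hd he hde hc
  have h1 := D.lo_lt_hi c
  have h2 := D.left_lt_right r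
  have h3 := D.eq_lo_or_hi_iff c r
  unfold IsCrossing at hc
  have n1 : ∀ p q : Prop, ∀ [Decidable p] [Decidable q], (p ↔ ¬q) →
      (if p then (1 : ℤˣ) else -1) = -(if q then 1 else -1) := by
    intro p q _ _ hpq; by_cases q <;> simp_all
  have n2 : ∀ p q : Prop, ∀ [Decidable p] [Decidable q], (p ↔ ¬q) →
      (if p then (-1 : ℤˣ) else 1) = -(if q then -1 else 1) := by
    intro p q _ _ hpq; by_cases q <;> simp_all
  have n3 : ∀ p q : Prop, ∀ [Decidable p] [Decidable q], (p ↔ q) →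
      (if p then (1 : ℤˣ) else -1) = -(if q then -1 else 1) := by
    intro p q _ _ hpq; by_cases q <;> simp_all
  have n4 : ∀ p q : Prop, ∀ [Decidable p] [Decidable q], (p ↔ q) →
      (if p then (-1 : ℤˣ) else 1) = -(if q then 1 else -1) := by
    intro p q _ _ hpq; by_cases q <;> simp_all
  cases d <;> cases e <;> first | exact absurd rfl hde | skip
  all_goals
    simp only [switchOut]
    first | apply n1 | apply n2 | apply n3 | apply n4
    clear n1 n2 n3 n4
    simp only [HasEnd, Dir.opp, Fin.ext_iff, Fin.lt_def, Fin.le_def, reduceCtorEq, or_false,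
      false_or, or_true, true_or, forall_true_left, IsEmpty.forall_iff, true_and, and_true] at *
    omega

theorem Admissible.preserved {σ : Equiv.Perm (Fin n)} (hσ : D.Admissible σ) :
    Preserved (D.flowOf σ) := by
  intro h h' hc hp hne
  rw [(switchesAt_flowOf σ).out_eq, (switchesAt_flowOf σ).out_eq, hp]
  exact switchOut_eq_neg (hσ _).1 (hσ.symm _).2 (by rw [Equiv.symm_apply_eq, eq_comm])
    (fun e => e ▸ (hσ _).2) (fun e => by have := (hσ.symm h.pt.2).1; rwa [e] at this) hc h.2
    (hp ▸ h'.2) fun e => hne (Half.ext hp e)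

theorem crossingWeight_switchOut {σ τ : Fin n → Fin n} {c r : Fin n} (a3 : σ c = r ↔ τ r = c) :
    crossingWeight (switchOut σ τ c r) =
      if σ c = r then LaurentPolynomial.T (-2) - LaurentPolynomial.T 6
      else if (σ c < r ↔ c < τ r) then -LaurentPolynomial.T 4 else 1 := by
  rw [crossingWeight_eq]
  simp only [switchOut]
  rcases lt_trichotomy (σ c) r with h1 | h1 | h1
  · rcases lt_trichotomy (τ r) c with h2 | h2 | h2
    · simp [h1.le, h1.not_ge, h1.ne, h2.le, h2.not_ge, h1, h2.not_gt]
    · exact absurd (a3.2 h2) h1.ne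
    · simp [h1.le, h1.not_ge, h1.ne, h2.le, h2.not_ge, h1, h2]
  · have h2 := a3.1 h1
    simp [h1, h2]
  · rcases lt_trichotomy (τ r) c with h2 | h2 | h2
    · simp [h1.le, h1.not_ge, h1.ne', h2.le, h2.not_ge, h1.not_gt, h2.not_gt]
    · exact absurd (a3.2 h2) h1.ne'
    · simp [h1.le, h1.not_ge, h1.ne', h2.le, h2.not_ge, h1.not_gt, h2]

/-- The weight of a crossing for the flow of a permutation. -/
theorem crossingWeight_flowOf (σ : Equiv.Perm (Fin n)) (p : D.Crossing) :
    crossingWeight (p.out (D.flowOf σ)) =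
      if σ p.1.1 = p.1.2 then LaurentPolynomial.T (-2) - LaurentPolynomial.T 6
      else if (σ p.1.1 < p.1.2 ↔ p.1.1 < σ.symm p.1.2) then -LaurentPolynomial.T 4 else 1 := by
  have h : p.out (D.flowOf σ) = switchOut σ σ.symm p.1.1 p.1.2 :=
    funext fun d => (switchesAt_flowOf σ).out_eq _
  rw [h, crossingWeight_switchOut (by rw [Equiv.symm_apply_eq, eq_comm])]

/-- A sign which never returns from 1 to -1 is a threshold function; `k = b` covers the case without
any 1. -/
theorem exists_switch (f : ℕ → ℤˣ) {a b : ℕ} (hab : a ≤ b)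
    (hf : ∀ y, a ≤ y → y + 1 < b → f y = 1 → f (y + 1) = 1) :
    ∃ k, a ≤ k ∧ k ≤ b ∧ ∀ y, a ≤ y → y < b → f y = if k ≤ y then 1 else -1 := by
  induction b, hab using Nat.le_induction with
  | base => exact ⟨a, le_rfl, le_rfl, fun y h1 h2 => absurd h1 (by omega)⟩
  | succ b hb ih =>
    obtain ⟨k, h1, h2, h3⟩ := ih fun y h1 h2 => hf y h1 (by omega)
    rcases Int.units_eq_one_or (f b) with h | h
    · refine ⟨k, h1, by omega, fun y hy hy' => ?_⟩
      by_cases e : y = b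
      · subst e; rw [h, if_pos h2]
      · exact h3 y hy (by omega)
    · by_cases e : k = b
      · refine ⟨b + 1, by omega, le_rfl, fun y hy hy' => ?_⟩
        rw [if_neg (by omega)]
        by_cases e' : y = b
        · rw [e', h]
        · rw [h3 y hy (by omega), if_neg (by omega)]
      · exfalso
        have h4 := h3 (b - 1) (by omega) (by omega)
        rw [if_pos (by omega)] at h4
        have h5 := hf (b - 1) (by omega) (by omega) h4
        rw [Nat.sub_add_cancel (by omega), h] at h5
        exact absurd h5 (by decide)

/-- Flows of nonzero weight pass straight through a lattice point, or leave it vertically and enter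
it horizontally. -/
theorem straight_or_sink {o : D.Edge → ℤˣ} (hp : Preserved o)
    (hw : ∀ p : D.Crossing, crossingWeight (p.out o) ≠ 0) {c r : Fin n} {d : Dir}
    (h : D.HasEnd c r d) (h' : D.HasEnd c r d.opp) :
    (mkHalf (c, r) d.opp h').out o = -(mkHalf (c, r) d h).out o ∨
      D.IsCrossing c r ∧ ∀ e H, (mkHalf (c, r) e H).out o = if e = .N ∨ e = .S then 1 else -1 := by
  by_cases hc : D.IsCrossing c r
  · have h1 := hw ⟨(c, r), hc⟩
    rw [crossingWeight_eq] at h1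
    split_ifs at h1 with h2 h3 h4
    · left
      change Crossing.out ⟨(c, r), hc⟩ o d.opp = -Crossing.out ⟨(c, r), hc⟩ o d
      cases d <;> simp only [Dir.opp, h2, neg_neg]
    · left
      change Crossing.out ⟨(c, r), hc⟩ o d.opp = -Crossing.out ⟨(c, r), hc⟩ o d
      cases d <;> simp only [Dir.opp, h2, neg_neg]
    · refine Or.inr ⟨hc, fun e H => ?_⟩
      change Crossing.out ⟨(c, r), hc⟩ o e = _
      cases e <;> simp [h4]
    · exact absurd rfl h1
  · refine Or.inl (hp _ _ hc rfl fun e => ?_)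
    have := congrArg Half.dir e
    cases d <;> cases this

/-- Going up a column, the flow can change only at a crossing with both vertical ends outward, that
is, from downward to upward. -/
theorem exists_column_switch {o : D.Edge → ℤˣ} (hp : Preserved o)
    (hw : ∀ p : D.Crossing, crossingWeight (p.out o) ≠ 0) (c : Fin n) :
    ∃ k : Fin n, (D.lo c ≤ k ∧ k ≤ D.hi c) ∧
      ∀ y H, o ⟨.vert c y, H⟩ = if k ≤ y then 1 else -1 := by
  let f : ℕ → ℤˣ := fun y => if H : ∃ h : y < n, D.Covers (.vert c ⟨y, h⟩)
    then o ⟨.vert c ⟨y, H.1⟩, H.2⟩ else 1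
  obtain ⟨k, h1, h2, h3⟩ := exists_switch f (a := D.lo c) (b := D.hi c) (D.lo_lt_hi c).le (by
    intro y hy hy' h
    have H : ∃ h : y < n, D.Covers (.vert c ⟨y, h⟩) :=
      ⟨by omega, hy, Nat.lt_of_succ_lt hy'⟩
    have H' : ∃ h : y + 1 < n, D.Covers (.vert c ⟨y + 1, h⟩) :=
      ⟨by omega, hy.trans (Nat.le_succ y), hy'⟩
    simp only [f, dif_pos H] at h
    simp only [f, dif_pos H']
    have hS : D.HasEnd c ⟨y + 1, H'.1⟩ .S := ⟨Nat.lt_succ_of_le hy, hy'.le⟩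
    have hN : D.HasEnd c ⟨y + 1, H'.1⟩ .N := ⟨hy.trans (Nat.le_succ y), hy'⟩
    have eS : (mkHalf (c, ⟨y + 1, H'.1⟩) .S hS).out o = -1 := by
      rw [← h]; exact neg_one_mul _
    have eN : (mkHalf (c, ⟨y + 1, H'.1⟩) .N hN).out o = o ⟨.vert c ⟨y + 1, H'.1⟩, H'.2⟩ :=
      one_mul _
    rcases straight_or_sink hp hw hS hN with h4 | ⟨-, h4⟩
    · rw [← eN]; exact h4.trans (by rw [eS, neg_neg])
    · rw [← eN, h4]; rfl)
  refine ⟨⟨k, by omega⟩, ⟨h1, h2⟩, fun y H => ?_⟩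
  have := h3 y H.1 H.2
  simp only [f] at this
  rw [dif_pos ⟨y.2, H⟩] at this
  exact this

theorem exists_row_switch {o : D.Edge → ℤˣ} (hp : Preserved o)
    (hw : ∀ p : D.Crossing, crossingWeight (p.out o) ≠ 0) (r : Fin n) :
    ∃ k : Fin n, (D.left r ≤ k ∧ k ≤ D.right r) ∧
      ∀ x H, o ⟨.horiz x r, H⟩ = if k ≤ x then -1 else 1 := by
  let f : ℕ → ℤˣ := fun x => if H : ∃ h : x < n, D.Covers (.horiz ⟨x, h⟩ r)
    -- The sign is reversed because a row changes from rightward to leftward.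
    then -o ⟨.horiz ⟨x, H.1⟩ r, H.2⟩ else 1
  obtain ⟨k, h1, h2, h3⟩ := exists_switch f (a := D.left r) (b := D.right r) (D.left_lt_right r).le (by
    intro y hy hy' h
    have H : ∃ h : y < n, D.Covers (.horiz ⟨y, h⟩ r) :=
      ⟨by omega, hy, Nat.lt_of_succ_lt hy'⟩
    have H' : ∃ h : y + 1 < n, D.Covers (.horiz ⟨y + 1, h⟩ r) :=
      ⟨by omega, hy.trans (Nat.le_succ y), hy'⟩
    simp only [f, dif_pos H] at h
    simp only [f, dif_pos H']
    have hW : D.HasEnd ⟨y + 1, H'.1⟩ r .W := ⟨Nat.lt_succ_of_le hy, hy'.le⟩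
    have hE : D.HasEnd ⟨y + 1, H'.1⟩ r .E := ⟨hy.trans (Nat.le_succ y), hy'⟩
    have eW : (mkHalf (⟨y + 1, H'.1⟩, r) .W hW).out o = 1 := by
      rw [← h]; exact neg_one_mul _
    have eE : (mkHalf (⟨y + 1, H'.1⟩, r) .E hE).out o = o ⟨.horiz ⟨y + 1, H'.1⟩ r, H'.2⟩ :=
      one_mul _
    rcases straight_or_sink hp hw hW hE with h4 | ⟨-, h4⟩
    · rw [← eE]; exact neg_eq_iff_eq_neg.2 (h4.trans (by rw [eW]))
    · rw [← eE, h4]; rfl)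
  refine ⟨⟨k, by omega⟩, ⟨h1, h2⟩, fun y H => ?_⟩
  have := h3 y H.1 H.2
  simp only [f] at this
  rw [dif_pos ⟨y.2, H⟩, neg_eq_iff_eq_neg] at this
  rw [this]
  simp only [Fin.le_def]
  split_ifs <;> simp

/-- At the switch of a column all its vertical ends are outward. Hence the horizontal ends are
inward, and the switch of that row lies at the same point. So the column switches are injective and
form a permutation, inverse to the row switches. -/
theorem exists_flowOf {o : D.Edge → ℤˣ} (hp : Preserved o)
    (hw : ∀ p : D.Crossing, crossingWeight (p.out o) ≠ 0) :
    ∃ σ, D.Admissible σ ∧ D.flowOf σ = o := by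
  choose σ hσ hσ' using exists_column_switch hp hw
  choose τ hτ hτ' using exists_row_switch hp hw
  have hs : SwitchesAt o σ τ := ⟨hσ', fun x r H => hτ' r x H⟩
  have out : ∀ c r d H, (mkHalf (c, r) d H).out o = switchOut σ τ c r d :=
    fun c r d H => hs.out_eq (mkHalf (c, r) d H)
  have opp : ∀ c r d d' (h : D.HasEnd c r d) (h' : D.HasEnd c r d'), ¬D.IsCrossing c r → d' ≠ d →
      switchOut σ τ c r d' = -switchOut σ τ c r d := fun c r d d' h h' hc hd => by
    rw [← out c r d h, ← out c r d' h']
    exact hp _ _ hc rfl fun e => hd (congrArg Half.dir e)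
  -- If all horizontal ends at a point of row `r` are inward, the row switches there.
  have fin : ∀ c r, (D.HasEnd c r .E → switchOut σ τ c r .E = -1) →
      (D.HasEnd c r .W → switchOut σ τ c r .W = -1) → D.left r ≤ c → c ≤ D.right r → τ r = c := by
    intro c r h1 h2 h3 h4
    refine le_antisymm ?_ ?_
    · by_contra h
      have h5 : c < D.right r := (not_le.1 h).trans_le (hτ r).2
      have := h1 ⟨h3, h5⟩
      simp only [switchOut, if_neg h] at this
      exact absurd this (by decide)
    · by_contra h
      have h5 : D.left r < c := (hτ r).1.trans_lt (not_le.1 h)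
      have := h2 ⟨h5, h4⟩
      simp only [switchOut, if_neg h] at this
      exact absurd this (by decide)
  have key : ∀ c, τ (σ c) = c := by
    intro c
    have N : switchOut σ τ c (σ c) .N = 1 := if_pos le_rfl
    have S : switchOut σ τ c (σ c) .S = 1 := if_pos le_rfl
    have h3 := D.eq_lo_or_hi_iff c (σ c)
    have hlr := D.left_lt_right (σ c)
    by_cases hl : σ c = D.lo c
    · have h0 : ¬D.IsCrossing c (σ c) := fun h => hl.not_gt h.1
      have hN : D.HasEnd c (σ c) .N := ⟨hl.ge, hl.trans_lt (D.lo_lt_hi c)⟩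
      refine fin c _ (fun h => ?_) (fun h => ?_) ?_ ?_
      · rw [opp c _ .N .E hN h h0 (by decide), N]
      · rw [opp c _ .N .W hN h h0 (by decide), N]
      · rcases h3.1 (Or.inl hl) with h | h
        · exact h.ge
        · exact hlr.le.trans h.ge
      · rcases h3.1 (Or.inl hl) with h | h
        · exact h.le.trans hlr.le
        · exact h.le
    by_cases hh : σ c = D.hi c
    · have h0 : ¬D.IsCrossing c (σ c) := fun h => hh.not_lt h.2.1
      have hS : D.HasEnd c (σ c) .S := ⟨(D.lo_lt_hi c).trans_eq hh.symm, hh.le⟩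
      refine fin c _ (fun h => ?_) (fun h => ?_) ?_ ?_
      · rw [opp c _ .S .E hS h h0 (by decide), S]
      · rw [opp c _ .S .W hS h h0 (by decide), S]
      · rcases h3.1 (Or.inr hh) with h | h
        · exact h.ge
        · exact hlr.le.trans h.ge
      · rcases h3.1 (Or.inr hh) with h | h
        · exact h.le.trans hlr.le
        · exact h.le
    have hN : D.HasEnd c (σ c) .N := ⟨(hσ c).1, lt_of_le_of_ne (hσ c).2 hh⟩
    have hS : D.HasEnd c (σ c) .S := ⟨lt_of_le_of_ne (hσ c).1 (Ne.symm hl), (hσ c).2⟩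
    rcases straight_or_sink hp hw hN hS with h | ⟨hc, h⟩
    · replace h := (out _ _ _ hS).symm.trans (h.trans (congrArg Neg.neg (out _ _ _ hN)))
      rw [N, S] at h
      exact absurd h (by decide)
    · refine fin c _ (fun H => ?_) (fun H => ?_) hc.2.2.1.le hc.2.2.2.le
      · rw [← out _ _ _ H, h]; rfl
      · rw [← out _ _ _ H, h]; rfl
  have inj : Function.Injective σ := fun a b h => by rw [← key a, h, key]
  let π : Equiv.Perm (Fin n) := Equiv.ofBijective σ (Finite.injective_iff_bijective.1 inj)
  have hπ : ∀ c, π c = σ c := fun _ => rfl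
  have hπ' : ∀ r, π.symm r = τ r := fun r => by
    rw [Equiv.symm_apply_eq]
    obtain ⟨c, rfl⟩ := π.surjective r
    rw [hπ, hπ, key]
  refine ⟨π, fun c => ⟨hσ c, ?_⟩, funext fun e => ?_⟩
  · have := hτ (σ c)
    rwa [key] at this
  · obtain ⟨e, he⟩ := e
    cases e with
    | vert c y => rw [hs.1]; rfl
    | horiz x r => rw [hs.2, ← hπ']; rfl

/-- If two permutations differ in a column, the unit edge just above the lower point carries
opposite flows. -/
theorem flowOf_injOn : Set.InjOn D.flowOf {σ | D.Admissible σ} := by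
  have key : ∀ σ τ, D.Admissible σ → D.Admissible τ → D.flowOf σ = D.flowOf τ →
      ∀ c, ¬σ c < τ c := by
    intro σ τ hσ hτ h c hlt
    have := congrFun h ⟨.vert c (σ c), (hσ c).1.1, hlt.trans_le (hτ c).1.2⟩
    simp only [flowOf, le_refl, if_true, if_neg hlt.not_ge] at this
    exact absurd this (by decide)
  intro σ hσ τ hτ h
  exact Equiv.ext fun c => le_antisymm (not_lt.1 (key τ σ hτ hσ h.symm c))
    (not_lt.1 (key σ τ hσ hτ h c))

theorem sum_preserved : ∑ o : D.Edge → ℤˣ with Preserved o, flowWeight o =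
    ∑ σ : Equiv.Perm (Fin n) with D.Admissible σ, flowWeight (D.flowOf σ) := by
  rw [← Finset.sum_image (s := Finset.univ.filter fun σ => D.Admissible σ) (g := D.flowOf)
    (f := flowWeight) (fun σ hσ τ hτ h => flowOf_injOn (by simpa using hσ) (by simpa using hτ) h)]
  symm
  refine Finset.sum_subset (fun o ho => ?_) fun o ho ho' => ?_
  · obtain ⟨σ, hσ, rfl⟩ := Finset.mem_image.1 ho
    simpa using (Finset.mem_filter.1 hσ).2.preserved
  · have hp : Preserved o := (Finset.mem_filter.1 ho).2
    by_cases hw : ∀ p : D.Crossing, crossingWeight (p.out o) ≠ 0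
    · obtain ⟨σ, hσ, rfl⟩ := exists_flowOf hp hw
      exact absurd (Finset.mem_image.2 ⟨σ, by simpa using hσ, rfl⟩) ho'
    · push Not at hw
      obtain ⟨p, hp⟩ := hw
      rw [flowWeight, Finset.prod_eq_zero (Finset.mem_univ p) hp, mul_zero]

end GridDiagram

namespace GridDiagram

variable {n : ℕ} {D : GridDiagram n}

/-! ### Counting -/

/-- The indicator of a proposition. -/
abbrev ind (p : Prop) [Decidable p] : ℤ := if p then 1 else 0

theorem sum_ind_eq_and {ι : Type*} [Fintype ι] [DecidableEq ι] (i : ι) (p : ι → Prop)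
    [DecidablePred p] : ∑ j, ind (j = i ∧ p j) = ind (p i) := by
  rw [Finset.sum_eq_single i (fun j _ hj => if_neg fun h => hj h.1) (by simp)]
  simp [ind]

/-- The number of noninversions of a permutation. -/
def noninversions (σ : Equiv.Perm (Fin n)) : ℤ := ∑ c, ∑ c', ind (c < c' ∧ σ c < σ c')

variable (D) in
/-- The number of punctures to the left of and below a square. -/
def southWest (c r : Fin n) : ℤ :=
  ∑ c', (ind (c' < c ∧ D.lo c' < r) + ind (c' < c ∧ D.hi c' < r))

theorem southWest_eq_sum_rows (c r : Fin n) :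
    D.southWest c r = ∑ r', (ind (r' < r ∧ D.left r' < c) + ind (r' < r ∧ D.right r' < c)) := by
  have h1 : D.southWest c r =
      ∑ c', (ind (c' < c ∧ D.rowX c' < r) + ind (c' < c ∧ D.rowO c' < r)) := by
    refine Finset.sum_congr rfl fun c' _ => ?_
    unfold lo hi
    rcases le_total (D.rowX c') (D.rowO c') with h | h <;> simp [h, add_comm]
  have h2 : ∑ r', (ind (r' < r ∧ D.left r' < c) + ind (r' < r ∧ D.right r' < c)) =
      ∑ r', (ind (D.colX r' < c ∧ r' < r) + ind (D.colO r' < c ∧ r' < r)) := by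
    refine Finset.sum_congr rfl fun r' _ => ?_
    unfold left right
    rcases le_total (D.colX r') (D.colO r') with h | h <;> simp [h, and_comm, add_comm]
  rw [h1, h2, Finset.sum_add_distrib, Finset.sum_add_distrib,
    ← Equiv.sum_comp D.rowX fun r' => ind (D.colX r' < c ∧ r' < r),
    ← Equiv.sum_comp D.rowO fun r' => ind (D.colO r' < c ∧ r' < r)]
  simp [colX, colO]

variable (D) in
/-- The number of vertical segments to the upper left or the lower right of a square, together with
the number of such horizontal segments. -/
def outer (c r : Fin n) : ℤ :=
  ∑ c', (ind (D.hi c' ≤ r ∧ c' < c) + ind (r ≤ D.lo c' ∧ c < c')) +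
    ∑ r', (ind (r < r' ∧ c ≤ D.left r') + ind (r' < r ∧ D.right r' ≤ c))

/-- Compared column by column: up to corner corrections, the segments counted are the punctures to
the lower left plus a part depending on the row alone and a part depending on the column alone. -/
theorem outer_columns {c r : Fin n} (h1 : D.left r ≤ c) (h2 : c ≤ D.right r)
    (h3 : D.lo c ≤ r) :
    ∑ c', (ind (D.hi c' ≤ r ∧ c' < c) + ind (r ≤ D.lo c' ∧ c < c')) +
      ind (r = D.hi c ∧ D.left r = c) =
    D.southWest c r - ind (r = D.lo c) +
      ∑ c', (ind (r ≤ D.lo c') + ind (D.hi c' = r ∧ c' = D.left r)) - ∑ c', ind (c' < c) := by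
  have e1 : ind (r = D.hi c ∧ D.left r = c) = ∑ c', ind (c' = c ∧ (r = D.hi c' ∧ D.left r = c')) :=
    (sum_ind_eq_and c fun c' => r = D.hi c' ∧ D.left r = c').symm
  have e2 : ind (r = D.lo c) = ∑ c', ind (c' = c ∧ r = D.lo c') :=
    (sum_ind_eq_and c fun c' => r = D.lo c').symm
  rw [e1, e2]
  unfold southWest
  rw [← Finset.sum_add_distrib, ← Finset.sum_sub_distrib, ← Finset.sum_add_distrib,
    ← Finset.sum_sub_distrib]
  refine Finset.sum_congr rfl fun c' _ => ?_
  have h4 := D.eq_lo_or_hi_iff c' r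
  have h5 := D.lo_lt_hi c'
  have h6 := D.left_lt_right r
  have h7 : c' = c → D.lo c' = D.lo c := fun h => by rw [h]
  clear e1 e2
  simp only [Fin.ext_iff, Fin.lt_def, Fin.le_def, ind] at *
  rcases lt_trichotomy (c' : ℕ) c with h | h | h
  · rcases lt_trichotomy (D.hi c' : ℕ) r with h8 | h8 | h8
    · simp only [h, h.ne, h.not_gt, h8, h8.le, h8.ne,
        true_and, and_true, false_and, and_false, if_true, if_false]
      split_ifs <;> omega
    · simp only [h, h.ne, h.not_gt, h8,
        true_and, and_true, false_and, and_false, if_true, if_false]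
      split_ifs <;> omega
    · simp only [h, h.ne, h.not_gt, h8.not_ge, h8.not_gt, h8.ne',
        true_and, and_true, false_and, and_false, if_true, if_false]
      split_ifs <;> omega
  · obtain rfl := Fin.ext h
    simp only [lt_irrefl,
        true_and, false_and, and_false, if_false]
    split_ifs <;> omega
  · simp only [h, h.ne', h.not_gt,
        and_true, false_and, and_false, if_false]
    split_ifs <;> omega

theorem outer_rows {c r : Fin n} (h1 : D.lo c ≤ r) (h2 : r ≤ D.hi c) (h3 : D.left r ≤ c) :
    ∑ r', (ind (r < r' ∧ c ≤ D.left r') + ind (r' < r ∧ D.right r' ≤ c)) +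
      ind (r = D.lo c ∧ D.right r = c) =
    D.southWest c r - ind (D.left r = c) +
      ∑ r', (ind (c ≤ D.left r') + ind (D.right r' = c ∧ r' = D.lo c)) - ∑ r', ind (r' < r) := by
  have e1 : ind (r = D.lo c ∧ D.right r = c) =
      ∑ r', ind (r' = r ∧ (r' = D.lo c ∧ D.right r' = c)) :=
    (sum_ind_eq_and r fun r' => r' = D.lo c ∧ D.right r' = c).symm
  have e2 : ind (D.left r = c) = ∑ r', ind (r' = r ∧ D.left r' = c) :=
    (sum_ind_eq_and r fun r' => D.left r' = c).symm
  rw [e1, e2, southWest_eq_sum_rows, ← Finset.sum_add_distrib, ← Finset.sum_sub_distrib,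
    ← Finset.sum_add_distrib, ← Finset.sum_sub_distrib]
  refine Finset.sum_congr rfl fun r' _ => ?_
  have h4 := D.eq_lo_or_hi_iff c r'
  have h5 := D.lo_lt_hi c
  have h6 := D.left_lt_right r'
  have h7 : r' = r → D.left r' = D.left r := fun h => by rw [h]
  clear e1 e2
  simp only [Fin.ext_iff, Fin.lt_def, Fin.le_def, ind] at *
  rcases lt_trichotomy (r' : ℕ) r with h | h | h
  · rcases lt_trichotomy (D.right r' : ℕ) c with h8 | h8 | h8
    · simp only [h, h.ne, h.not_gt, h8, h8.le, h8.ne,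
        true_and, and_true, false_and, and_false, if_true, if_false]
      split_ifs <;> omega
    · simp only [h, h.ne, h.not_gt, h8,
        true_and, and_true, false_and, if_true, if_false]
      split_ifs <;> omega
    · simp only [h, h.ne, h.not_gt, h8.not_ge, h8.not_gt, h8.ne',
        true_and, false_and, and_false, if_true, if_false]
      split_ifs <;> omega
  · obtain rfl := Fin.ext h
    simp only [lt_irrefl,
        true_and, false_and, if_false]
    split_ifs <;> omega
  · simp only [h, h.ne', h.not_gt,
        true_and, false_and, if_false]
    split_ifs <;> omega

/-- The functions `a` and `b` need not be known: summed over the points of a permutation, they give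
a constant. -/
theorem outer_eq (D : GridDiagram n) : ∃ a b : Fin n → ℤ, ∀ c r, D.lo c ≤ r → r ≤ D.hi c →
    D.left r ≤ c → c ≤ D.right r →
    D.outer c r + ind (r = D.hi c ∧ D.left r = c) + ind (r = D.lo c ∧ D.right r = c) =
      2 * D.southWest c r - ind (r = D.lo c) - ind (D.left r = c) + a c + b r := by
  refine ⟨fun c => ∑ r', (ind (c ≤ D.left r') + ind (D.right r' = c ∧ r' = D.lo c)) -
      ∑ c', ind (c' < c), fun r => ∑ c', (ind (r ≤ D.lo c') + ind (D.hi c' = r ∧ c' = D.left r)) -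
      ∑ r', ind (r' < r), fun c r h1 h2 h3 h4 => ?_⟩
  have e1 := outer_columns h3 h4 h1
  have e2 := outer_rows h1 h2 h3
  unfold outer
  linarith

/-- Inclusion-exclusion. Given `s < r` and `c < i`, a crossing can fail only because `hi c ≤ r` or
`c ≤ left r`. These inequalities imply the first two except at a corner lying on the permutation,
which the last term removes. -/
theorem ind_crossing_left {c r s i : Fin n} (h1 : D.lo c ≤ s) (h2 : s ≤ D.hi c)
    (h3 : D.left r ≤ i) (h4 : i ≤ D.right r) (h : s = r ↔ i = c) :
    ind (D.IsCrossing c r ∧ s < r ∧ c < i) = ind (s < r ∧ c < i) - ind (D.hi c ≤ r ∧ c < i) -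
      ind (s < r ∧ c ≤ D.left r) + ind (D.hi c ≤ r ∧ c ≤ D.left r) -
      ind (r = s ∧ (s = D.hi c ∧ D.left s = c)) := by
  have h7 : r = s → D.left s = D.left r := fun h => by rw [h]
  simp only [IsCrossing, Fin.ext_iff, Fin.lt_def, Fin.le_def, ind] at *
  by_cases h5 : (s : ℕ) < r <;> by_cases h6 : (c : ℕ) < i <;> simp only [h5, h6,
      true_and, and_true, false_and, and_false, if_true, if_false] <;>
    split_ifs <;> omega

theorem ind_crossing_right {c r s i : Fin n} (h1 : D.lo c ≤ s) (h2 : s ≤ D.hi c)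
    (h3 : D.left r ≤ i) (h4 : i ≤ D.right r) (h : s = r ↔ i = c) :
    ind (D.IsCrossing c r ∧ r < s ∧ i < c) = ind (r < s ∧ i < c) - ind (r ≤ D.lo c ∧ i < c) -
      ind (r < s ∧ D.right r ≤ c) + ind (r ≤ D.lo c ∧ D.right r ≤ c) -
      ind (r = s ∧ (s = D.lo c ∧ D.right s = c)) := by
  have h7 : r = s → D.right s = D.right r := fun h => by rw [h]
  simp only [IsCrossing, Fin.ext_iff, Fin.lt_def, Fin.le_def, ind] at *
  by_cases h5 : (r : ℕ) < s <;> by_cases h6 : (i : ℕ) < c <;> simp only [h5, h6,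
      true_and, and_true, false_and, and_false, if_true, if_false] <;>
    split_ifs <;> omega

variable (D) in
/-- The number of crossings which the flow of a permutation passes up and to the right, or down and
to the left. -/
def negativeStraight (σ : Equiv.Perm (Fin n)) : ℕ :=
  (Finset.univ.filter fun p : D.Crossing =>
    σ p.1.1 ≠ p.1.2 ∧ (σ p.1.1 < p.1.2 ↔ p.1.1 < σ.symm p.1.2)).card

theorem negativeStraight_eq_sum (σ : Equiv.Perm (Fin n)) : (D.negativeStraight σ : ℤ) =
    ∑ c, ∑ r, (ind (D.IsCrossing c r ∧ σ c < r ∧ c < σ.symm r) +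
      ind (D.IsCrossing c r ∧ r < σ c ∧ σ.symm r < c)) := by
  have h1 : D.negativeStraight σ = (Finset.univ.filter fun p : Fin n × Fin n =>
      D.IsCrossing p.1 p.2 ∧ σ p.1 ≠ p.2 ∧ (σ p.1 < p.2 ↔ p.1 < σ.symm p.2)).card := by
    refine Finset.card_bij (fun p _ => p.1) (fun p hp => ?_) (fun p _ q _ h => Subtype.ext h)
      fun p hp => ?_
    · simpa using ⟨p.2, (Finset.mem_filter.1 hp).2⟩
    · have hp := (Finset.mem_filter.1 hp).2
      exact ⟨⟨p, hp.1⟩, Finset.mem_filter.2 ⟨Finset.mem_univ _, hp.2⟩, rfl⟩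
  rw [h1, Finset.card_filter, Nat.cast_sum, Fintype.sum_prod_type]
  refine Finset.sum_congr rfl fun c _ => Finset.sum_congr rfl fun r _ => ?_
  have h : σ c = r ↔ σ.symm r = c := by rw [Equiv.symm_apply_eq, eq_comm]
  push_cast
  by_cases hc : D.IsCrossing c r
  · simp only [hc, true_and, ne_eq, ind, Fin.ext_iff, Fin.lt_def] at *
    split_ifs <;> omega
  · simp [hc]

theorem negativeStraight_eq {σ : Equiv.Perm (Fin n)} (hσ : D.Admissible σ) :
    (D.negativeStraight σ : ℤ) = 2 * noninversions σ -
      ∑ c, (D.outer c (σ c) + ind (σ c = D.hi c ∧ D.left (σ c) = c) +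
        ind (σ c = D.lo c ∧ D.right (σ c) = c)) +
      ∑ c, ∑ r, (ind (D.hi c ≤ r ∧ c ≤ D.left r) + ind (r ≤ D.lo c ∧ D.right r ≤ c)) := by
  have h : ∀ c r, σ c = r ↔ σ.symm r = c := fun c r => by rw [Equiv.symm_apply_eq, eq_comm]
  -- Rows are indexed by the columns of their points, so that the main terms become counts of
  -- noninversions.
  have sw : ∀ f : Fin n → Fin n → ℤ, ∑ c, ∑ r, f c r = ∑ c', ∑ c, f c (σ c') := fun f => by
    rw [Finset.sum_comm, ← Equiv.sum_comp σ]
  have t1 : ∑ c, ∑ r, ind (σ c < r ∧ c < σ.symm r) = noninversions σ := by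
    rw [sw, Finset.sum_comm]
    simp [noninversions, and_comm]
  have t2 : ∑ c, ∑ r, ind (r < σ c ∧ σ.symm r < c) = noninversions σ := by
    rw [sw]
    simp [noninversions, and_comm]
  have t3 : ∑ c, ∑ r, ind (D.hi c ≤ r ∧ c < σ.symm r) =
      ∑ c, ∑ c', ind (D.hi c' ≤ σ c ∧ c' < c) := by
    rw [sw]; simp
  have t4 : ∑ c, ∑ r, ind (r ≤ D.lo c ∧ σ.symm r < c) =
      ∑ c, ∑ c', ind (σ c ≤ D.lo c' ∧ c < c') := by
    rw [sw]; simp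
  have t5 : ∀ c, ∑ r, ind (r = σ c ∧ (σ c = D.hi c ∧ D.left (σ c) = c)) =
      ind (σ c = D.hi c ∧ D.left (σ c) = c) := fun c => sum_ind_eq_and (σ c) fun _ => _
  have t6 : ∀ c, ∑ r, ind (r = σ c ∧ (σ c = D.lo c ∧ D.right (σ c) = c)) =
      ind (σ c = D.lo c ∧ D.right (σ c) = c) := fun c => sum_ind_eq_and (σ c) fun _ => _
  rw [negativeStraight_eq_sum]
  simp only [ind_crossing_left (hσ _).1.1 (hσ _).1.2 (hσ.symm _).2.1 (hσ.symm _).2.2 (h _ _),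
    ind_crossing_right (hσ _).1.1 (hσ _).1.2 (hσ.symm _).2.1 (hσ.symm _).2.2 (h _ _), outer,
    Finset.sum_add_distrib, Finset.sum_sub_distrib, t1, t2, t3, t4, t5, t6]
  ring

/-- The exponent of the weight of a permutation, up to a constant. -/
theorem exists_negativeStraight_eq (D : GridDiagram n) : ∃ K : ℤ, ∀ σ, D.Admissible σ →
    (D.negativeStraight σ : ℤ) = K + 2 * noninversions σ +
      ∑ c, (ind (σ c = D.lo c) + ind (D.left (σ c) = c) - 2 * D.southWest c (σ c)) := by
  obtain ⟨a, b, h⟩ := D.outer_eq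
  refine ⟨∑ c, ∑ r, (ind (D.hi c ≤ r ∧ c ≤ D.left r) + ind (r ≤ D.lo c ∧ D.right r ≤ c)) -
    ∑ c, a c - ∑ r, b r, fun σ hσ => ?_⟩
  rw [negativeStraight_eq hσ, Finset.sum_congr rfl fun c _ =>
    h c (σ c) (hσ c).1.1 (hσ c).1.2 (hσ c).2.1 (hσ c).2.2, ← Equiv.sum_comp σ b]
  simp only [Finset.sum_add_distrib, Finset.sum_sub_distrib]
  ring

end GridDiagram

/-! ### The weight of a flow as a product of local weights of a permutation. -/

namespace GridDiagram

variable {n : ℕ} {D : GridDiagram n}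

variable (D) in
/-- The weight of an intersection point of a vertical and a horizontal segment. -/
noncomputable def localWeight (c r : Fin n) : ℤ[T;T⁻¹] :=
  subst (LaurentPolynomial.T (-2 * D.southWest c r)) *
    if D.IsCrossing c r then 1 - LaurentPolynomial.T (-8)
    else if r = D.lo c then (if c = D.left r then -1 else 1)
    else if c = D.left r then 1 else -LaurentPolynomial.T (-8)

variable (D) in
/-- The weight of a permutation. -/
noncomputable def permWeight (σ : Equiv.Perm (Fin n)) : ℤ[T;T⁻¹] :=
  subst (LaurentPolynomial.T (2 * noninversions σ)) * ∏ c, D.localWeight c (σ c)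

variable (D) in
/-- The part of the turning at the corners of a column which depends on the row of the
permutation. -/
def turnDefect (c r : Fin n) : ℤ :=
  -2 * ind (r = D.lo c) * D.shapeLo c - 2 * ind (r = D.hi c) * D.shapeHi c

/-- Ends of columns flow inward except at a point of the permutation; there the sign of the corner
is reversed, which doubles its defect. -/
theorem cornerTurn_flowOf {σ : Equiv.Perm (Fin n)} (hσ : D.Admissible σ) :
    cornerTurn (D.flowOf σ) =
      ∑ c, (D.shapeLo c + D.shapeHi c) + ∑ c, D.turnDefect c (σ c) := by
  unfold cornerTurn
  rw [← Finset.sum_add_distrib]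
  refine Finset.sum_congr rfl fun c _ => ?_
  rw [(switchesAt_flowOf σ).out_eq, (switchesAt_flowOf σ).out_eq]
  have h1 : switchOut σ σ.symm (D.halfLo c).pt.1 (D.halfLo c).pt.2 (D.halfLo c).dir =
      if σ c ≤ D.lo c then 1 else -1 := rfl
  have h2 : switchOut σ σ.symm (D.halfHi c).pt.1 (D.halfHi c).pt.2 (D.halfHi c).dir =
      if D.hi c ≤ σ c then 1 else -1 := rfl
  have h3 : σ c ≤ D.lo c ↔ σ c = D.lo c := ⟨fun h => h.antisymm (hσ c).1.1, fun h => h.le⟩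
  have h4 : D.hi c ≤ σ c ↔ σ c = D.hi c := ⟨fun h => (hσ c).1.2.antisymm h, fun h => h.ge⟩
  rw [h1, h2]
  simp only [h3, h4, turnDefect, ind]
  split_ifs <;> push_cast <;> ring

theorem prod_crossingWeight (σ : Equiv.Perm (Fin n)) :
    ∏ p : D.Crossing, crossingWeight (p.out (D.flowOf σ)) =
      (-LaurentPolynomial.T 4) ^ D.negativeStraight σ *
        ∏ c, if D.IsCrossing c (σ c) then LaurentPolynomial.T (-2) - LaurentPolynomial.T 6
          else 1 := by
  have h1 : ∀ p : D.Crossing, crossingWeight (p.out (D.flowOf σ)) =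
      (if σ p.1.1 ≠ p.1.2 ∧ (σ p.1.1 < p.1.2 ↔ p.1.1 < σ.symm p.1.2) then
        -LaurentPolynomial.T 4 else 1) *
      (if σ p.1.1 = p.1.2 then LaurentPolynomial.T (-2) - LaurentPolynomial.T 6 else 1) := by
    intro p
    rw [crossingWeight_flowOf]
    by_cases h : σ p.1.1 = p.1.2
    · simp only [h, if_true, ne_eq, not_true_eq_false, false_and, if_false, one_mul]
    · simp only [h, if_false, ne_eq, not_false_eq_true, true_and, mul_one]
  rw [Finset.prod_congr rfl fun p _ => h1 p, Finset.prod_mul_distrib]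
  congr 1
  · rw [Finset.prod_ite, Finset.prod_const, Finset.prod_const_one, mul_one]
    rfl
  · rw [Finset.prod_ite, Finset.prod_const_one, mul_one, Finset.prod_ite, Finset.prod_const_one,
      mul_one, Finset.prod_const, Finset.prod_const]
    congr 1
    refine Finset.card_bij (fun p _ => p.1.1) (fun p hp => ?_) (fun p hp q hq h => ?_)
      fun c hc => ?_
    · have h := (Finset.mem_filter.1 hp).2
      refine Finset.mem_filter.2 ⟨Finset.mem_univ _, ?_⟩
      rw [h]; exact p.2
    · have h1 := (Finset.mem_filter.1 hp).2
      have h2 := (Finset.mem_filter.1 hq).2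
      exact Subtype.ext (Prod.ext h (by rw [← h1, ← h2, h]))
    · exact ⟨⟨(c, σ c), (Finset.mem_filter.1 hc).2⟩,
        Finset.mem_filter.2 ⟨Finset.mem_univ _, rfl⟩, rfl⟩

/-- The factor -T^6 is chosen so that T^(-2) - T^6 = -T^6 (1 - T^(-8)); what remains in each of the
four kinds of corners is then the weight of the single available side of the figure-eight. -/
theorem localWeight_eq {c r : Fin n} (h1 : D.lo c ≤ r ∧ r ≤ D.hi c)
    (h2 : D.left r ≤ c ∧ c ≤ D.right r) :
    LaurentPolynomial.T (D.turnDefect c r) *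
      subst (LaurentPolynomial.T (ind (r = D.lo c) + ind (D.left r = c) - 2 * D.southWest c r)) *
      (if D.IsCrossing c r then LaurentPolynomial.T (-2) - LaurentPolynomial.T 6 else 1) =
    -LaurentPolynomial.T 6 * D.localWeight c r := by
  have hlh := D.lo_lt_hi c
  have hlr := D.left_lt_right r
  have h3 := D.eq_lo_or_hi_iff c r
  rw [sub_eq_add_neg, LaurentPolynomial.T_add, map_mul, localWeight, neg_mul 2]
  generalize subst (LaurentPolynomial.T (-(2 * D.southWest c r))) = G
  have key : LaurentPolynomial.T (D.turnDefect c r) *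
      subst (LaurentPolynomial.T (ind (r = D.lo c) + ind (D.left r = c))) *
      (if D.IsCrossing c r then LaurentPolynomial.T (-2) - LaurentPolynomial.T 6 else 1) =
      -LaurentPolynomial.T 6 * (if D.IsCrossing c r then 1 - LaurentPolynomial.T (-8)
        else if r = D.lo c then (if c = D.left r then -1 else 1)
        else if c = D.left r then 1 else -LaurentPolynomial.T (-8)) := by
    have t0 : ∀ {p : Prop} [Decidable p], ¬p → ind p = 0 := fun h => if_neg h
    have t1 : ∀ {p : Prop} [Decidable p], p → ind p = 1 := fun h => if_pos h
    have u1 : subst (LaurentPolynomial.T 2) = LaurentPolynomial.T 8 := by simp [subst_T]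
    have tt : ∀ a b k : ℤ, k = a + b → (LaurentPolynomial.T k : ℤ[T;T⁻¹]) =
        LaurentPolynomial.T a * LaurentPolynomial.T b := fun a b k h => by
      rw [h, LaurentPolynomial.T_add]
    by_cases hc : D.IsCrossing c r
    · have e1 : r ≠ D.lo c := hc.1.ne'
      have e2 : r ≠ D.hi c := hc.2.1.ne
      have e3 : D.left r ≠ c := hc.2.2.1.ne
      rw [if_pos hc, if_pos hc, turnDefect, t0 e1, t0 e2, t0 e3]
      norm_num
      rw [tt 6 (-8) (-2) (by norm_num)]
      ring
    · rw [if_neg hc, if_neg hc, mul_one]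
      by_cases e1 : r = D.lo c
      · have e2 : r ≠ D.hi c := fun h => hlh.ne (e1 ▸ h)
        rw [if_pos e1, turnDefect, t1 e1, t0 e2]
        rcases h3.1 (Or.inl e1) with e3 | e3
        · have e4 : D.shapeLo c = 1 := if_pos (e1 ▸ e3)
          rw [if_pos e3, t1 e3.symm, e4]
          rw [show (-2 * 1 * 1 - 2 * 0 * D.shapeHi c : ℤ) = -2 by ring, one_add_one_eq_two, u1,
            tt 8 (-2) 6 (by norm_num)]
          ring
        · have e5 : c ≠ D.left r := e3 ▸ hlr.ne'
          have e4 : D.shapeLo c = -1 := if_neg (e1 ▸ e5)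
          rw [if_neg e5, t0 e5.symm, e4]
          rw [show (-2 * 1 * -1 - 2 * 0 * D.shapeHi c : ℤ) = 2 by ring, add_zero, subst_T_one,
            tt 4 2 6 (by norm_num)]
          ring
      · have e2 : r = D.hi c := by
          by_contra e2
          have e3 : ¬(c = D.left r ∨ c = D.right r) := fun h => (h3.2 h).elim e1 e2
          push Not at e3
          exact hc ⟨lt_of_le_of_ne h1.1 (Ne.symm e1), lt_of_le_of_ne h1.2 e2,
            lt_of_le_of_ne h2.1 e3.1.symm, lt_of_le_of_ne h2.2 e3.2⟩
        rw [if_neg e1, turnDefect, t0 e1, t1 e2]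
        rcases h3.1 (Or.inr e2) with e3 | e3
        · have e5 : c ≠ D.right r := e3 ▸ hlr.ne
          have e4 : D.shapeHi c = -1 := if_neg (e2 ▸ e5)
          rw [if_pos e3, t1 e3.symm, e4]
          rw [show (-2 * 0 * D.shapeLo c - 2 * 1 * -1 : ℤ) = 2 by ring, zero_add, subst_T_one,
            tt 4 2 6 (by norm_num)]
          ring
        · have e5 : c ≠ D.left r := e3 ▸ hlr.ne'
          have e4 : D.shapeHi c = 1 := if_pos (e2 ▸ e3)
          rw [if_neg e5, t0 e5.symm, e4]
          rw [show (-2 * 0 * D.shapeLo c - 2 * 1 * 1 : ℤ) = -2 by ring, add_zero, LaurentPolynomial.T_zero,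
            map_one, tt 6 (-8) (-2) (by norm_num)]
          ring
  linear_combination G * key

/-- The weight of the flow of a permutation, up to a factor. -/
theorem exists_flowWeight_eq (D : GridDiagram n) : ∃ A : ℤ[T;T⁻¹], ∀ σ, D.Admissible σ →
    flowWeight (D.flowOf σ) = A * D.permWeight σ := by
  obtain ⟨K, hK⟩ := D.exists_negativeStraight_eq
  -- The factors independent of the permutation: the fixed part of the corner turning, the constant
  -- of the crossing count, and -T^6 for each column.
  refine ⟨LaurentPolynomial.T (∑ c, (D.shapeLo c + D.shapeHi c)) * subst (LaurentPolynomial.T K) *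
    (-LaurentPolynomial.T 6) ^ n, fun σ hσ => ?_⟩
  have h1 : (-LaurentPolynomial.T 4 : ℤ[T;T⁻¹]) ^ D.negativeStraight σ =
      subst (LaurentPolynomial.T (D.negativeStraight σ)) := by
    rw [← subst_T_one, ← map_pow, LaurentPolynomial.T_pow, mul_one]
  have h2 : ∏ c, (-LaurentPolynomial.T 6 * D.localWeight c (σ c)) =
      (-LaurentPolynomial.T 6) ^ n * ∏ c, D.localWeight c (σ c) := by
    rw [Finset.prod_mul_distrib, Finset.prod_const, Finset.card_univ, Fintype.card_fin]
  rw [flowWeight, prod_crossingWeight, h1, hK σ hσ, cornerTurn_flowOf hσ, LaurentPolynomial.T_add,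
    LaurentPolynomial.T_add, LaurentPolynomial.T_add, T_sum _ fun c => D.turnDefect c (σ c),
    T_sum _ fun c => ind (σ c = D.lo c) + ind (D.left (σ c) = c) - 2 * D.southWest c (σ c),
    map_mul, map_mul, map_prod, permWeight]
  have h3 := Finset.prod_congr rfl fun (c : Fin n) (_ : c ∈ Finset.univ) =>
    localWeight_eq (hσ c).1 (hσ c).2
  rw [Finset.prod_mul_distrib, Finset.prod_mul_distrib, h2] at h3
  linear_combination LaurentPolynomial.T (∑ c, (D.shapeLo c + D.shapeHi c)) *
    subst (LaurentPolynomial.T K) * subst (LaurentPolynomial.T (2 * noninversions σ)) * h3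

end GridDiagram

namespace GridDiagram

variable {n : ℕ} (D : GridDiagram n)

/-! ### The orientation of the diagram -/

theorem admissible_rowX : D.Admissible D.rowX := by
  intro c
  have h : D.colX (D.rowX c) = c := by simp [colX]
  exact ⟨⟨min_le_left _ _, le_max_left _ _⟩, (min_le_left _ _).trans_eq h,
    h.symm.trans_le (le_max_left _ _)⟩

/-- The columns switch at the X's, so the flow leaves every X vertically: it is the orientation of
the diagram. -/
theorem flowOf_rowX_vert (c y : Fin n) (H : D.Covers (.vert c y)) :
    (D.flowOf D.rowX ⟨.vert c y, H⟩ : ℤ) = D.vdir c := by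
  obtain ⟨h1, h2⟩ := H
  unfold lo at h1
  unfold hi at h2
  simp only [flowOf, vdir]
  rcases lt_trichotomy (D.rowX c) (D.rowO c) with h | h | h
  · rw [min_eq_left h.le] at h1
    rw [if_pos h1, if_pos h, Units.val_one]
  · exact absurd h (D.ne c)
  · rw [max_eq_left h.le] at h2
    rw [if_neg h2.not_ge, if_neg h.not_gt, Units.val_neg, Units.val_one]

theorem isCrossing_rowX {c r : Fin n} (h : D.IsCrossing c r) :
    (D.rowX c < r ↔ D.vdir c = 1) ∧ (c < D.rowX.symm r ↔ D.hdir r = 1) ∧ D.rowX c ≠ r := by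
  obtain ⟨h1, h2, h3, h4⟩ := h
  have h5 := D.ne c
  have h6 := D.colX_ne_colO r
  unfold lo left at *
  unfold hi right at *
  unfold vdir hdir
  change _ ∧ (c < D.colX r ↔ _) ∧ _
  generalize D.rowX c = a at *
  generalize D.rowO c = b at *
  generalize D.colX r = x at *
  generalize D.colO r = y at *
  simp only [Fin.lt_def, Fin.coe_max, Fin.coe_min, ne_eq, Fin.ext_iff] at *
  refine ⟨?_, ?_, by omega⟩ <;> split_ifs <;> simp only [iff_true, iff_false] <;> omega

theorem negativeStraight_rowX : D.negativeStraight D.rowX = D.nNeg := by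
  unfold negativeStraight nNeg
  congr 1
  refine Finset.filter_congr fun p _ => ?_
  obtain ⟨h1, h2, h3⟩ := D.isCrossing_rowX p.2
  rw [h1, h2]
  have h4 : D.vdir p.1.1 = 1 ∨ D.vdir p.1.1 = -1 := by unfold vdir; split_ifs <;> simp
  have h5 : D.hdir p.1.2 = 1 ∨ D.hdir p.1.2 = -1 := by unfold hdir; split_ifs <;> simp
  unfold sign
  rcases h4 with h4 | h4 <;> rcases h5 with h5 | h5 <;> simp [h3, h4, h5]

/-- For a flow passing straight in both directions, one arc of the smoothing respecting it turns
left and the other turns right. -/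
theorem crossingTurn_eq_zero {x : Smoothing} {w : Dir → ℤˣ} (h1 : w .S = -w .N) (h2 : w .W = -w .E)
    (hx : x = if w .N = w .E then .B else .A) :
    crossingTurn x w = 0 ∧ ∀ d, w (x.partner d) = -w d := by
  obtain ⟨a, b, rfl⟩ : ∃ a b : ℤˣ,
      w = fun x => match x with | .N => a | .E => b | .S => -a | .W => -b :=
    ⟨w .N, w .E, funext fun d => by cases d <;> simp [h1, h2]⟩
  subst hx
  clear h1 h2
  revert a b
  decide

theorem out_rowX (p : D.Crossing) : (p.out (D.flowOf D.rowX) .S = -p.out (D.flowOf D.rowX) .N) ∧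
    (p.out (D.flowOf D.rowX) .W = -p.out (D.flowOf D.rowX) .E) ∧
    (D.orientedResolution p = if p.out (D.flowOf D.rowX) .N = p.out (D.flowOf D.rowX) .E
      then .B else .A) := by
  have h : p.out (D.flowOf D.rowX) = switchOut D.rowX D.rowX.symm p.1.1 p.1.2 :=
    funext fun d => (switchesAt_flowOf D.rowX).out_eq _
  obtain ⟨h1, h2, h3⟩ := D.isCrossing_rowX p.2
  have h4 : D.vdir p.1.1 = 1 ∨ D.vdir p.1.1 = -1 := by unfold vdir; split_ifs <;> simp
  have h5 : D.hdir p.1.2 = 1 ∨ D.hdir p.1.2 = -1 := by unfold hdir; split_ifs <;> simp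
  have h6 : D.rowX.symm p.1.2 ≠ p.1.1 := by
    rw [ne_eq, Equiv.symm_apply_eq, eq_comm]; exact h3
  have a1 : D.rowX p.1.1 ≤ p.1.2 ↔ D.vdir p.1.1 = 1 := by rw [← h1, le_iff_lt_or_eq]; simp [h3]
  have a2 : p.1.2 ≤ D.rowX p.1.1 ↔ ¬D.vdir p.1.1 = 1 := by rw [← h1, not_lt]
  have a3 : D.rowX.symm p.1.2 ≤ p.1.1 ↔ ¬D.hdir p.1.2 = 1 := by rw [← h2, not_lt]
  have a4 : p.1.1 ≤ D.rowX.symm p.1.2 ↔ D.hdir p.1.2 = 1 := by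
    rw [← h2, le_iff_lt_or_eq]; simp [h6.symm]
  rw [h]
  simp only [switchOut, a1, a2, a3, a4, orientedResolution, sign]
  rcases h4 with h4 | h4 <;> rcases h5 with h5 | h5 <;> simp [h4, h5]

theorem consistent_rowX : D.orientedResolution.Consistent (D.flowOf D.rowX) :=
  (Resolution.consistent_iff _ _).2 ⟨D.admissible_rowX.preserved, fun p =>
    (crossingTurn_eq_zero (D.out_rowX p).1 (D.out_rowX p).2.1 (D.out_rowX p).2.2).2⟩

open Classical in
theorem signedArea_eq (C : D.SeifertCircle) :
    D.signedArea C = D.orientedResolution.circleArea (D.flowOf D.rowX) C := by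
  have h1 : D.orientedResolution.circleArea (D.flowOf D.rowX) C = ∑ e : D.Edge,
      if D.orientedResolution.circle e = C then edgeAbscissa e * (D.flowOf D.rowX e : ℤ) else 0 := by
    unfold Resolution.circleArea
    rw [← Finset.sum_filter]
    exact (Finset.sum_subtype _ (fun e => by simp)
      fun e : D.Edge => edgeAbscissa e * (D.flowOf D.rowX e : ℤ)).symm
  rw [h1, signedArea, ← Fintype.sum_prod_type']
  have hcov : ∀ (p : Fin n × Fin n) (_ : Decidable (∃ h : D.Covers (.vert p.1 p.2),
      (Quotient.mk _ ⟨.vert p.1 p.2, h⟩ : D.SeifertCircle) = C)), (if ∃ h : D.Covers (.vert p.1 p.2),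
      (Quotient.mk _ ⟨.vert p.1 p.2, h⟩ : D.SeifertCircle) = C then
      (p.1 : ℤ) * D.vdir p.1 else 0) ≠ 0 → D.Covers (.vert p.1 p.2) := fun p _ hne => by
    by_contra h
    exact hne (if_neg fun ⟨h', _⟩ => h h')
  refine Finset.sum_bij_ne_zero (fun p _ hne => ⟨.vert p.1 p.2, hcov p _ hne⟩)
    (fun _ _ _ => Finset.mem_univ _) (fun p _ _ q _ _ h => ?_) (fun e _ he => ?_) (fun p _ hne => ?_)
  · have := congrArg Subtype.val h
    simp only [UnitEdge.vert.injEq] at this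
    exact Prod.ext this.1 this.2
  · obtain ⟨e, H⟩ := e
    cases e with
    | vert c y =>
      refine ⟨(c, y), Finset.mem_univ _, fun h0 => he ?_, rfl⟩
      split_ifs with h2
      · change (c : ℤ) * (D.flowOf D.rowX ⟨.vert c y, H⟩ : ℤ) = 0
        rw [flowOf_rowX_vert]
        rwa [if_pos ⟨H, h2⟩] at h0
      · rfl
    | horiz x r =>
      exact absurd (by split_ifs <;> simp [edgeAbscissa]) he
  · have H := hcov p _ hne
    by_cases h2 : D.orientedResolution.circle ⟨.vert p.1 p.2, H⟩ = C
    · rw [if_pos ⟨H, h2⟩, if_pos h2, flowOf_rowX_vert]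
      rfl
    · rw [if_neg h2, if_neg]
      rintro ⟨h, h'⟩
      exact h2 h'

/-- Smoothing along the orientation causes no net turning at crossings, so the corners carry the
total turning of the Seifert circles, four quarter turns each with its sign. -/
theorem cornerTurn_rowX : cornerTurn (D.flowOf D.rowX) = 4 * D.rot := by
  have h1 := D.consistent_rowX.turning_eq_local
  rw [Finset.sum_eq_zero fun p _ => (crossingTurn_eq_zero (D.out_rowX p).1 (D.out_rowX p).2.1
    (D.out_rowX p).2.2).1, add_zero, D.consistent_rowX.turning_eq] at h1
  rw [← h1, rot, Finset.mul_sum]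
  refine Finset.sum_congr rfl fun C _ => ?_
  rw [signedArea_eq]
  have h2 := (D.consistent_rowX.turning_circle C).1
  rcases lt_or_gt_of_ne h2 with h | h
  · rw [Int.sign_eq_neg_one_of_neg h, if_neg h.not_gt]
  · rw [Int.sign_eq_one_of_pos h, if_pos h]

theorem flowWeight_rowX : flowWeight (D.flowOf D.rowX) =
    LaurentPolynomial.T (4 * D.rot) * subst (LaurentPolynomial.T D.nNeg) := by
  have h1 : ∀ c, ¬D.IsCrossing c (D.rowX c) := fun c h => (D.isCrossing_rowX h).2.2 rfl
  rw [flowWeight, prod_crossingWeight, negativeStraight_rowX, cornerTurn_rowX,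
    Finset.prod_eq_one fun c _ => if_neg (h1 c), mul_one, ← subst_T_one, ← map_pow,
    LaurentPolynomial.T_pow, mul_one]

end GridDiagram

namespace GridDiagram

variable {n : ℕ} {D : GridDiagram n}

/-! ### Winding numbers -/

theorem edgeWinding_eq_zero {p a b : ℤ × ℤ} (h1 : ¬(a.2 ≤ p.2 ∧ p.2 < b.2))
    (h2 : ¬(b.2 ≤ p.2 ∧ p.2 < a.2)) : edgeWinding p a b = 0 := by
  unfold edgeWinding
  rw [if_neg fun h => h1 ⟨h.1, h.2.1⟩, if_neg fun h => h2 ⟨h.1, h.2.1⟩]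

theorem edgeWinding_of_snd_eq {p a b : ℤ × ℤ} (h : a.2 = b.2) : edgeWinding p a b = 0 :=
  edgeWinding_eq_zero (by omega) (by omega)

theorem edgeWinding_vertical (p : ℤ × ℤ) (x y y' : ℤ) : edgeWinding p (x, y) (x, y') =
    ind (p.1 < x) * (ind (p.2 < y') - ind (p.2 < y)) := by
  have h1 : (x - x) * (p.2 - y) - (y' - y) * (p.1 - x) = (y' - y) * (x - p.1) := by ring
  simp only [edgeWinding, h1, ind]
  by_cases hx : p.1 < x
  · have h2 : 0 < x - p.1 := by omega
    have h3 : (y' - y) * (x - p.1) < 0 ↔ y' - y < 0 :=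
      ⟨fun h => neg_of_mul_neg_left h h2.le, fun h => mul_neg_of_neg_of_pos h h2⟩
    simp only [mul_pos_iff_of_pos_right h2, h3, hx, if_true, one_mul]
    split_ifs <;> omega
  · have h2 : x - p.1 ≤ 0 := by omega
    rw [if_neg hx, zero_mul, if_neg, if_neg]
    · rintro ⟨h3, h4, h5⟩
      exact absurd (mul_nonneg_of_nonpos_of_nonpos (by omega) h2) h5.not_ge
    · rintro ⟨h3, h4, h5⟩
      exact absurd (mul_nonpos_of_nonneg_of_nonpos (by omega) h2) h5.not_ge

theorem edgeWinding_symm (p a b : ℤ × ℤ) : edgeWinding p b a = -edgeWinding p a b := by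
  have h1 : (a.1 - b.1) * (p.2 - b.2) - (a.2 - b.2) * (p.1 - b.1) =
      -((b.1 - a.1) * (p.2 - a.2) - (b.2 - a.2) * (p.1 - a.1)) := by ring
  simp only [edgeWinding, h1]
  split_ifs <;> omega

theorem pathWinding_append (p a : ℤ × ℤ) (l l' : List (ℤ × ℤ)) :
    pathWinding p (l ++ a :: l') = pathWinding p (l ++ [a]) + pathWinding p (a :: l') := by
  induction l with
  | nil => simp [pathWinding]
  | cons b l ih =>
    cases l with
    | nil => simp [pathWinding]
    | cons c l =>
      simp only [List.cons_append, pathWinding] at ih ⊢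
      rw [ih, add_assoc]

theorem pathWinding_reverse (p : ℤ × ℤ) (l : List (ℤ × ℤ)) :
    pathWinding p l.reverse = -pathWinding p l := by
  induction l with
  | nil => rfl
  | cons a l ih =>
    cases l with
    | nil => rfl
    | cons b l =>
      rw [List.reverse_cons, List.reverse_cons, List.append_assoc, List.singleton_append,
        pathWinding_append, ← List.reverse_cons, ih]
      simp only [pathWinding]
      rw [edgeWinding_symm p a b]
      ring

theorem sum_punctures (f : ℤ × ℤ → ℤ) : ∑ p ∈ D.punctures, f p =
    ∑ c, (f (center c (D.lo c)) + f (center c (D.hi c))) := by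
  have inj : ∀ σ : Equiv.Perm (Fin n), Function.Injective fun c => center c (σ c) := fun σ c c' h => by
    have := congrArg Prod.fst h
    simp only [center] at this
    omega
  unfold punctures
  rw [Finset.sum_union, Finset.sum_image fun c _ c' _ h => inj _ h,
    Finset.sum_image fun c _ c' _ h => inj _ h, ← Finset.sum_add_distrib]
  · refine Finset.sum_congr rfl fun c _ => ?_
    unfold lo hi
    rcases le_total (D.rowX c) (D.rowO c) with h | h <;> simp [h, add_comm]
  · rw [Finset.disjoint_left]
    rintro p hp hp'
    obtain ⟨c, -, rfl⟩ := Finset.mem_image.1 hp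
    obtain ⟨c', -, h⟩ := Finset.mem_image.1 hp'
    simp only [center, Prod.mk.injEq] at h
    obtain rfl : c' = c := by omega
    exact D.ne c' (by omega)

namespace FigureEights

variable (F : D.FigureEights)

/-- The winding around the punctures of the arc leading to a position on a figure-eight. -/
def arcWinding (c r : Fin n) (ε : Side) : ℤ := ∑ p ∈ D.punctures, pathWinding p (F.arcTo c r ε)

theorem exists_arcTo_eq_cons (c : Fin n) : ∃ a, ∀ r ε, ∃ l, F.arcTo c r ε = a :: l := by
  refine ⟨(4 * (c : ℤ) - 1, 4 * (D.lo c : ℤ) - 1), fun r ε => ?_⟩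
  unfold arcTo edgeIndex vertices
  cases ε <;> dsimp only <;> split_ifs <;> exact ⟨_, rfl⟩

theorem pathWinding_pathAlong (p : ℤ × ℤ) (h g : Tuple n) (c : Fin n) :
    pathWinding p (F.pathAlong h g c) = pathWinding p (F.arcTo c (g.row c) (g.side c)) -
      pathWinding p (F.arcTo c (h.row c) (h.side c)) := by
  obtain ⟨a, ha⟩ := F.exists_arcTo_eq_cons c
  obtain ⟨l, hl⟩ := ha (g.row c) (g.side c)
  obtain ⟨l', hl'⟩ := ha (h.row c) (h.side c)
  unfold pathAlong
  rw [hl, hl', pathWinding_append, List.reverse_cons, List.append_assoc, List.singleton_append,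
    pathWinding_append, ← List.reverse_cons, pathWinding_reverse]
  simp only [pathWinding]
  -- The base vertex occurs twice in succession, giving a degenerate edge of winding zero.
  rw [edgeWinding_of_snd_eq rfl]
  ring

/-- The parts of the curves along the rows do not meet the horizontal rays transversally and count
zero. The parts along the figure-eights are differences of arcs from a common base vertex, so Q
becomes a sum over columns. -/
theorem Q_eq (g : Tuple n) : F.Q g = ∑ c, F.arcWinding c (g.row c) (g.side c) -
    ∑ c, F.arcWinding c (D.genX.row c) (D.genX.side c) := by
  have h1 : ∀ (p : ℤ × ℤ) r, pathWinding p [g.ptOfRow r, D.genX.ptOfRow r] = 0 := fun p r => by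
    simp only [pathWinding]
    rw [edgeWinding_of_snd_eq]
    · rfl
    · simp [Tuple.ptOfRow, Tuple.pt, sidePoint]
  unfold Q Qrel arcWinding
  simp only [h1, pathWinding_pathAlong, Finset.sum_const_zero, zero_add, Finset.sum_sub_distrib]
  rw [Finset.sum_comm, Finset.sum_comm (s := D.punctures)]

/-- The contribution of the punctures of a column to the winding of the arcs on its own
figure-eight. -/
def ownWinding (c r : Fin n) : Side → ℤ
  | .L => if F.cut c < r then 1 else 0
  | .R => if F.cut c < r then 0 else ind (D.lo c < r)

variable {F}

theorem pathWinding_arcTo (c c' r r' : Fin n) (ε : Side) :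
    pathWinding (center c' r') (F.arcTo c r ε) =
      if F.cut c < r then
        ind (c' ≤ c) * (ind ((r' : ℕ) ≤ F.cut c) - ind (r' < D.lo c)) +
          match ε with
          | .L => ind (c' < c) * (ind (r' < r) - ind ((r' : ℕ) ≤ F.cut c))
          | .R => ind (c' < c) * (ind (r' ≤ D.hi c) - ind ((r' : ℕ) ≤ F.cut c)) +
              ind (c' ≤ c) * (ind (r' < r) - ind (r' ≤ D.hi c))
      else match ε with
        | .R => ind (c' ≤ c) * (ind (r' < r) - ind (r' < D.lo c))
        | .L => ind (c' ≤ c) * (ind ((r' : ℕ) ≤ F.cut c) - ind (r' < D.lo c)) +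
            ind (c' < c) * (ind (r' ≤ D.hi c) - ind ((r' : ℕ) ≤ F.cut c)) +
              ind (c' ≤ c) * (ind ((r' : ℕ) ≤ F.cut c) - ind (r' ≤ D.hi c)) +
              ind (c' < c) * (ind (r' < r) - ind ((r' : ℕ) ≤ F.cut c)) := by
  have x1 : (4 * (c' : ℤ) < 4 * (c : ℤ) + 1) ↔ c' ≤ c := by rw [Fin.le_def]; omega
  have x2 : (4 * (c' : ℤ) < 4 * (c : ℤ) - 1) ↔ c' < c := by rw [Fin.lt_def]; omega
  have x3 : (4 * (c' : ℤ) < 4 * (c : ℤ) + -1) ↔ c' < c := by rw [Fin.lt_def]; omega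
  have y1 : (4 * (r' : ℤ) < 4 * (D.lo c : ℤ) - 1) ↔ r' < D.lo c := by rw [Fin.lt_def]; omega
  have y2 : (4 * (r' : ℤ) < 4 * (D.hi c : ℤ) + 1) ↔ r' ≤ D.hi c := by rw [Fin.le_def]; omega
  have y3 : (4 * (r' : ℤ) < 4 * (r : ℤ)) ↔ r' < r := by rw [Fin.lt_def]; omega
  have y4 : (4 * (r' : ℤ) < 4 * (F.cut c : ℤ) + 2 - 1) ↔ (r' : ℕ) ≤ F.cut c := by omega
  have y5 : (4 * (r' : ℤ) < 4 * (F.cut c : ℤ) + 2 + 1) ↔ (r' : ℕ) ≤ F.cut c := by omega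
  -- The slanted edges at the self-intersection lie strictly between two rows of punctures, so no
  -- ray meets them.
  have d1 : ∀ x x' : ℤ, edgeWinding (4 * (c' : ℤ), 4 * (r' : ℤ))
      (x, 4 * (F.cut c : ℤ) + 2 - 1) (x', 4 * (F.cut c : ℤ) + 2 + 1) = 0 := fun x x' =>
    edgeWinding_eq_zero (by dsimp only; omega) (by dsimp only; omega)
  have d2 : ∀ x x' : ℤ, edgeWinding (4 * (c' : ℤ), 4 * (r' : ℤ))
      (x, 4 * (F.cut c : ℤ) + 2 + 1) (x', 4 * (F.cut c : ℤ) + 2 - 1) = 0 := fun x x' =>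
    edgeWinding_eq_zero (by dsimp only; omega) (by dsimp only; omega)
  have d3 : ∀ (p : ℤ × ℤ) (x x' y : ℤ), edgeWinding p (x, y) (x', y) = 0 := fun p x x' y =>
    edgeWinding_of_snd_eq rfl
  have o1 : Side.offset .L = -1 := rfl
  have o2 : Side.offset .R = 1 := rfl
  cases ε <;> by_cases h : F.cut c < r <;>
    simp only [arcTo, edgeIndex, h, if_true, if_false, vertices, List.take, List.cons_append,
      List.nil_append, pathWinding, sidePoint, center, o1, o2, ← sub_eq_add_neg, d1, d2, d3,
      edgeWinding_vertical, x1, x2, y1, y2, y3, y4, y5, add_zero, zero_add]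
  all_goals ring

/-- A puncture in a column further left sees both sides of the figure-eight on its right, so only
the heights of the ends of the arc matter. Punctures further right see nothing. Only the own column
depends on the side and on the cut. -/
theorem arcWinding_eq {c r : Fin n} {ε : Side} (h1 : D.lo c ≤ r) (h2 : r ≤ D.hi c) :
    F.arcWinding c r ε = D.southWest c r - D.southWest c (D.lo c) + F.ownWinding c r ε := by
  have e1 : F.ownWinding c r ε = ∑ c', if c' = c then F.ownWinding c r ε else 0 := by simp
  rw [e1]
  unfold arcWinding southWest
  rw [sum_punctures, ← Finset.sum_sub_distrib, ← Finset.sum_add_distrib]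
  refine Finset.sum_congr rfl fun c' _ => ?_
  have h3 := F.lo_le_cut c
  have h4 := F.cut_lt_hi c
  have h5 := D.lo_lt_hi c
  have t0 : ∀ {p : Prop} [Decidable p], ¬p → ind p = 0 := fun h => if_neg h
  have t1 : ∀ {p : Prop} [Decidable p], p → ind p = 1 := fun h => if_pos h
  rw [pathWinding_arcTo, pathWinding_arcTo]
  rcases lt_trichotomy c' c with h | h | h
  · have e2 : ∀ (p : Prop) [Decidable p], ind (c' < c ∧ p) = ind p := fun p _ => by simp [ind, h]
    rw [t1 h, t1 h.le, if_neg h.ne, e2, e2, e2, e2]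
    cases ε <;> dsimp only <;> split_ifs <;> ring
  · subst h
    have e2 : ∀ (p : Prop) [Decidable p], ind (c' < c' ∧ p) = 0 := fun p _ => by simp [ind]
    rw [t0 (lt_irrefl c'), t1 (le_refl c'), if_pos rfl, e2, e2, e2, e2, t0 (lt_irrefl (D.lo c')),
      t1 h3, t1 h5.le, t0 h5.not_gt, t0 h4.not_ge, t1 (le_refl (D.hi c')), t0 h2.not_gt]
    unfold ownWinding
    by_cases h6 : F.cut c' < r
    · have h7 : D.lo c' < r := h3.trans_lt h6
      rw [if_pos h6, if_pos h6, t1 h7]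
      cases ε <;> dsimp only
      · rw [if_pos h6]; ring
      · rw [if_pos h6]; ring
    · rw [if_neg h6, if_neg h6]
      cases ε <;> dsimp only
      · rw [if_neg h6]; ring
      · rw [if_neg h6]; ring
  · have e2 : ∀ (p : Prop) [Decidable p], ind (c' < c ∧ p) = 0 := fun p _ => by
      simp [ind, h.not_gt]
    rw [t0 h.not_gt, t0 h.not_ge, if_neg h.ne', e2, e2, e2, e2]
    cases ε <;> dsimp only <;> split_ifs <;> ring

end FigureEights

end GridDiagram

namespace GridDiagram

variable {n : ℕ} {D : GridDiagram n}

/-! ### The sum over the generators -/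

theorem isIntersection_iff {c r : Fin n} {ε : Side} : D.IsIntersection c r ε ↔
    (D.lo c ≤ r ∧ r ≤ D.hi c) ∧ (D.left r ≤ c ∧ c ≤ D.right r) ∧
      match ε with
      | .L => D.left r < c
      | .R => c < D.right r := by
  unfold IsIntersection
  simp only [Fin.lt_def, Fin.le_def]
  cases ε <;> simp only [Side.offset] <;> omega

/-- The sign of a parity. -/
noncomputable abbrev signC (k : ℤ) : ℤ[T;T⁻¹] := LaurentPolynomial.C ((k.negOnePow : ℤˣ) : ℤ)

theorem signC_add (k l : ℤ) : signC (k + l) = signC k * signC l := by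
  simp [signC, Int.negOnePow_add]

theorem signC_sum {ι : Type*} (t : Finset ι) (f : ι → ℤ) :
    signC (∑ i ∈ t, f i) = ∏ i ∈ t, signC (f i) := by
  classical
  induction t using Finset.induction_on with
  | empty => simp [signC]
  | insert a t ha ih => rw [Finset.sum_insert ha, Finset.prod_insert ha, signC_add, ih]

theorem sum_side (f : Side → ℤ[T;T⁻¹]) : ∑ ε, f ε = f .L + f .R := by
  have : (Finset.univ : Finset Side) = {.L, .R} := rfl
  rw [this, Finset.sum_pair (by decide)]

namespace FigureEights

variable (F : D.FigureEights)

/-- The weight of a position on a figure-eight. -/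
noncomputable def sideWeight (c r : Fin n) (ε : Side) : ℤ[T;T⁻¹] :=
  signC (F.p c r ε) * subst (LaurentPolynomial.T (-2 * F.arcWinding c r ε))

/-- At a crossing the two sides have weights 1 and -T^(-8), in an order depending on the cut, so
their sum does not depend on it. At a corner only one side lies on the horizontal segment. -/
theorem sum_sideWeight {c r : Fin n} (h1 : D.lo c ≤ r ∧ r ≤ D.hi c)
    (h2 : D.left r ≤ c ∧ c ≤ D.right r) :
    ∑ ε, (if D.IsIntersection c r ε then F.sideWeight c r ε else 0) =
      subst (LaurentPolynomial.T (2 * D.southWest c (D.lo c))) * D.localWeight c r := by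
  have hL : D.IsIntersection c r .L ↔ c ≠ D.left r := by
    rw [isIntersection_iff]
    exact ⟨fun h => h.2.2.ne', fun h => ⟨h1, h2, lt_of_le_of_ne h2.1 h.symm⟩⟩
  have hR : D.IsIntersection c r .R ↔ c ≠ D.right r := by
    rw [isIntersection_iff]
    exact ⟨fun h => h.2.2.ne, fun h => ⟨h1, h2, lt_of_le_of_ne h2.2 h⟩⟩
  have hlr := D.left_lt_right r
  have hlh := D.lo_lt_hi c
  have h3 := D.eq_lo_or_hi_iff c r
  have hs : ∀ ε, F.sideWeight c r ε = subst (LaurentPolynomial.T (2 * D.southWest c (D.lo c))) *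
      subst (LaurentPolynomial.T (-2 * D.southWest c r)) *
      (signC (F.p c r ε) * subst (LaurentPolynomial.T (-2 * F.ownWinding c r ε))) := fun ε => by
    rw [sideWeight, arcWinding_eq h1.1 h1.2, show -2 * (D.southWest c r - D.southWest c (D.lo c) +
      F.ownWinding c r ε) = 2 * D.southWest c (D.lo c) + -2 * D.southWest c r +
      -2 * F.ownWinding c r ε by ring, LaurentPolynomial.T_add, LaurentPolynomial.T_add, map_mul,
      map_mul]
    ring
  have w1 : subst (LaurentPolynomial.T (-2)) = LaurentPolynomial.T (-8) := by
    rw [subst_T]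
    simp [show Int.negOnePow (-2) = 1 by decide]
  have s0 : signC 0 = 1 := by simp [signC]
  have s1 : signC 1 = -1 := by simp [signC]
  have key : ∀ ε, signC (F.p c r ε) * subst (LaurentPolynomial.T (-2 * F.ownWinding c r ε)) =
      match ε with
      | .L => if F.cut c < r then -LaurentPolynomial.T (-8) else 1
      | .R => if F.cut c < r then 1 else if D.lo c < r then -LaurentPolynomial.T (-8) else -1 := by
    intro ε
    unfold FigureEights.p ownWinding ind
    cases ε <;> dsimp only <;> split_ifs <;> simp only [mul_one, mul_zero, LaurentPolynomial.T_zero,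
      map_one, s0, s1, w1, neg_one_mul]
  rw [sum_side, hs, hs, key, key]
  dsimp only
  rw [localWeight, if_congr hL rfl rfl, if_congr hR rfl rfl]
  have h4 : (D.lo c : ℕ) ≤ F.cut c := F.lo_le_cut c
  have h5 : F.cut c < (D.hi c : ℕ) := F.cut_lt_hi c
  by_cases hc : D.IsCrossing c r
  · rw [if_pos hc, if_pos hc.2.2.1.ne', if_pos hc.2.2.2.ne, if_pos hc.1]
    split_ifs <;> ring
  rw [if_neg hc]
  by_cases e1 : r = D.lo c
  · have h6 : ¬F.cut c < r := by rw [e1]; exact h4.not_gt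
    have h7 : ¬D.lo c < r := by rw [e1]; exact lt_irrefl _
    rw [if_pos e1, if_neg h6, if_neg h6, if_neg h7]
    rcases h3.1 (Or.inl e1) with e3 | e3
    · rw [if_neg (not_not.2 e3), if_pos (e3 ▸ hlr.ne), if_pos e3]; ring
    · rw [if_pos (e3 ▸ hlr.ne' : c ≠ D.left r), if_neg (not_not.2 e3),
        if_neg (e3 ▸ hlr.ne' : c ≠ D.left r)]; ring
  · have e2 : r = D.hi c := by
      by_contra e2
      have e3 : ¬(c = D.left r ∨ c = D.right r) := fun h => (h3.2 h).elim e1 e2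
      push Not at e3
      exact hc ⟨lt_of_le_of_ne h1.1 (Ne.symm e1), lt_of_le_of_ne h1.2 e2,
        lt_of_le_of_ne h2.1 e3.1.symm, lt_of_le_of_ne h2.2 e3.2⟩
    have h6 : F.cut c < r := by rw [e2]; exact h5
    rw [if_neg e1, if_pos h6, if_pos h6]
    rcases h3.1 (Or.inr e2) with e3 | e3
    · rw [if_neg (not_not.2 e3), if_pos (e3 ▸ hlr.ne), if_pos e3]; ring
    · rw [if_pos (e3 ▸ hlr.ne' : c ≠ D.left r), if_neg (not_not.2 e3),
        if_neg (e3 ▸ hlr.ne' : c ≠ D.left r)]; ring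

end FigureEights

/-- The offsets of the sides are too small to change the order of two columns, and points in one
column coincide. -/
theorem Tuple.T_eq (g : Tuple n) : g.T = noninversions g.row := by
  have inj : Function.Injective g.pt := fun c c' h => by
    have := congrArg Prod.snd h
    simp only [Tuple.pt, sidePoint] at this
    exact g.row.injective (by omega)
  unfold Tuple.T countI Tuple.points noninversions
  rw [Finset.card_filter, Finset.sum_product, Finset.sum_image fun c _ c' _ h => inj h, Nat.cast_sum]
  refine Finset.sum_congr rfl fun c _ => ?_
  rw [Finset.sum_image fun c _ c' _ h => inj h, Nat.cast_sum]
  refine Finset.sum_congr rfl fun c' _ => ?_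
  have h1 : c = c' → g.row c = g.row c' := congrArg _
  push_cast
  refine if_congr ?_ rfl rfl
  simp only [Tuple.pt, sidePoint, Fin.lt_def, Fin.ext_iff] at *
  cases g.side c <;> cases g.side c' <;> simp only [Side.offset] <;> omega

namespace FigureEights

variable (F : D.FigureEights)

/-- The term of a tuple in the state sum. -/
noncomputable def tupleWeight (g : Tuple n) : ℤ[T;T⁻¹] :=
  signC (F.P g) * LaurentPolynomial.T (F.J g)

theorem exists_tupleWeight_eq : ∃ B : ℤ[T;T⁻¹], ∀ g : Tuple n, subst (F.tupleWeight g) =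
    B * (subst (LaurentPolynomial.T (2 * noninversions g.row)) *
      ∏ c, F.sideWeight c (g.row c) (g.side c)) := by
  refine ⟨signC (-F.Pbar D.genX - D.rot - D.writhe) * subst (LaurentPolynomial.T
    (2 * ∑ c, F.arcWinding c (D.genX.row c) (D.genX.side c) - 2 * D.genX.T + D.rot + D.writhe)),
    fun g => ?_⟩
  have h1 : F.P g = -F.Pbar D.genX - D.rot - D.writhe + ∑ c, F.p c (g.row c) (g.side c) := by
    unfold FigureEights.P FigureEights.Pbar; ring
  have h2 : F.J g = 2 * ∑ c, F.arcWinding c (D.genX.row c) (D.genX.side c) - 2 * D.genX.T + D.rot +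
      D.writhe + 2 * noninversions g.row + ∑ c, -2 * F.arcWinding c (g.row c) (g.side c) := by
    rw [FigureEights.J, Q_eq, g.T_eq, ← Finset.mul_sum]; ring
  unfold sideWeight tupleWeight
  rw [map_mul, subst_C, h1, h2, LaurentPolynomial.T_add, LaurentPolynomial.T_add, T_sum, map_mul,
    map_mul, map_prod, Finset.prod_mul_distrib, ← signC_sum, ← signC, signC_add]
  ring

variable (D) in
theorem sum_generators (f : Tuple n → ℤ[T;T⁻¹]) : ∑ g ∈ D.generators, f g =
    ∑ σ : Equiv.Perm (Fin n) with D.Admissible σ, ∑ ε : Fin n → Side,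
      if ∀ c, D.IsIntersection c (σ c) (ε c) then f ⟨σ, ε⟩ else 0 := by
  have h : ∀ σ : Equiv.Perm (Fin n), ¬D.Admissible σ → ∑ ε : Fin n → Side,
      (if ∀ c, D.IsIntersection c (σ c) (ε c) then f ⟨σ, ε⟩ else 0) = 0 := fun σ hσ =>
    Finset.sum_eq_zero fun ε _ => if_neg fun H => hσ fun c =>
      ⟨(isIntersection_iff.1 (H c)).1, (isIntersection_iff.1 (H c)).2.1⟩
  rw [Finset.sum_filter_of_ne fun σ _ hne => not_not.1 fun hσ => hne (h σ hσ), generators,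
    Finset.sum_filter, ← Fintype.sum_prod_type']
  exact Finset.sum_bij' (fun g _ => (g.row, g.side)) (fun x _ => ⟨x.1, x.2⟩) (by simp) (by simp)
    (by simp) (by simp) (by simp)

/-- For a fixed permutation the sides are chosen independently, so the sum over sides factors over
the columns. -/
theorem exists_sum_tupleWeight_eq : ∃ B : ℤ[T;T⁻¹], ∀ σ, D.Admissible σ →
    ∑ ε : Fin n → Side, (if ∀ c, D.IsIntersection c (σ c) (ε c) then
      subst (F.tupleWeight ⟨σ, ε⟩) else 0) = B * D.permWeight σ := by
  obtain ⟨B, hB⟩ := F.exists_tupleWeight_eq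
  refine ⟨B * ∏ c, subst (LaurentPolynomial.T (2 * D.southWest c (D.lo c))), fun σ hσ => ?_⟩
  have h1 : ∀ ε : Fin n → Side, (if ∀ c, D.IsIntersection c (σ c) (ε c) then
      subst (F.tupleWeight ⟨σ, ε⟩) else 0) =
      B * subst (LaurentPolynomial.T (2 * noninversions σ)) * ∏ c,
        if D.IsIntersection c (σ c) (ε c) then F.sideWeight c (σ c) (ε c) else 0 := fun ε => by
    split_ifs with h
    · rw [hB, Finset.prod_congr rfl fun c _ => if_pos (h c), mul_assoc]
    · push Not at h
      obtain ⟨c, hc⟩ := h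
      rw [Finset.prod_eq_zero (Finset.mem_univ c) (if_neg hc), mul_zero]
  rw [Finset.sum_congr rfl fun ε _ => h1 ε, ← Finset.mul_sum, ← Fintype.piFinset_univ,
    ← Finset.prod_univ_sum (fun _ => Finset.univ) fun c ε =>
      if D.IsIntersection c (σ c) ε then F.sideWeight c (σ c) ε else 0,
    Finset.prod_congr rfl fun c _ => F.sum_sideWeight (hσ c).1 (hσ c).2, Finset.prod_mul_distrib,
    permWeight]
  ring

/-- An X is an end of its horizontal segment, so only one side of it meets that segment. -/
theorem sum_tupleWeight_rowX : ∑ ε : Fin n → Side,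
    (if ∀ c, D.IsIntersection c (D.rowX c) (ε c) then subst (F.tupleWeight ⟨D.rowX, ε⟩) else 0) =
      subst (F.tupleWeight D.genX) := by
  have hx : ∀ c ε, D.IsIntersection c (D.rowX c) ε ↔ ε = D.genX.side c := by
    intro c ε
    rw [isIntersection_iff]
    have h1 := D.admissible_rowX c
    have h2 : D.colX (D.rowX c) = c := by simp [colX]
    have h3 := D.colX_ne_colO (D.rowX c)
    simp only [h1, true_and, genX, left, right, h2]
    rw [h2] at h3
    rcases lt_or_gt_of_ne h3 with h | h
    · cases ε <;> simp [h, h.le]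
    · cases ε <;> simp [h, h.not_gt, h.le]
  rw [Finset.sum_eq_single D.genX.side, if_pos fun c => (hx c _).2 rfl]
  · rfl
  · exact fun ε _ hε => if_neg fun h => hε (funext fun c => (hx c _).1 (h c))
  · simp

theorem tupleWeight_genX : F.tupleWeight D.genX =
    signC (-D.rot - D.writhe) * LaurentPolynomial.T (D.rot + D.writhe) := by
  have h1 : F.P D.genX = -D.rot - D.writhe := by unfold FigureEights.P; ring
  have h2 : F.J D.genX = D.rot + D.writhe := by
    rw [FigureEights.J, Q_eq]; ring
  rw [tupleWeight, h1, h2]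

end FigureEights

theorem signC_mul_self (k : ℤ) : signC k * signC k = 1 := by
  rw [← signC_add]
  simp [signC, Int.negOnePow_even _ ⟨k, rfl⟩]

theorem signC_neg (k : ℤ) : signC (-k) = signC k := by simp [signC]

end GridDiagram

/-! ### Comparison of the two sums and determination of the constant. -/

theorem mainTheorem5 {n : ℕ} (hn : 2 ≤ n) (D : GridDiagram n) (F : D.FigureEights) :
    D.jonesPolynomial =
      ∑ g ∈ D.generators,
        LaurentPolynomial.C (((F.P g).negOnePow : ℤˣ) : ℤ) * LaurentPolynomial.T (F.J g) := by
  open GridDiagram in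
  change D.jonesPolynomial = ∑ g ∈ D.generators, F.tupleWeight g
  refine subst_injective ?_
  obtain ⟨A, hA⟩ := D.exists_flowWeight_eq
  obtain ⟨B, hB⟩ := F.exists_sum_tupleWeight_eq
  have hX := D.admissible_rowX
  have h1 := hA _ hX
  have h2 := hB _ hX
  rw [flowWeight_rowX] at h1
  rw [F.sum_tupleWeight_rowX, F.tupleWeight_genX, map_mul, subst_C, LaurentPolynomial.T_add, map_mul,
    subst_T D.rot, sub_eq_add_neg, ← signC, signC_add, signC_neg, signC_neg] at h2
  -- It divides the weight of the orientation flow, a product of units.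
  have hunit : IsUnit (D.permWeight D.rowX) := by
    refine isUnit_of_mul_isUnit_right (x := A) ?_
    rw [← h1]
    exact (LaurentPolynomial.isUnit_T _).mul ((LaurentPolynomial.isUnit_T _).map subst)
  -- Evaluated at the X's: `subst` turns q^rot(D) into (-1)^rot(D) T^(4 rot(D)), whose sign cancels
  -- the one in P(𝐱), and n₊ - 2n₋ + n₋ is the writhe.
  have hAB : signC D.writhe * (subst (LaurentPolynomial.T (D.nPos - 2 * D.nNeg)) * A) = B := by
    refine hunit.mul_right_cancel ?_
    rw [← h2, D.writhe_eq, mul_assoc, mul_assoc, ← h1, sub_eq_add_neg, sub_eq_add_neg,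
      show (D.nPos : ℤ) + -(2 * D.nNeg) = D.nPos + -D.nNeg + -D.nNeg by ring,
      LaurentPolynomial.T_add (_ + _), map_mul]
    have h3 : subst (LaurentPolynomial.T (-D.nNeg)) * subst (LaurentPolynomial.T D.nNeg) = 1 := by
      rw [← map_mul, ← LaurentPolynomial.T_add, neg_add_cancel, LaurentPolynomial.T_zero, map_one]
    have h4 := signC_mul_self D.rot
    unfold signC at *
    linear_combination LaurentPolynomial.C (((D.nPos + -D.nNeg : ℤ).negOnePow : ℤˣ) : ℤ) *
      subst (LaurentPolynomial.T (D.nPos + -D.nNeg : ℤ)) *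
      LaurentPolynomial.T (4 * D.rot) * (h3 - h4)
  rw [subst_jonesPolynomial, sum_preserved, map_sum, FigureEights.sum_generators,
    Finset.sum_congr rfl fun σ hσ => hA σ (Finset.mem_filter.1 hσ).2,
    Finset.sum_congr rfl fun σ hσ => (hB σ (Finset.mem_filter.1 hσ).2), ← Finset.mul_sum,
    ← Finset.mul_sum, ← hAB]
  ring
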